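/- Let $k'>0$ and $\mu>0$ be real numbers and $k=k'+\tfrac14$. Let $\mathcal D^J_1=\{\varsigma=(z,w)\in\mathbb C^2:\ |w|<1\}$ be the Siegel–Jacobi disk and $G^J_1=H_1\ltimes SU(1,1)$ the Jacobi group, where $H_1=\mathbb C\times\mathbb R$ is the Heisenberg group; $(g,\alpha)$ with $g=\begin{pmatrix}a&b\\ \bar b&\bar a\end{pmatrix}$, $|a|^2-|b|^2=1$, $\alpha\in\mathbb C$, acts by $(z,w)\mapsto\left(\frac{z+\alpha-\bar\alpha w}{\bar bw+\bar a},\frac{aw+b}{\bar bw+\bar a}\right)$, and the center of $H_1$ acts trivially. Put $P=1-|w|^2$, $\eta=(z+\bar zw)/P$, $\mathcal A=dz+\bar\eta\,dw$ and $$\omega_{k\mu}=i\Big(2k\frac{dw\wedge d\bar w}{P^2}+\mu\frac{\mathcal A\wedge\bar{\mathcal A}}{P}\Big),\qquad K_k(w,\bar w')=(1-w\bar w')^{-2k},$$ $$F(\varsigma,\bar\varsigma')=\frac{2z\bar z'+z^2\bar w'+\bar z'^2w}{2(1-w\bar w')},\quad F(\varsigma)=F(\varsigma,\bar\varsigma),\quad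 K_{k\mu}(\varsigma,\bar\varsigma')=K_k(w,\bar w')\,e^{\mu F(\varsigma,\bar\varsigma')},$$ and for $n,m\in\{0,1,2,\dots\}$ $$f_{nk'm}(z,w)=\sqrt{\frac{\Gamma(m+2k')}{m!\,\Gamma(2k')}}\,w^m\,\frac{P_n(\sqrt\mu z,w)}{\sqrt{n!}},\qquad P_n(z,w)=n!\sum_{p=0}^{[n/2]}\Big(\frac w2\Big)^p\frac{z^{n-2p}}{p!\,(n-2p)!}.$$ Powers with real exponents of complex numbers are principal values. Write $\omega_{FS}$ for the Fubini–Study two-form on $\mathbb{CP}^\infty=\mathbb P(\ell^2)$, normalized so that a local holomorphic lift $\Phi$ pulls it back to $i\partial\bar\partial\ln(\Phi,\Phi)$. 1. $G^J_1$ is a CS-group and $\mathcal D^J_1$ with $\omega_{k\mu}$ is a quantizable Kähler CS-manifold. That is: $\omega_{k\mu}$ is a Kähler form; $G^J_1$ acts continuously and transitively on $\mathcal D^J_1$ by holomorphic maps preserving $\omega_{k\mu}$; there is an injective holomorphic immersion $\iota:\mathcal D^J_1\hookrightarrow\mathbb{CP}^\infty$ with $\omega_{k\mu}=\iota^*\omega_{FS}$,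 such that every $g\in G^J_1$ acts on the image as a unitary operator of $\ell^2$; moreover $\omega_{k\mu}=i\partial\bar\partial\ln K_{k\mu}(\varsigma,\bar\varsigma)$, and there is a holomorphic line bundle with hermitian metric, given by $1/K_{k\mu}(\varsigma,\bar\varsigma)$ in holomorphic frames, and with a connection compatible with the metric and the complex structure, whose curvature is $-i\omega_{k\mu}$. 2. $K_{k\mu}(\varsigma,\bar\varsigma')=\sum_{n,m\ge0}f_{nk'm}(\varsigma)\overline{f_{nk'm}(\varsigma')}$ on $\mathcal D^J_1\times\mathcal D^J_1$. If moreover $k>\tfrac34$, let $\mathfrak F_{k\mu}=L^2_{\mathrm{hol}}(\mathcal D^J_1,\rho_{k\mu})$ be the space of holomorphic functions on $\mathcal D^J_1$ of finite norm for $$(f,g)=\int_{\mathcal D^J_1}\bar f g\,\rho_{k\mu}\,d\nu,\quad \rho_{k\mu}=\frac{4k-3}{2\pi^2}P^{2k}e^{-\mu F(\varsigma)},\quad d\nu=\mu\,\frac{d\Re w\,d\Im w\,d\Re z\,d\Im z}{P^3}.$$ Then the weight $\rho_{k\mu}\,\mu P^{-3}$ equals $\frac{4k-3}{2\pi^2}\cdot\frac1{2k}\cdot\mathcal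 G/K_{k\mu}(\varsigma,\bar\varsigma)$, where $\mathcal G=\det(\partial_i\bar\partial_j\ln K_{k\mu}(\varsigma,\bar\varsigma))$; $\mathfrak F_{k\mu}$ is a Hilbert space with orthonormal basis $(f_{nk'm})_{n,m\ge0}$ and reproducing kernel $K_{k\mu}$; and it is the Fock space of the coherent states: if $\mathfrak H$ is a Hilbert space with vectors $e_{\bar\varsigma}$ ($\varsigma\in\mathcal D^J_1$) that span a dense subspace and satisfy $(e_{\bar\varsigma},e_{\bar\varsigma'})=K_{k\mu}(\varsigma,\bar\varsigma')$, then $\psi\mapsto(e_{\bar\varsigma},\psi)$ is a unitary map of $\mathfrak H$ onto $\mathfrak F_{k\mu}$. 3. For every enumeration $(\varphi_N)_{N\ge0}$ of the family $(f_{nk'm})_{n,m\ge 0}$, the map $\iota=[\varphi_0:\varphi_1:\cdots]$ is an embedding as in 1; in particular $\omega_{k\mu}=\iota^*\omega_{FS}$. 4. For a kernel $K$ let $\kappa(x,\bar y)=K(x,\bar y)/\sqrt{K(x,\bar x)K(y,\bar y)}$ be the normalized Bergman kernel, $b=|\kappa|^2$ the Berezin kernel and $D=-\ln b$ Calabi's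 diastasis. Those of $K_k$ (on $|w|<1$) and $K_{k\mu}$ satisfy, for all $\varsigma,\varsigma'\in\mathcal D^J_1$, $$\kappa_k(w,\bar w')=\left[\frac{(1-|w|^2)(1-|w'|^2)}{(1-w\bar w')^2}\right]^k,\qquad \kappa_{k\mu}(\varsigma,\bar\varsigma')=\kappa_k(w,\bar w')\,e^{\mu\left(F(\varsigma,\bar\varsigma')-\frac12(F(\varsigma)+F(\varsigma'))\right)},$$ $$b_{k\mu}(\varsigma,\varsigma')=b_k(w,w')\,e^{\mu\left(2\Re F(\varsigma,\bar\varsigma')-F(\varsigma)-F(\varsigma')\right)},$$ $$\tfrac12D_{k\mu}(\varsigma,\varsigma')=k\ln\frac{|1-w\bar w'|^2}{(1-|w|^2)(1-|w'|^2)}+\mu\Big[\frac{F(\varsigma)+F(\varsigma')}2-\Re F(\varsigma,\bar\varsigma')\Big].$$ -/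

import Mathlib

open Complex MeasureTheory Set
open scoped ContDiff ComplexConjugate InnerProductSpace LinearAlgebra.Projectivization

noncomputable section

namespace SiegelJacobi

/-! ### Complex differential calculus on open subsets of a complex normed space -/

section Calculus

variable {E : Type*} [NormedAddCommGroup E] [NormedSpace ℂ E]

/-- The Wirtinger derivative `∂_X f`, of type `(1,0)` in the vector `X`. -/
def wirtinger (f : E → ℂ) (X x : E) : ℂ :=
  (fderiv ℝ f x X - I * fderiv ℝ f x (I • X)) / 2

/-- The conjugate Wirtinger derivative `∂̄_X f`, of type `(0,1)` in the vector `X`. -/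
def wirtingerBar (f : E → ℂ) (X x : E) : ℂ :=
  (fderiv ℝ f x X + I * fderiv ℝ f x (I • X)) / 2

/-- The mixed derivative `∑ (∂²f / ∂z_i ∂z̄_j) X_i conj Y_j`. -/
def leviForm (f : E → ℂ) (x X Y : E) : ℂ :=
  wirtinger (fun y => wirtingerBar f Y y) X x

/-- The wedge product of two complex valued one-forms,
`(a ∧ b) (X, Y) = a X * b Y - a Y * b X`. -/
def wedge (a b : E →L[ℝ] ℂ) : E [⋀^Fin 2]→L[ℝ] ℂ :=
  ContinuousMultilinearMap.alternatization
    ((ContinuousMultilinearMap.mkPiAlgebra ℝ (Fin 2) ℂ).compContinuousLinearMap ![a, b])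

theorem wedge_apply (a b : E →L[ℝ] ℂ) (X Y : E) :
    wedge a b ![X, Y] = a X * b Y - a Y * b X := by
  have h : (Finset.univ : Finset (Equiv.Perm (Fin 2))) = {1, Equiv.swap 0 1} := by decide
  have h' : (1 : Equiv.Perm (Fin 2)) ≠ Equiv.swap 0 1 := by decide
  rw [wedge, ContinuousMultilinearMap.alternatization_apply_apply, h, Finset.sum_pair h']
  simp [Fin.prod_univ_two, sub_eq_add_neg]

/-- The complex conjugate of a one-form. -/
def conjForm (a : E →L[ℝ] ℂ) : E →L[ℝ] ℂ :=
  (Complex.conjCLE : ℂ →L[ℝ] ℂ).comp a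

/-- A Kähler two-form on the open set `M`: a smooth, real, closed `(1,1)`-form whose associated
hermitian form is positive definite. -/
structure IsKahlerForm (M : Set E) (Ω : E → E [⋀^Fin 2]→L[ℝ] ℂ) : Prop where
  isOpen : IsOpen M
  smooth : ContDiffOn ℝ ∞ Ω M
  real : ∀ x ∈ M, ∀ X Y, (Ω x ![X, Y]).im = 0
  type_one_one : ∀ x ∈ M, ∀ X Y, Ω x ![I • X, I • Y] = Ω x ![X, Y]
  pos : ∀ x ∈ M, ∀ X, X ≠ 0 → 0 < (Ω x ![X, I • X]).re
  closed : ∀ x ∈ M, extDeriv Ω x = 0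

/-- `M` with the Kähler form `Ω` is a homogeneous Kähler manifold `G / H`: the topological
group `G` acts continuously and transitively by holomorphic maps preserving `Ω`. -/
structure IsHomogeneousKahler (G : Type*) [Group G] [TopologicalSpace G] (M : Set E)
    [MulAction G M] (Ω : E → E [⋀^Fin 2]→L[ℝ] ℂ) : Prop where
  kahler : IsKahlerForm M Ω
  continuous_smul : Continuous fun p : G × M => p.1 • p.2
  transitive : MulAction.IsPretransitive G M
  automorphism : ∀ g : G, ∃ φ : E → E, DifferentiableOn ℂ φ M ∧
    (∀ x : M, φ x = ((g • x : M) : E)) ∧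
    ∀ x ∈ M, ∀ X Y, Ω (φ x) ![fderiv ℂ φ x X, fderiv ℂ φ x Y] = Ω x ![X, Y]

end Calculus

/-! ### Projective Hilbert space -/

section Projective

variable {H : Type*} [NormedAddCommGroup H] [InnerProductSpace ℂ H]

/-- The Fubini-Study hermitian form at the line through `v`, evaluated on lifts of tangent
vectors; it is linear in `X` and antilinear in `Y`. -/
def fubiniStudyMetric (v X Y : H) : ℂ :=
  (⟪Y, X⟫_ℂ * ⟪v, v⟫_ℂ - ⟪v, X⟫_ℂ * ⟪Y, v⟫_ℂ) / ⟪v, v⟫_ℂ ^ 2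

/-- The Fubini-Study two-form, `Ω = i ∑ h_{ij̄} dz_i ∧ dz̄_j`. -/
def fubiniStudyForm (v X Y : H) : ℂ :=
  I * (fubiniStudyMetric v X Y - fubiniStudyMetric v Y X)

/-- The Fubini-Study metric does not depend on the vector representing a point of the
projective space nor on the lifts of the tangent vectors. -/
theorem fubiniStudyMetric_lift (v X Y : H) (c a b : ℂ) (hc : c ≠ 0) (hv : v ≠ 0) :
    fubiniStudyMetric (c • v) (c • X + a • v) (c • Y + b • v) = fubiniStudyMetric v X Y := by
  have h1 : ⟪v, v⟫_ℂ ≠ 0 := inner_self_ne_zero.mpr hv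
  have h2 : (starRingEnd ℂ) c ≠ 0 := by simpa using hc
  simp only [fubiniStudyMetric, inner_add_left, inner_add_right, inner_smul_left,
    inner_smul_right]
  field_simp
  ring

variable {E : Type*} [NormedAddCommGroup E] [NormedSpace ℂ E] {M : Set E}

/-- `F` is a holomorphic lift to `H ∖ 0` of the map `f : M → ℙ(H)` over the open set `U`. -/
structure IsLocalLift (f : M → ℙ ℂ H) (U : Set E) (F : E → H) : Prop where
  isOpen : IsOpen U
  subset : U ⊆ M
  differentiableOn : DifferentiableOn ℂ F U
  lift : ∀ x : M, (x : E) ∈ U → ∃ h : F x ≠ 0, f x = Projectivization.mk ℂ (F x) h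

/-- A holomorphic embedding of `M` in the projective space of `H`, that is, an injective
holomorphic immersion. The kernel of the projection `H ∖ 0 → ℙ(H)` on tangent vectors at
`v` is the line through `v`. -/
structure IsHolomorphicEmbedding (f : M → ℙ ℂ H) : Prop where
  holomorphic : ∀ x ∈ M, ∃ U F, x ∈ U ∧ IsLocalLift f U F
  immersion : ∀ U F, IsLocalLift f U F → ∀ x ∈ U, ∀ X : E,
    fderiv ℂ F x X ∈ Submodule.span ℂ {F x} → X = 0
  injective : Function.Injective f

/-- `Ω` is the pullback by `f : M → ℙ(H)` of the Fubini-Study form. -/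
def IsFubiniStudyPullback (f : M → ℙ ℂ H) (Ω : E → E [⋀^Fin 2]→L[ℝ] ℂ) : Prop :=
  ∀ U F, IsLocalLift f U F → ∀ x ∈ U, ∀ X Y : E,
    Ω x ![X, Y] = fubiniStudyForm (F x) (fderiv ℂ F x X) (fderiv ℂ F x Y)

/-- A Kähler embedding of `M` onto an orbit in `ℙ(H)` on which `G` acts through unitary
operators of `H`. -/
structure IsCSEmbedding (G : Type*) [Group G] [MulAction G M]
    (Ω : E → E [⋀^Fin 2]→L[ℝ] ℂ) (f : M → ℙ ℂ H) : Prop where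
  embedding : IsHolomorphicEmbedding f
  pullback : IsFubiniStudyPullback f Ω
  equivariant : ∀ g : G, ∃ u : H ≃ₗᵢ[ℂ] H, ∀ x : M,
    f (g • x) = Projectivization.map u.toLinearEquiv.toLinearMap u.injective (f x)

end Projective

/-- The Hilbert space `ℓ²(ℕ)`, whose projective space is `ℂP^∞`. -/
abbrev ell2 : Type := lp (fun _ : ℕ => ℂ) 2

section Quantization

variable {E : Type*} [NormedAddCommGroup E] [NormedSpace ℂ E]

/-- `M` is a CS-manifold `G / H` and `G` is the corresponding CS-group: a homogeneous Kähler
manifold with an embedding as a `G`-orbit in `ℂP^∞` which induces its Kähler form. -/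
structure IsCSManifold (G : Type*) [Group G] [TopologicalSpace G] (M : Set E) [MulAction G M]
    (Ω : E → E [⋀^Fin 2]→L[ℝ] ℂ) : Prop where
  homogeneous : IsHomogeneousKahler G M Ω
  exists_embedding : ∃ f : M → ℙ ℂ ell2, IsCSEmbedding G Ω f

/-- A holomorphic hermitian line bundle with connection on `M`, described by local holomorphic
frames `e_i` over the sets `U i` of an open cover of `M`:
`e_j = g_{ij} e_i`, `hhat i = h(e_i, e_i)`, `∇ e_i = θ_i e_i`; the connection is compatible with
the metric and with the complex structure. -/
structure HermitianLineBundle (M : Set E) where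
  ι : Type
  U : ι → Set E
  isOpen : ∀ i, IsOpen (U i)
  cover : ⋃ i, U i = M
  g : ι → ι → E → ℂ
  g_holomorphic : ∀ i j, DifferentiableOn ℂ (g i j) (U i ∩ U j)
  g_ne_zero : ∀ i j, ∀ x ∈ U i ∩ U j, g i j x ≠ 0
  cocycle : ∀ i j l, ∀ x ∈ U i ∩ U j ∩ U l, g i j x * g j l x = g i l x
  hhat : ι → E → ℝ
  hhat_smooth : ∀ i, ContDiffOn ℝ ∞ (hhat i) (U i)
  hhat_pos : ∀ i, ∀ x ∈ U i, 0 < hhat i x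
  hhat_change : ∀ i j, ∀ x ∈ U i ∩ U j, hhat j x = ‖g i j x‖ ^ 2 * hhat i x
  θ : ι → E → E →L[ℝ] ℂ
  θ_smooth : ∀ i, ContDiffOn ℝ ∞ (θ i) (U i)
  θ_change : ∀ i j, ∀ x ∈ U i ∩ U j, ∀ X,
    θ j x X = θ i x X + fderiv ℂ (g i j) x X / g i j x
  metric_compatible : ∀ i, ∀ x ∈ U i, ∀ X,
    ((fderiv ℝ (hhat i) x X : ℝ) : ℂ) = (θ i x X + conj (θ i x X)) * hhat i x
  type_one_zero : ∀ i, ∀ x ∈ U i, ∀ X, θ i x (I • X) = I * θ i x X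

/-- The curvature `F(X, Y) = ∇_X ∇_Y - ∇_Y ∇_X - ∇_{[X, Y]}` in the frame `e_i`. -/
def HermitianLineBundle.curvature {M : Set E} (L : HermitianLineBundle M) (i : L.ι)
    (x X Y : E) : ℂ :=
  fderiv ℝ (L.θ i) x X Y - fderiv ℝ (L.θ i) x Y X

/-- `Ω = i ∂∂̄ ln K(z, z̄)`. -/
def IsBalancedForm (M : Set E) (K : E → E → ℂ) (Ω : E → E [⋀^Fin 2]→L[ℝ] ℂ) : Prop :=
  ∀ x ∈ M, ∀ X Y, Ω x ![X, Y] =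
    I * (leviForm (fun y => Complex.log (K y y)) x X Y -
      leviForm (fun y => Complex.log (K y y)) x Y X)

/-- `(M, Ω)` is quantizable with kernel function `K`: `Ω = i ∂∂̄ ln K`, and there is a
holomorphic hermitian line bundle with connection whose curvature is `-i Ω` and whose metric in
the coherent state frames is `1 / K`. -/
def IsQuantizable (M : Set E) (K : E → E → ℂ) (Ω : E → E [⋀^Fin 2]→L[ℝ] ℂ) : Prop :=
  IsBalancedForm M K Ω ∧
  ∃ L : HermitianLineBundle M,
    (∀ i, ∀ x ∈ L.U i, ∀ X Y, L.curvature i x X Y = -I * Ω x ![X, Y]) ∧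
    ∀ i, ∀ x ∈ L.U i, (L.hhat i x : ℂ) = (K x x)⁻¹

/-- The space of functions holomorphic on `M` and square integrable for `ν`, with the scalar
product `(f, g) = ∫ conj f * g dν`, as a subspace of `L²(ν)`; it is used for measures carried
by `M`. -/
def holomorphicL2 [MeasurableSpace E] (M : Set E) (ν : Measure E) :
    Submodule ℂ (Lp ℂ 2 ν) where
  carrier := {f | ∃ φ : E → ℂ, DifferentiableOn ℂ φ M ∧ f =ᵐ[ν] φ}
  zero_mem' := ⟨0, differentiableOn_const 0, Lp.coeFn_zero ℂ 2 ν⟩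
  add_mem' := by
    rintro f g ⟨φ, hφ, hf⟩ ⟨ψ, hψ, hg⟩
    exact ⟨φ + ψ, hφ.add hψ, (Lp.coeFn_add f g).trans (hf.add hg)⟩
  smul_mem' := by
    rintro c f ⟨φ, hφ, hf⟩
    exact ⟨c • φ, hφ.const_smul c, (Lp.coeFn_smul c f).trans (hf.const_smul c)⟩

/-- `K` is the reproducing kernel of `holomorphicL2 M ν`. -/
def IsReproducingKernel [MeasurableSpace E] (M : Set E) (ν : Measure E) (K : E → E → ℂ) : Prop :=
  ∀ y ∈ M, DifferentiableOn ℂ (fun x => K x y) M ∧ MemLp (fun x => K x y) 2 ν ∧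
    ∀ φ : E → ℂ, DifferentiableOn ℂ φ M → MemLp φ 2 ν → φ y = ∫ x, conj (K x y) * φ x ∂ν

/-- The vectors `e x` (`x ∈ M`) of the Hilbert space `H` are a total system of coherent vectors
with kernel `K`. -/
def IsCoherentSystem {H : Type*} [NormedAddCommGroup H] [InnerProductSpace ℂ H] (M : Set E)
    (K : E → E → ℂ) (e : E → H) : Prop :=
  (∀ x ∈ M, ∀ y ∈ M, ⟪e x, e y⟫_ℂ = K x y) ∧
    (Submodule.span ℂ (e '' M)).topologicalClosure = ⊤

/-- The evaluation map `ψ ↦ (e x, ψ)` is a unitary map of `H` onto `holomorphicL2 M ν`. -/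
def IsFockRealization {H : Type*} [NormedAddCommGroup H] [InnerProductSpace ℂ H]
    [MeasurableSpace E] (M : Set E) (ν : Measure E) (e : E → H) : Prop :=
  ∃ u : H ≃ₗᵢ[ℂ] holomorphicL2 M ν, ∀ ψ : H,
    DifferentiableOn ℂ (fun x => ⟪e x, ψ⟫_ℂ) M ∧
    ((u ψ : Lp ℂ 2 ν) : E → ℂ) =ᵐ[ν] fun x => ⟪e x, ψ⟫_ℂ

end Quantization

/-- The normalized Bergman kernel `K(x, ȳ) / √(K(x, x̄) K(y, ȳ))`. -/
def normalizedKernel {X : Type*} (K : X → X → ℂ) (x y : X) : ℂ :=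
  K x y / Real.sqrt ((K x x).re * (K y y).re)

/-- The Berezin kernel. -/
def berezinKernel {X : Type*} (K : X → X → ℂ) (x y : X) : ℝ :=
  ‖normalizedKernel K x y‖ ^ 2

/-- Calabi's diastasis. -/
def diastasis {X : Type*} (K : X → X → ℂ) (x y : X) : ℝ :=
  -Real.log (berezinKernel K x y)

/-! ### The Siegel-Jacobi disk -/

/-- The Siegel-Jacobi disk, with points `ς = (z, w)`. -/
def disk : Set (ℂ × ℂ) := {p | ‖p.2‖ < 1}

/-- The function `P = 1 - |w|²`. -/
def pFun (x : ℂ × ℂ) : ℝ := 1 - ‖x.2‖ ^ 2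

/-- `F(ς, ς̄')`. -/
def fFun (x y : ℂ × ℂ) : ℂ :=
  (2 * conj y.1 * x.1 + x.1 ^ 2 * conj y.2 + conj y.1 ^ 2 * x.2) / (2 * (1 - x.2 * conj y.2))

/-- The kernel `(1 - w w̄')^{-2k}` of the Siegel disk (principal branch; the base has positive
real part on the disk). -/
def diskKernel (k : ℝ) (w w' : ℂ) : ℂ := (1 - w * conj w') ^ (-(2 * k : ℝ) : ℂ)

/-- The kernel `K_{kμ}` of the Siegel-Jacobi disk. -/
def jacobiKernel (k μ : ℝ) (x y : ℂ × ℂ) : ℂ :=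
  diskKernel k x.2 y.2 * Complex.exp (μ * fFun x y)

/-- `η = (z + z̄ w) / P`. -/
def eta (x : ℂ × ℂ) : ℂ := (x.1 + conj x.1 * x.2) / pFun x

/-- The coordinate one-form `dz`. -/
def dz : ℂ × ℂ →L[ℝ] ℂ := ContinuousLinearMap.fst ℝ ℂ ℂ

/-- The coordinate one-form `dw`. -/
def dw : ℂ × ℂ →L[ℝ] ℂ := ContinuousLinearMap.snd ℝ ℂ ℂ

/-- The one-form `𝒜 = dz + η̄ dw`. -/
def aForm (x : ℂ × ℂ) : ℂ × ℂ →L[ℝ] ℂ := dz + conj (eta x) • dw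

/-- The Kähler two-form
`ω_{kμ} = i (2k dw ∧ dw̄ / P² + μ 𝒜 ∧ 𝒜̄ / P)`. -/
def omega (k μ : ℝ) (x : ℂ × ℂ) : (ℂ × ℂ) [⋀^Fin 2]→L[ℝ] ℂ :=
  I • ((2 * k / pFun x ^ 2) • wedge dw (conjForm dw) +
    (μ / pFun x) • wedge (aForm x) (conjForm (aForm x)))

/-- The monomials `f_{mk'}(w)`. -/
def diskBasis (k' : ℝ) (m : ℕ) (w : ℂ) : ℂ :=
  Real.sqrt (Real.Gamma (m + 2 * k') / (m.factorial * Real.Gamma (2 * k'))) * w ^ m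

/-- The polynomials `P_n(z, w)`. -/
def matchingPoly (n : ℕ) (z w : ℂ) : ℂ :=
  n.factorial * ∑ p ∈ Finset.range (n / 2 + 1),
    (w / 2) ^ p * (z ^ (n - 2 * p) / (p.factorial * (n - 2 * p).factorial))

/-- The polynomials `f_{nk'm}(z, w)`. -/
def jacobiBasis (k' μ : ℝ) (n m : ℕ) (x : ℂ × ℂ) : ℂ :=
  diskBasis k' m x.2 * (matchingPoly n (Real.sqrt μ * x.1) x.2 / Real.sqrt n.factorial)

/-- The density with respect to `dRe z dIm z dRe w dIm w` of `ρ_{kμ} dν`, where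
`ρ_{kμ} = Λ P^{2k} exp (-μ (2|z|² + z² w̄ + z̄² w) / (2P))`, `Λ = (4k - 3) / (2π²)` and
`dν = μ P^{-3} dRe w dIm w dRe z dIm z`. -/
def fockDensity (k μ : ℝ) (x : ℂ × ℂ) : ℝ :=
  (4 * k - 3) / (2 * Real.pi ^ 2) * pFun x ^ (2 * k) *
    Real.exp (-μ * ((2 * ‖x.1‖ ^ 2 + 2 * (x.1 ^ 2 * conj x.2).re) / (2 * pFun x))) *
    (μ / pFun x ^ 3)

/-- The measure `ρ_{kμ} dν` on the Siegel-Jacobi disk. -/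
def fockMeasure (k μ : ℝ) : Measure (ℂ × ℂ) :=
  (volume.restrict disk).withDensity fun x => ENNReal.ofReal (fockDensity k μ x)

/-- The density `𝒢 = det (h_{ij̄})` of the metric `h_{ij̄} = ∂_i ∂̄_j ln K_{kμ}`. -/
def volumeDensity (k μ : ℝ) (x : ℂ × ℂ) : ℂ :=
  Matrix.det (Matrix.of fun i j : Fin 2 =>
    leviForm (fun y => Complex.log (jacobiKernel k μ y y)) x
      ((![(1, 0), (0, 1)] : Fin 2 → ℂ × ℂ) i) ((![(1, 0), (0, 1)] : Fin 2 → ℂ × ℂ) j))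

/-! ### The Jacobi group and its action -/

/-- The Heisenberg group `H₁`. -/
@[ext] structure Heisenberg where
  α : ℂ
  t : ℝ

namespace Heisenberg

instance : Mul Heisenberg := ⟨fun h h' => ⟨h.α + h'.α, h.t + h'.t + (h.α * conj h'.α).im⟩⟩
instance : One Heisenberg := ⟨⟨0, 0⟩⟩
instance : Inv Heisenberg := ⟨fun h => ⟨-h.α, -h.t⟩⟩

@[simp] theorem mul_α (h h' : Heisenberg) : (h * h').α = h.α + h'.α := rfl
@[simp] theorem mul_t (h h' : Heisenberg) :
    (h * h').t = h.t + h'.t + (h.α * conj h'.α).im := rfl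
@[simp] theorem one_α : (1 : Heisenberg).α = 0 := rfl
@[simp] theorem one_t : (1 : Heisenberg).t = 0 := rfl
@[simp] theorem inv_α (h : Heisenberg) : (h⁻¹).α = -h.α := rfl
@[simp] theorem inv_t (h : Heisenberg) : (h⁻¹).t = -h.t := rfl

instance : Group Heisenberg :=
  Group.ofLeftAxioms
    (fun a b c => by ext <;> simp <;> ring)
    (fun a => by ext <;> simp)
    (fun a => by ext <;> simp; ring)

end Heisenberg

/-- The group `SU(1,1)` of matrices `(a, b; b̄, ā)` with `|a|² - |b|² = 1`. -/
def su11 : Subgroup (Matrix.SpecialLinearGroup (Fin 2) ℂ) where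
  carrier := {g | g 1 0 = conj (g 0 1) ∧ g 1 1 = conj (g 0 0)}
  one_mem' := by simp
  mul_mem' := by
    rintro g h ⟨h1, h2⟩ ⟨h3, h4⟩
    simp only [mem_ofPred_eq, Matrix.SpecialLinearGroup.coe_mul, Matrix.mul_apply,
      Fin.sum_univ_two, map_add, map_mul] at *
    rw [h1, h2, h3, h4]
    simp only [conj_conj]
    constructor <;> ring
  inv_mem' := by
    rintro g ⟨h1, h2⟩
    simp only [mem_ofPred_eq, Matrix.SpecialLinearGroup.coe_inv, Matrix.adjugate_fin_two]
    simp [h1, h2]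

/-- `SU(1,1)` as a type. -/
abbrev SU11 : Type := su11

/-- The matrix entry `a`. -/
def SU11.a (g : SU11) : ℂ := g.1 0 0

/-- The matrix entry `b`. -/
def SU11.b (g : SU11) : ℂ := g.1 0 1

namespace SU11

theorem det_eq (g : SU11) : g.a * conj g.a - g.b * conj g.b = 1 := by
  have h := Matrix.det_fin_two g.1.1
  rw [g.1.2] at h
  have h1 : g.1.1 1 0 = conj (g.1.1 0 1) := g.2.1
  have h2 : g.1.1 1 1 = conj (g.1.1 0 0) := g.2.2
  rw [h1, h2] at h
  exact h.symm

@[simp] theorem one_a : (1 : SU11).a = 1 := by simp [SU11.a]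
@[simp] theorem one_b : (1 : SU11).b = 0 := by simp [SU11.b]

@[simp] theorem mul_a (g h : SU11) : (g * h).a = g.a * h.a + g.b * conj h.b := by
  have h1 : h.1.1 1 0 = conj (h.1.1 0 1) := h.2.1
  change (g.1.1 * h.1.1) 0 0 = _
  rw [Matrix.mul_apply, Fin.sum_univ_two, h1]
  rfl

@[simp] theorem mul_b (g h : SU11) : (g * h).b = g.a * h.b + g.b * conj h.a := by
  have h1 : h.1.1 1 1 = conj (h.1.1 0 0) := h.2.2
  change (g.1.1 * h.1.1) 0 1 = _
  rw [Matrix.mul_apply, Fin.sum_univ_two, h1]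
  rfl

theorem normSq_eq (g : SU11) : ‖g.a‖ ^ 2 - ‖g.b‖ ^ 2 = 1 := by
  have h := g.det_eq
  rw [Complex.mul_conj, Complex.mul_conj, Complex.normSq_eq_norm_sq,
    Complex.normSq_eq_norm_sq] at h
  exact_mod_cast h

/-- `|b̄ w + ā|² - |a w + b|² = 1 - |w|²`. -/
theorem norm_sub (g : SU11) (w : ℂ) :
    ‖conj g.b * w + conj g.a‖ ^ 2 - ‖g.a * w + g.b‖ ^ 2 = 1 - ‖w‖ ^ 2 := by
  have h := g.det_eq
  rw [← Complex.ofReal_inj]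
  push_cast
  simp only [← Complex.mul_conj', map_add, map_mul, conj_conj]
  linear_combination (1 - w * conj w) * h

theorem delta_ne_zero (g : SU11) {w : ℂ} (hw : ‖w‖ < 1) : conj g.b * w + conj g.a ≠ 0 := by
  intro h0
  have h := g.norm_sub w
  rw [h0] at h
  simp only [norm_zero] at h
  nlinarith [sq_nonneg ‖g.a * w + g.b‖, norm_nonneg w]

theorem norm_lt (g : SU11) {w : ℂ} (hw : ‖w‖ < 1) :
    ‖(g.a * w + g.b) / (conj g.b * w + conj g.a)‖ < 1 := by
  have h := g.norm_sub w
  rw [norm_div, div_lt_one (norm_pos_iff.mpr (g.delta_ne_zero hw))]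
  refine lt_of_pow_lt_pow_left₀ 2 (norm_nonneg _) ?_
  nlinarith [norm_nonneg w]

/-- `SU(1,1)` acts on `H₁` by automorphisms, `g · (α, t) = (a α + b ᾱ, t)`. -/
instance : MulDistribMulAction SU11 Heisenberg where
  smul g h := ⟨g.a * h.α + g.b * conj h.α, h.t⟩
  one_smul h := by
    change Heisenberg.mk _ _ = _
    ext <;> simp
  mul_smul g g' h := by
    change Heisenberg.mk _ _ = Heisenberg.mk (g.a * (g'.a * h.α + g'.b * conj h.α) +
      g.b * conj (g'.a * h.α + g'.b * conj h.α)) _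
    ext
    · simp
      ring
    · rfl
  smul_one g := by
    change Heisenberg.mk _ _ = _
    ext <;> simp
  smul_mul g h h' := by
    change Heisenberg.mk _ _ = Heisenberg.mk _ _ * Heisenberg.mk _ _
    ext
    · simp
      ring
    · have h1 := g.det_eq
      have h2 : (g.a * h.α + g.b * conj h.α) * conj (g.a * h'.α + g.b * conj h'.α)
          = (g.a * conj g.a - g.b * conj g.b) * (h.α * conj h'.α)
            + ((g.a * conj g.b * h.α * h'.α + conj (g.a * conj g.b * h.α * h'.α))
            + (g.b * conj g.b) * (h.α * conj h'.α + conj (h.α * conj h'.α))) := by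
        simp only [map_add, map_mul, conj_conj]
        ring
      simp only [Heisenberg.mul_t]
      rw [h2, h1, Complex.add_conj, Complex.add_conj, Complex.mul_conj]
      simp only [one_mul, add_im, ← ofReal_mul, ofReal_im, add_zero]

theorem smul_def (g : SU11) (h : Heisenberg) :
    g • h = ⟨g.a * h.α + g.b * conj h.α, h.t⟩ := rfl

/-- The action of `SU(1,1)` on the Siegel-Jacobi disk,
`(z, w) ↦ (z / δ, (a w + b) / δ)` with `δ = b̄ w + ā`. -/
instance : MulAction SU11 disk where
  smul g x := ⟨(x.1.1 / (conj g.b * x.1.2 + conj g.a),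
    (g.a * x.1.2 + g.b) / (conj g.b * x.1.2 + conj g.a)), g.norm_lt x.2⟩
  one_smul x := by
    apply Subtype.ext
    change (_, _) = _
    simp
  mul_smul g g' x := by
    have h1 := g'.delta_ne_zero x.2
    have h2 := (g * g').delta_ne_zero x.2
    have h3 := g.delta_ne_zero (g'.norm_lt x.2)
    have h4 : conj g.b * (g'.a * x.1.2 + g'.b) + conj g.a * (conj g'.b * x.1.2 + conj g'.a)
        = conj (g * g').b * x.1.2 + conj (g * g').a := by
      simp only [mul_a, mul_b, map_add, map_mul, conj_conj]
      ring
    have h5 : conj g.b * ((g'.a * x.1.2 + g'.b) / (conj g'.b * x.1.2 + conj g'.a)) + conj g.a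
        = (conj (g * g').b * x.1.2 + conj (g * g').a) / (conj g'.b * x.1.2 + conj g'.a) := by
      rw [← h4, eq_div_iff h1, add_mul, mul_assoc, div_mul_cancel₀ _ h1]
    apply Subtype.ext
    change (_, _) = ((_, _) : ℂ × ℂ)
    rw [Prod.mk.injEq]
    constructor
    · change _ = _ / _ / (conj g.b * (_ / _) + conj g.a)
      rw [h5, div_div_div_cancel_right₀ h1]
    · change _ = (g.a * (_ / _) + g.b) / (conj g.b * (_ / _) + conj g.a)
      have h6 : g.a * ((g'.a * x.1.2 + g'.b) / (conj g'.b * x.1.2 + conj g'.a)) + g.b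
          = (g.a * (g'.a * x.1.2 + g'.b) + g.b * (conj g'.b * x.1.2 + conj g'.a)) /
            (conj g'.b * x.1.2 + conj g'.a) := by
        rw [eq_div_iff h1, add_mul, mul_assoc, div_mul_cancel₀ _ h1]
      rw [h5, h6, div_div_div_cancel_right₀ h1]
      congr 1
      simp only [mul_a, mul_b]
      ring

theorem coe_smul (g : SU11) (x : disk) : ((g • x : disk) : ℂ × ℂ) =
    (x.1.1 / (conj g.b * x.1.2 + conj g.a),
      (g.a * x.1.2 + g.b) / (conj g.b * x.1.2 + conj g.a)) := rfl

end SU11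

/-- The action of the Heisenberg group on the Siegel-Jacobi disk,
`(z, w) ↦ (z + α - ᾱ w, w)`. -/
instance : MulAction Heisenberg disk where
  smul h x := ⟨(x.1.1 + h.α - conj h.α * x.1.2, x.1.2), x.2⟩
  one_smul x := by
    apply Subtype.ext
    change (_, _) = _
    simp
  mul_smul h h' x := by
    apply Subtype.ext
    change (_, _) = ((_, _) : ℂ × ℂ)
    rw [Prod.mk.injEq]
    refine ⟨?_, rfl⟩
    change _ = (x.1.1 + h'.α - conj h'.α * x.1.2) + h.α - conj h.α * x.1.2
    rw [Heisenberg.mul_α, map_add]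
    ring

theorem Heisenberg.coe_smul (h : Heisenberg) (x : disk) : ((h • x : disk) : ℂ × ℂ) =
    (x.1.1 + h.α - conj h.α * x.1.2, x.1.2) := rfl

theorem smul_smul_disk (g : SU11) (h : Heisenberg) (x : disk) :
    g • (h • x) = (g • h) • (g • x) := by
  have h1 := g.delta_ne_zero x.2
  have h2 := g.det_eq
  apply Subtype.ext
  rw [SU11.coe_smul, Heisenberg.coe_smul, Heisenberg.coe_smul, SU11.coe_smul, SU11.smul_def]
  rw [Prod.mk.injEq]
  refine ⟨?_, rfl⟩
  simp only [map_add, map_mul, conj_conj]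
  rw [div_eq_iff h1, sub_mul, add_mul, mul_assoc _ (_ / _), div_mul_cancel₀ _ h1,
    div_mul_cancel₀ _ h1]
  linear_combination (conj h.α * x.1.2 - h.α) * h2

/-- The Jacobi group `G^J₁ = H₁ ⋊ SU(1,1)`. -/
abbrev JacobiGroup : Type := Heisenberg ⋊[MulDistribMulAction.toMulAut SU11 Heisenberg] SU11

/-- The topology of `ℂ × ℝ × SU(1,1)`. -/
instance : TopologicalSpace JacobiGroup :=
  TopologicalSpace.induced (fun q => (q.left.α, q.left.t, q.right)) inferInstance

/-- The action of the Jacobi group on the Siegel-Jacobi disk. -/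
instance : MulAction JacobiGroup disk where
  smul q x := q.left • (q.right • x)
  one_smul x := by
    change (1 : Heisenberg) • ((1 : SU11) • x) = x
    rw [one_smul, one_smul]
  mul_smul q q' x := by
    change (q.left * q.right • q'.left) • ((q.right * q'.right) • x)
      = q.left • (q.right • (q'.left • (q'.right • x)))
    rw [mul_smul, mul_smul, smul_smul_disk]

/-- The element `(g, α)`, that is `α` followed by `g`, acts by `(z, w) ↦ (γ / δ, (a w + b) / δ)`
with `γ = z + α - ᾱ w` and `δ = b̄ w + ā`. -/
theorem coe_jacobi_smul (g : SU11) (h : Heisenberg) (x : disk) :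
    (((SemidirectProduct.inr g * SemidirectProduct.inl h : JacobiGroup) • x : disk) : ℂ × ℂ) =
      ((x.1.1 + h.α - conj h.α * x.1.2) / (conj g.b * x.1.2 + conj g.a),
        (g.a * x.1.2 + g.b) / (conj g.b * x.1.2 + conj g.a)) := by
  rw [mul_smul]
  change (((1 : Heisenberg) • (g • (h • ((1 : SU11) • x))) : disk) : ℂ × ℂ) = _
  rw [one_smul, one_smul]
  rfl

end SiegelJacobi

end

open SiegelJacobi

noncomputable section

namespace SiegelJacobi

/-! ### The polarized potential -/

/-! The whole theorem is read off one holomorphic function. On the disk `jacobiKernel k μ x y = exp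
(potential k μ (x, conj y))`, with `potential` holomorphic in two independent points of `ℂ × ℂ`.
Restricted to the antidiagonal, `∂` and `∂̄` become complex derivatives in the first and second
slot. The mixed second derivative is the sum of squares `hermForm`, which gives the balanced form
and positivity; `connForm = -∂ ln K` makes `ω` exact and is the connection of the line bundle.

The expansion of the kernel is Mehler's formula for the `P_n` (`hasSum_mehler_aux`) times the
binomial series of weight `k'`. Mehler's prefactor `(1 - w w̄')^(-1/2)` has weight `1/4`, whence `k
= k' + 1/4`. The base functions therefore define a holomorphic map `kernelMap` into `ℓ²` with Gram
matrix `K`. Differentiating this Gram identity shows that the Fubini-Study form pulls back to `ω`.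

Each group element satisfies `K(φx, φy) = J(x) conj J(y) K(x, y)` (`IsAutomorphy`), checked for the
Heisenberg group and for `SU(1,1)`. Total families with equal Gram matrices differ by a unitary map,
so the action on `ℓ²` is unitary up to `J`. Invariance of the metric follows, and so does the
Jacobian of `φ`.

For the Fock space one integral is computed: the total mass is `1`. Rotations preserve the measure
and fix the origin, so a holomorphic integrable function has its value at the origin as mean.
Transitivity and the factor `J` carry this to every point, giving the reproducing property. The
coherent vectors of `ℓ²` then map isometrically into `L²`, and the reproducing property makes the
map onto the holomorphic functions; the unit vectors go to the base functions, so their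
orthonormality needs no further integral. -/

/-- Componentwise complex conjugation on `ℂ × ℂ`. -/
def conjPair : ℂ × ℂ →L[ℝ] ℂ × ℂ :=
  (Complex.conjCLE : ℂ →L[ℝ] ℂ).prodMap (Complex.conjCLE : ℂ →L[ℝ] ℂ)

@[simp] theorem conjPair_apply (x : ℂ × ℂ) : conjPair x = (conj x.1, conj x.2) := rfl

/-- The common denominator `1 - w v` at the point `((z, w), (u, v))`. -/
def den (p : (ℂ × ℂ) × (ℂ × ℂ)) : ℂ := 1 - p.1.2 * p.2.2

/-- The logarithm of the polarized kernel: `jacobiKernel k μ x y = exp (potential (x, conj y))`. -/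
def potential (k μ : ℝ) (p : (ℂ × ℂ) × (ℂ × ℂ)) : ℂ :=
  -(2 * k) * log (den p) +
    μ * ((2 * p.2.1 * p.1.1 + p.1.1 ^ 2 * p.2.2 + p.2.1 ^ 2 * p.1.2) / (2 * den p))

/-- The polarization of `conj η`. -/
def etaBar (p : (ℂ × ℂ) × (ℂ × ℂ)) : ℂ := (p.2.1 + p.1.1 * p.2.2) / den p

/-- The derivative of the potential in the direction `(X, 0)`. -/
def potentialGrad (k μ : ℝ) (X : ℂ × ℂ) (p : (ℂ × ℂ) × (ℂ × ℂ)) : ℂ :=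
  μ * etaBar p * X.1 + (2 * k * p.2.2 / den p + μ / 2 * etaBar p ^ 2) * X.2

/-- The second derivative of the potential in the directions `(X, 0)` and `(Y, 0)`. -/
def potentialHess (k μ : ℝ) (X Y : ℂ × ℂ) (p : (ℂ × ℂ) × (ℂ × ℂ)) : ℂ :=
  2 * k * p.2.2 ^ 2 * X.2 * Y.2 / den p ^ 2 +
    μ * p.2.2 * (X.1 + etaBar p * X.2) * (Y.1 + etaBar p * Y.2) / den p

/-- The second derivative of the potential in the directions `(X, 0)` and `(0, U)`. -/
def potentialMixed (k μ : ℝ) (X U : ℂ × ℂ) (p : (ℂ × ℂ) × (ℂ × ℂ)) : ℂ :=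
  2 * k * X.2 * U.2 / den p ^ 2 +
    μ * (X.1 + etaBar p * X.2) * (U.1 + etaBar p.swap * U.2) / den p

theorem den_swap (p : (ℂ × ℂ) × (ℂ × ℂ)) : den p.swap = den p := by
  simp [den, mul_comm]

theorem potentialMixed_swap (k μ : ℝ) (X U : ℂ × ℂ) (p : (ℂ × ℂ) × (ℂ × ℂ)) :
    potentialMixed k μ X U p.swap = potentialMixed k μ U X p := by
  simp only [potentialMixed, den_swap, Prod.swap_swap]
  ring

theorem potentialHess_symm (k μ : ℝ) (X Y : ℂ × ℂ) (p : (ℂ × ℂ) × (ℂ × ℂ)) :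
    potentialHess k μ X Y p = potentialHess k μ Y X p := by
  simp only [potentialHess]
  ring

/-- Reduces the derivatives of the potential to one-variable calculus along complex lines;
differentiability is established separately. -/
theorem fderiv_apply_eq_of_hasDerivAt {E F : Type*} [NormedAddCommGroup E] [NormedSpace ℂ E]
    [NormedAddCommGroup F] [NormedSpace ℂ F] {f : E → F} {p q : E} {d : F}
    (hf : DifferentiableAt ℂ f p) (h : HasDerivAt (fun t : ℂ => f (p + t • q)) d 0) :
    fderiv ℂ f p q = d :=
  (hf.hasFDerivAt.hasLineDerivAt q).unique h

theorem differentiableAt_potential (k μ : ℝ) {p : (ℂ × ℂ) × (ℂ × ℂ)} (hp : den p ∈ slitPlane) :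
    DifferentiableAt ℂ (potential k μ) p := by
  have h0 := slitPlane_ne_zero hp
  unfold potential
  have h1 : DifferentiableAt ℂ den p := by unfold den; fun_prop
  have h2 : 2 * den p ≠ 0 := by simpa using h0
  fun_prop (disch := assumption)

theorem differentiableAt_etaBar {p : (ℂ × ℂ) × (ℂ × ℂ)} (hp : den p ≠ 0) :
    DifferentiableAt ℂ etaBar p := by
  unfold etaBar
  have h1 : DifferentiableAt ℂ den p := by unfold den; fun_prop
  fun_prop (disch := assumption)

theorem differentiableAt_potentialGrad (k μ : ℝ) (X : ℂ × ℂ) {p : (ℂ × ℂ) × (ℂ × ℂ)}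
    (hp : den p ≠ 0) : DifferentiableAt ℂ (potentialGrad k μ X) p := by
  unfold potentialGrad
  have h1 : DifferentiableAt ℂ den p := by unfold den; fun_prop
  have h2 := differentiableAt_etaBar hp
  fun_prop (disch := assumption)

/-! ### Derivatives of the potential along complex lines -/

section LineDerivatives

variable (p q : (ℂ × ℂ) × (ℂ × ℂ))

theorem hasDerivAt_line_affine (a b : ℂ) : HasDerivAt (fun t : ℂ => a + t * b) b 0 := by
  simpa using ((hasDerivAt_id (0 : ℂ)).mul_const b).const_add a

theorem hasDerivAt_line_den :
    HasDerivAt (fun t : ℂ => den (p + t • q)) (-(q.1.2 * p.2.2 + p.1.2 * q.2.2)) 0 := by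
  have h := ((hasDerivAt_line_affine p.1.2 q.1.2).mul
    (hasDerivAt_line_affine p.2.2 q.2.2)).const_sub 1
  exact h.congr_deriv (by simp)

theorem hasDerivAt_line_etaBar (hp : den p ≠ 0) :
    HasDerivAt (fun t : ℂ => etaBar (p + t • q))
      ((p.2.2 * (q.1.1 + etaBar p * q.1.2) + (q.2.1 + etaBar p.swap * q.2.2)) / den p) 0 := by
  have h := ((hasDerivAt_line_affine p.2.1 q.2.1).add ((hasDerivAt_line_affine p.1.1 q.1.1).mul
    (hasDerivAt_line_affine p.2.2 q.2.2))).div (hasDerivAt_line_den p q) (by simpa using hp)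
  refine h.congr_deriv ?_
  simp only [etaBar, den_swap, Prod.fst_swap, Prod.snd_swap, zero_mul, add_zero, zero_smul]
  -- `den p` stays opaque while denominators are cleared, since `hp` speaks of it; the remaining
  -- polynomial identity needs `den p = 1 - w v`.
  field_simp
  unfold den
  simp
  ring

/-- The potential is symmetric in its two slots, so its gradient in the second slot is the first
gradient at the swapped point. -/
theorem hasDerivAt_line_potential (k μ : ℝ) (hp : den p ∈ slitPlane) :
    HasDerivAt (fun t : ℂ => potential k μ (p + t • q))
      (potentialGrad k μ q.1 p + potentialGrad k μ q.2 p.swap) 0 := by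
  have h0 := slitPlane_ne_zero hp
  have hz := hasDerivAt_line_affine p.1.1 q.1.1
  have hw := hasDerivAt_line_affine p.1.2 q.1.2
  have hu := hasDerivAt_line_affine p.2.1 q.2.1
  have hv := hasDerivAt_line_affine p.2.2 q.2.2
  have hd := hasDerivAt_line_den p q
  have h := ((hd.clog (by simpa using hp)).const_mul (-(2 * k : ℂ))).add
    ((((((hu.const_mul 2).mul hz).add ((hz.pow 2).mul hv)).add ((hu.pow 2).mul hw)).div
      (hd.const_mul 2) (by simpa using h0)).const_mul (μ : ℂ))
  refine h.congr_deriv ?_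
  simp only [potentialGrad, etaBar, den_swap, Prod.fst_swap, Prod.snd_swap, zero_mul, add_zero,
    zero_smul, Pi.mul_apply, Pi.add_apply, Pi.pow_apply]
  field_simp
  unfold den
  simp
  ring

theorem hasDerivAt_line_potentialGrad (k μ : ℝ) (X : ℂ × ℂ) (hp : den p ≠ 0) :
    HasDerivAt (fun t : ℂ => potentialGrad k μ X (p + t • q))
      (potentialHess k μ X q.1 p + potentialMixed k μ X q.2 p) 0 := by
  have he := hasDerivAt_line_etaBar p q hp
  have hv := hasDerivAt_line_affine p.2.2 q.2.2
  have hd := hasDerivAt_line_den p q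
  have h := ((he.const_mul (μ : ℂ)).mul_const X.1).add
    ((((hv.const_mul (2 * k : ℂ)).div hd (by simpa using hp)).add
      ((he.pow 2).const_mul (μ / 2 : ℂ))).mul_const X.2)
  refine h.congr_deriv ?_
  simp only [potentialHess, potentialMixed, zero_mul, add_zero, zero_smul]
  field_simp
  unfold den
  simp
  ring

end LineDerivatives

theorem fderiv_potential (k μ : ℝ) {p : (ℂ × ℂ) × (ℂ × ℂ)} (hp : den p ∈ slitPlane)
    (q : (ℂ × ℂ) × (ℂ × ℂ)) : fderiv ℂ (potential k μ) p q =
      potentialGrad k μ q.1 p + potentialGrad k μ q.2 p.swap :=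
  fderiv_apply_eq_of_hasDerivAt (differentiableAt_potential k μ hp)
    (hasDerivAt_line_potential p q k μ hp)

theorem fderiv_potentialGrad (k μ : ℝ) (X : ℂ × ℂ) {p : (ℂ × ℂ) × (ℂ × ℂ)} (hp : den p ≠ 0)
    (q : (ℂ × ℂ) × (ℂ × ℂ)) : fderiv ℂ (potentialGrad k μ X) p q =
      potentialHess k μ X q.1 p + potentialMixed k μ X q.2 p :=
  fderiv_apply_eq_of_hasDerivAt (differentiableAt_potentialGrad k μ X hp)
    (hasDerivAt_line_potentialGrad p q k μ X hp)

/-! ### Wirtinger calculus for restrictions to the antidiagonal -/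

/-- The antidiagonal embedding `x ↦ (x, conj x)`. -/
def antidiag : ℂ × ℂ →L[ℝ] (ℂ × ℂ) × (ℂ × ℂ) := (ContinuousLinearMap.id ℝ _).prod conjPair

@[simp] theorem antidiag_apply (x : ℂ × ℂ) : antidiag x = (x, conjPair x) := rfl

/-- Multiplication by `i` acts as `i` on the first slot and as `-i` on the second; this sign
separates the types `(1,0)` and `(0,1)`. -/
theorem antidiag_I_smul (X : ℂ × ℂ) : antidiag (I • X) = I • (X, -conjPair X) := by
  ext <;> simp

theorem hasFDerivAt_comp_antidiag {g : (ℂ × ℂ) × (ℂ × ℂ) → ℂ} {x : ℂ × ℂ}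
    (hg : DifferentiableAt ℂ g (antidiag x)) :
    HasFDerivAt (fun y => g (antidiag y))
      (((fderiv ℂ g (antidiag x)).restrictScalars ℝ).comp antidiag) x :=
  (hg.hasFDerivAt.restrictScalars ℝ).comp x antidiag.hasFDerivAt

/-- The combination `(antidiag X - i antidiag (i X)) / 2` equals `(X, 0)`, and the derivative of `g`
is complex linear. The opposite sign gives `(0, conj X)` for `wirtingerBar`. -/
theorem wirtinger_comp_antidiag {g : (ℂ × ℂ) × (ℂ × ℂ) → ℂ} {x : ℂ × ℂ}
    (hg : DifferentiableAt ℂ g (antidiag x)) (X : ℂ × ℂ) :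
    wirtinger (fun y => g (antidiag y)) X x = fderiv ℂ g (antidiag x) (X, 0) := by
  have h : (X, (0 : ℂ × ℂ)) = (2⁻¹ : ℂ) • (antidiag X + (X, -conjPair X)) := by
    ext <;> simp <;> ring
  rw [wirtinger, (hasFDerivAt_comp_antidiag hg).fderiv, h,
    map_smul (fderiv ℂ g (antidiag x)), map_add (fderiv ℂ g (antidiag x))]
  simp only [ContinuousLinearMap.comp_apply, ContinuousLinearMap.coe_restrictScalars',
    antidiag_I_smul, map_smul, smul_eq_mul]
  linear_combination (-(fderiv ℂ g (antidiag x)) (X, -conjPair X) / 2) * I_mul_I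

theorem wirtingerBar_comp_antidiag {g : (ℂ × ℂ) × (ℂ × ℂ) → ℂ} {x : ℂ × ℂ}
    (hg : DifferentiableAt ℂ g (antidiag x)) (X : ℂ × ℂ) :
    wirtingerBar (fun y => g (antidiag y)) X x =
      fderiv ℂ g (antidiag x) (0, conjPair X) := by
  have h : ((0 : ℂ × ℂ), conjPair X) = (2⁻¹ : ℂ) • (antidiag X - (X, -conjPair X)) := by
    ext <;> simp <;> ring
  rw [wirtingerBar, (hasFDerivAt_comp_antidiag hg).fderiv, h,
    map_smul (fderiv ℂ g (antidiag x)), map_sub (fderiv ℂ g (antidiag x))]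
  simp only [ContinuousLinearMap.comp_apply, ContinuousLinearMap.coe_restrictScalars',
    antidiag_I_smul, map_smul, smul_eq_mul]
  linear_combination ((fderiv ℂ g (antidiag x)) (X, -conjPair X) / 2) * I_mul_I

theorem wirtinger_congr {f g : ℂ × ℂ → ℂ} {x : ℂ × ℂ} (h : f =ᶠ[nhds x] g) (X : ℂ × ℂ) :
    wirtinger f X x = wirtinger g X x := by
  rw [wirtinger, wirtinger, h.fderiv_eq]

theorem wirtingerBar_congr {f g : ℂ × ℂ → ℂ} {x : ℂ × ℂ} (h : f =ᶠ[nhds x] g) (X : ℂ × ℂ) :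
    wirtingerBar f X x = wirtingerBar g X x := by
  rw [wirtingerBar, wirtingerBar, h.fderiv_eq]

/-! ### The kernel in terms of the potential -/

theorem isOpen_disk : IsOpen disk :=
  isOpen_lt (by fun_prop) continuous_const

theorem den_re_pos {x y : ℂ × ℂ} (hx : x ∈ disk) (hy : ‖y.2‖ < 1) : 0 < (den (x, y)).re := by
  have h1 : ‖x.2 * y.2‖ < 1 := by
    rw [norm_mul]
    have hx' : ‖x.2‖ < 1 := hx
    nlinarith [norm_nonneg x.2, norm_nonneg y.2]
  have h2 := (Complex.re_le_norm (x.2 * y.2)).trans_lt h1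
  simpa [den] using h2

theorem den_mem_slitPlane {x y : ℂ × ℂ} (hx : x ∈ disk) (hy : y ∈ disk) :
    den (x, conjPair y) ∈ slitPlane :=
  Or.inl (den_re_pos hx ((Complex.norm_conj y.2).trans_lt hy))

theorem den_ne_zero {x y : ℂ × ℂ} (hx : x ∈ disk) (hy : y ∈ disk) :
    den (x, conjPair y) ≠ 0 :=
  slitPlane_ne_zero (den_mem_slitPlane hx hy)

theorem pFun_pos {x : ℂ × ℂ} (hx : x ∈ disk) : 0 < pFun x := by
  have hx' : ‖x.2‖ < 1 := hx
  unfold pFun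
  nlinarith [norm_nonneg x.2]

theorem den_antidiag (x : ℂ × ℂ) : den (antidiag x) = pFun x := by
  simp [den, pFun, Complex.mul_conj']

theorem etaBar_antidiag (x : ℂ × ℂ) : etaBar (antidiag x) = conj (eta x) := by
  rw [etaBar, den_antidiag, eta, map_div₀, conj_ofReal]
  simp

theorem etaBar_antidiag_swap (x : ℂ × ℂ) : etaBar (antidiag x).swap = eta x := by
  rw [etaBar, den_swap, den_antidiag, eta]
  simp

theorem jacobiKernel_eq_exp (k μ : ℝ) {x y : ℂ × ℂ} (hx : x ∈ disk) (hy : y ∈ disk) :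
    jacobiKernel k μ x y = Complex.exp (potential k μ (x, conjPair y)) := by
  have h := den_ne_zero hx hy
  unfold jacobiKernel diskKernel
  rw [potential, Complex.exp_add]
  unfold den at h ⊢
  rw [cpow_def_of_ne_zero (by simpa using h)]
  congr 2
  push_cast
  simp
  ring

theorem fFun_self (x : ℂ × ℂ) : fFun x x =
    (((2 * ‖x.1‖ ^ 2 + 2 * (x.1 ^ 2 * conj x.2).re) / (2 * pFun x) : ℝ) : ℂ) := by
  have h : x.1 ^ 2 * conj x.2 + conj x.1 ^ 2 * x.2 = (2 * (x.1 ^ 2 * conj x.2).re : ℝ) := by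
    rw [← Complex.add_conj]
    simp
  rw [fFun]
  push_cast at h ⊢
  rw [← h, pFun]
  push_cast
  rw [← Complex.mul_conj', ← Complex.mul_conj']
  ring

theorem potential_antidiag (k μ : ℝ) {x : ℂ × ℂ} (hx : x ∈ disk) :
    potential k μ (antidiag x) = ((-(2 * k) * Real.log (pFun x) + μ * (fFun x x).re : ℝ) : ℂ) := by
  have h : (((fFun x x).re : ℝ) : ℂ) = fFun x x := by
    rw [fFun_self, ofReal_re]
  push_cast
  rw [potential, den_antidiag, h, ofReal_log (pFun_pos hx).le, ← den_antidiag]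
  simp [fFun, den]

theorem jacobiKernel_self (k μ : ℝ) {x : ℂ × ℂ} (hx : x ∈ disk) :
    jacobiKernel k μ x x =
      (Real.exp (-(2 * k) * Real.log (pFun x) + μ * (fFun x x).re) : ℝ) := by
  rw [jacobiKernel_eq_exp k μ hx hx, ← antidiag_apply, potential_antidiag k μ hx, ofReal_exp]

/-- On the diagonal the potential is real, so the principal logarithm inverts the exponential with
no multiple of `2πi`. -/
theorem log_jacobiKernel_self (k μ : ℝ) {x : ℂ × ℂ} (hx : x ∈ disk) :
    Complex.log (jacobiKernel k μ x x) = potential k μ (antidiag x) := by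
  rw [jacobiKernel_self k μ hx, ← ofReal_log (Real.exp_pos _).le, Real.log_exp,
    potential_antidiag k μ hx]

theorem wirtingerBar_log_jacobiKernel (k μ : ℝ) (Y : ℂ × ℂ) {x : ℂ × ℂ} (hx : x ∈ disk) :
    wirtingerBar (fun y => Complex.log (jacobiKernel k μ y y)) Y x =
      potentialGrad k μ (conjPair Y) (antidiag x).swap := by
  have h : (fun y => Complex.log (jacobiKernel k μ y y)) =ᶠ[nhds x]
      fun y => potential k μ (antidiag y) := by
    filter_upwards [isOpen_disk.mem_nhds hx] with y hy using log_jacobiKernel_self k μ hy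
  rw [wirtingerBar_congr h, wirtingerBar_comp_antidiag
    (differentiableAt_potential k μ (den_mem_slitPlane hx hx)), antidiag_apply,
    fderiv_potential k μ (den_mem_slitPlane hx hx)]
  simp [potentialGrad]

/-- The inner derivative is a gradient at the swapped point. Through `Prod.swap` the outer direction
`(X, 0)` becomes `(0, X)`, which kills the pure Hessian and leaves the mixed part. -/
theorem leviForm_log_jacobiKernel (k μ : ℝ) (X Y : ℂ × ℂ) {x : ℂ × ℂ} (hx : x ∈ disk) :
    leviForm (fun y => Complex.log (jacobiKernel k μ y y)) x X Y =
      potentialMixed k μ X (conjPair Y) (antidiag x) := by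
  have h : (fun y => wirtingerBar (fun y => Complex.log (jacobiKernel k μ y y)) Y y) =ᶠ[nhds x]
      fun y => (potentialGrad k μ (conjPair Y) ∘ Prod.swap) (antidiag y) := by
    filter_upwards [isOpen_disk.mem_nhds hx] with y hy
      using wirtingerBar_log_jacobiKernel k μ Y hy
  have hd : den (antidiag x).swap ≠ 0 := by rw [den_swap]; exact den_ne_zero hx hx
  have h1 := differentiableAt_potentialGrad k μ (conjPair Y) hd
  have h2 : HasFDerivAt (Prod.swap : (ℂ × ℂ) × (ℂ × ℂ) → _)
      ((ContinuousLinearMap.snd ℂ (ℂ × ℂ) (ℂ × ℂ)).prod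
        (ContinuousLinearMap.fst ℂ (ℂ × ℂ) (ℂ × ℂ))) (antidiag x) :=
    ((ContinuousLinearMap.snd ℂ (ℂ × ℂ) (ℂ × ℂ)).prod
      (ContinuousLinearMap.fst ℂ (ℂ × ℂ) (ℂ × ℂ))).hasFDerivAt
  have h3 := h1.hasFDerivAt.comp _ h2
  rw [leviForm, wirtinger_congr h, wirtinger_comp_antidiag h3.differentiableAt, h3.fderiv]
  simp only [ContinuousLinearMap.comp_apply, ContinuousLinearMap.prod_apply,
    ContinuousLinearMap.coe_fst', ContinuousLinearMap.coe_snd']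
  rw [fderiv_potentialGrad k μ _ hd, potentialMixed_swap]
  simp [potentialHess]

/-! ### The Kähler form and the prequantum line bundle -/

/-- The hermitian form `2k X_w conj Y_w / P² + μ 𝒜(X) conj 𝒜(Y) / P` on tangent vectors. -/
def hermForm (k μ : ℝ) (x X Y : ℂ × ℂ) : ℂ :=
  2 * k * X.2 * conj Y.2 / pFun x ^ 2 +
    μ * (X.1 + conj (eta x) * X.2) * conj (Y.1 + conj (eta x) * Y.2) / pFun x

theorem potentialMixed_antidiag (k μ : ℝ) (x X Y : ℂ × ℂ) :
    potentialMixed k μ X (conjPair Y) (antidiag x) = hermForm k μ x X Y := by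
  rw [potentialMixed, etaBar_antidiag, etaBar_antidiag_swap, den_antidiag, hermForm]
  simp

theorem omega_apply (k μ : ℝ) (x X Y : ℂ × ℂ) :
    omega k μ x ![X, Y] = I * (hermForm k μ x X Y - hermForm k μ x Y X) := by
  change I * ((2 * k / pFun x ^ 2) • wedge dw (conjForm dw) ![X, Y] +
    (μ / pFun x) • wedge (aForm x) (conjForm (aForm x)) ![X, Y]) = _
  rw [wedge_apply, wedge_apply]
  have hA : ∀ Z : ℂ × ℂ, aForm x Z = Z.1 + conj (eta x) * Z.2 := fun Z => rfl
  have hA' : ∀ Z : ℂ × ℂ, conjForm (aForm x) Z = conj (Z.1 + conj (eta x) * Z.2) := fun Z => rfl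
  have hw : ∀ Z : ℂ × ℂ, dw Z = Z.2 := fun Z => rfl
  have hw' : ∀ Z : ℂ × ℂ, conjForm dw Z = conj Z.2 := fun Z => rfl
  simp only [hA, hA', hw, hw', hermForm, real_smul]
  push_cast
  ring

theorem conj_hermForm (k μ : ℝ) (x X Y : ℂ × ℂ) :
    conj (hermForm k μ x X Y) = hermForm k μ x Y X := by
  simp only [hermForm, map_add, map_mul, map_div₀, map_pow, conj_conj, conj_ofReal, map_ofNat]
  ring

theorem hermForm_smul_left (k μ : ℝ) (c : ℂ) (x X Y : ℂ × ℂ) :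
    hermForm k μ x (c • X) Y = c * hermForm k μ x X Y := by
  simp only [hermForm, Prod.smul_fst, Prod.smul_snd, smul_eq_mul]
  ring

theorem hermForm_smul_right (k μ : ℝ) (c : ℂ) (x X Y : ℂ × ℂ) :
    hermForm k μ x X (c • Y) = conj c * hermForm k μ x X Y := by
  rw [← conj_hermForm, hermForm_smul_left, map_mul, conj_hermForm]

/-- The form is a sum of two squares: the first detects `X.2`, and when `X.2 = 0` the second reduces
to `X.1`. -/
theorem hermForm_self_pos {k μ : ℝ} (hk : 0 < k) (hμ : 0 < μ) {x : ℂ × ℂ} (hx : x ∈ disk)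
    {X : ℂ × ℂ} (hX : X ≠ 0) : 0 < (hermForm k μ x X X).re := by
  have hP := pFun_pos hx
  have h : hermForm k μ x X X = ((2 * k * ‖X.2‖ ^ 2 / pFun x ^ 2 +
      μ * ‖X.1 + conj (eta x) * X.2‖ ^ 2 / pFun x : ℝ) : ℂ) := by
    push_cast
    rw [← Complex.mul_conj', ← Complex.mul_conj', hermForm]
    ring
  rw [h, ofReal_re]
  by_cases h2 : X.2 = 0
  · have h1 : X.1 ≠ 0 := fun h1 => hX (Prod.ext h1 h2)
    have := norm_pos_iff.mpr h1
    simp only [h2, norm_zero, mul_zero, add_zero]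
    positivity
  · have := norm_pos_iff.mpr h2
    positivity

/-- The connection form `-∂ ln K` of the prequantum line bundle. -/
def connForm (k μ : ℝ) (x : ℂ × ℂ) : ℂ × ℂ →L[ℝ] ℂ :=
  (-(μ * etaBar (antidiag x))) • dz +
    (-(2 * k * conj x.2 / den (antidiag x) + μ / 2 * etaBar (antidiag x) ^ 2)) • dw

theorem connForm_apply (k μ : ℝ) (x X : ℂ × ℂ) :
    connForm k μ x X = -potentialGrad k μ X (antidiag x) := by
  change (-(μ * etaBar (antidiag x))) * X.1 +
    (-(2 * k * conj x.2 / den (antidiag x) + μ / 2 * etaBar (antidiag x) ^ 2)) * X.2 = _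
  simp only [potentialGrad, antidiag_apply, conjPair_apply]
  ring

theorem contDiff_conj_snd : ContDiff ℝ ∞ fun x : ℂ × ℂ => conj x.2 :=
  Complex.conjCLE.contDiff.comp contDiff_snd

theorem contDiff_den_antidiag : ContDiff ℝ ∞ fun x : ℂ × ℂ => den (antidiag x) := by
  unfold den
  exact contDiff_const.sub (contDiff_snd.mul contDiff_conj_snd)

theorem den_antidiag_ne_zero {x : ℂ × ℂ} (hx : x ∈ disk) : den (antidiag x) ≠ 0 :=
  den_ne_zero hx hx

theorem contDiffOn_etaBar_antidiag : ContDiffOn ℝ ∞ (fun x => etaBar (antidiag x)) disk := by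
  have h1 : ContDiff ℝ ∞ fun x : ℂ × ℂ => conj x.1 := Complex.conjCLE.contDiff.comp contDiff_fst
  have h2 : ContDiff ℝ ∞ fun x : ℂ × ℂ => conj x.1 + x.1 * conj x.2 :=
    h1.add (contDiff_fst.mul contDiff_conj_snd)
  exact (h2.contDiffOn.mul (contDiff_den_antidiag.contDiffOn.inv
    fun x hx => den_antidiag_ne_zero hx)).congr fun x _ => div_eq_mul_inv _ _

theorem contDiffOn_connForm_coeffs (k μ : ℝ) :
    ContDiffOn ℝ ∞ (fun x => -(μ * etaBar (antidiag x) : ℂ)) disk ∧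
    ContDiffOn ℝ ∞ (fun x : ℂ × ℂ => -(2 * k * conj x.2 / den (antidiag x) +
      μ / 2 * etaBar (antidiag x) ^ 2 : ℂ)) disk := by
  have he := contDiffOn_etaBar_antidiag
  refine ⟨(contDiffOn_const.mul he).neg, (ContDiffOn.add ?_ (contDiffOn_const.mul (he.pow 2))).neg⟩
  have h2 : ContDiff ℝ ∞ fun x : ℂ × ℂ => 2 * (k : ℂ) * conj x.2 :=
    contDiff_const.mul contDiff_conj_snd
  exact (h2.contDiffOn.mul (contDiff_den_antidiag.contDiffOn.inv
    fun x hx => den_antidiag_ne_zero hx)).congr fun x _ => div_eq_mul_inv _ _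

theorem contDiffOn_connForm (k μ : ℝ) : ContDiffOn ℝ ∞ (connForm k μ) disk := by
  obtain ⟨h1, h2⟩ := contDiffOn_connForm_coeffs k μ
  exact (h1.smul contDiffOn_const).add (h2.smul contDiffOn_const)

theorem hasFDerivAt_connForm_apply (k μ : ℝ) (Y : ℂ × ℂ) {x : ℂ × ℂ} (hx : x ∈ disk)
    (X : ℂ × ℂ) : fderiv ℝ (fun y => connForm k μ y Y) x X =
      -(potentialHess k μ Y X (antidiag x) + hermForm k μ x Y X) := by
  have h := (hasFDerivAt_comp_antidiag
    (differentiableAt_potentialGrad k μ Y (den_antidiag_ne_zero hx))).neg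
  have h1 : (fun y => connForm k μ y Y) = -fun y => potentialGrad k μ Y (antidiag y) :=
    funext fun y => connForm_apply k μ y Y
  rw [h1, h.fderiv]
  simp only [neg_apply, ContinuousLinearMap.comp_apply,
    ContinuousLinearMap.coe_restrictScalars']
  rw [fderiv_potentialGrad k μ Y (den_antidiag_ne_zero hx)]
  simp only [antidiag_apply]
  rw [← antidiag_apply, potentialMixed_antidiag]

/-- The pure Hessian is symmetric and disappears on antisymmetrization; only the mixed derivatives
contribute. -/
theorem connForm_curvature (k μ : ℝ) {x : ℂ × ℂ} (hx : x ∈ disk) (X Y : ℂ × ℂ) :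
    fderiv ℝ (fun y => connForm k μ y Y) x X - fderiv ℝ (fun y => connForm k μ y X) x Y =
      -I * omega k μ x ![X, Y] := by
  rw [hasFDerivAt_connForm_apply k μ Y hx, hasFDerivAt_connForm_apply k μ X hx,
    potentialHess_symm k μ Y X, omega_apply]
  linear_combination (hermForm k μ x X Y - hermForm k μ x Y X) * I_mul_I

/-- The connection form as an alternating form. -/
def connAlt (k μ : ℝ) (x : ℂ × ℂ) : (ℂ × ℂ) [⋀^Fin 1]→L[ℝ] ℂ :=
  (-(μ * etaBar (antidiag x))) • ContinuousAlternatingMap.ofSubsingleton ℝ (ℂ × ℂ) ℂ 0 dz +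
    (-(2 * k * conj x.2 / den (antidiag x) + μ / 2 * etaBar (antidiag x) ^ 2)) •
      ContinuousAlternatingMap.ofSubsingleton ℝ (ℂ × ℂ) ℂ 0 dw

theorem connAlt_apply (k μ : ℝ) (x : ℂ × ℂ) (v : Fin 1 → ℂ × ℂ) :
    connAlt k μ x v = connForm k μ x (v 0) := rfl

theorem contDiffOn_connAlt (k μ : ℝ) : ContDiffOn ℝ ∞ (connAlt k μ) disk := by
  obtain ⟨h1, h2⟩ := contDiffOn_connForm_coeffs k μ
  exact (h1.smul contDiffOn_const).add (h2.smul contDiffOn_const)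

/-- Exactness serves twice: smoothness and closedness of the form both follow from smoothness of the
connection form. -/
theorem omega_eq_extDeriv (k μ : ℝ) {x : ℂ × ℂ} (hx : x ∈ disk) :
    omega k μ x = I • extDeriv (connAlt k μ) x := by
  have hd : DifferentiableAt ℝ (connAlt k μ) x :=
    ((contDiffOn_connAlt k μ).contDiffAt (isOpen_disk.mem_nhds hx)).differentiableAt (by simp)
  ext v
  obtain ⟨X, Y, rfl⟩ : ∃ X Y, v = ![X, Y] := ⟨v 0, v 1, by ext i <;> fin_cases i <;> rfl⟩
  have h : extDeriv (connAlt k μ) x ![X, Y] = -I * omega k μ x ![X, Y] := by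
    rw [extDeriv_apply hd, Fin.sum_univ_two, ← connForm_curvature k μ hx X Y]
    simp [connAlt_apply, Fin.removeNth, sub_eq_add_neg]
  change _ = I * extDeriv (connAlt k μ) x ![X, Y]
  rw [h]
  linear_combination (omega k μ x ![X, Y]) * I_mul_I

theorem contDiffOn_extDeriv_connAlt (k μ : ℝ) :
    ContDiffOn ℝ ∞ (extDeriv (connAlt k μ)) disk := by
  have h := (contDiffOn_connAlt k μ).fderiv_of_isOpen isOpen_disk (m := ∞) (by simp)
  exact (ContinuousAlternatingMap.alternatizeUncurryFinCLM ℝ (ℂ × ℂ) ℂ).contDiff.comp_contDiffOn h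

theorem isKahlerForm_omega {k μ : ℝ} (hk : 0 < k) (hμ : 0 < μ) :
    IsKahlerForm disk (omega k μ) where
  isOpen := isOpen_disk
  smooth := ((contDiffOn_extDeriv_connAlt k μ).const_smul I).congr
    fun x hx => omega_eq_extDeriv k μ hx
  real x _ X Y := by
    rw [omega_apply, ← conj_hermForm k μ x X Y, Complex.sub_conj]
    simp
  type_one_one x _ X Y := by
    simp only [omega_apply, hermForm_smul_left, hermForm_smul_right, conj_I]
    linear_combination (-I * (hermForm k μ x X Y - hermForm k μ x Y X)) * I_mul_I
  pos x hx X hX := by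
    have h : omega k μ x ![X, I • X] = 2 * hermForm k μ x X X := by
      simp only [omega_apply, hermForm_smul_left, hermForm_smul_right, conj_I]
      linear_combination (-2 * hermForm k μ x X X) * I_mul_I
    have := hermForm_self_pos hk hμ hx hX
    rw [h]
    simpa using this
  closed x hx := by
    have h : omega k μ =ᶠ[nhds x] I • extDeriv (connAlt k μ) := by
      filter_upwards [isOpen_disk.mem_nhds hx] with y hy using omega_eq_extDeriv k μ hy
    have hd : DifferentiableAt ℝ (extDeriv (connAlt k μ)) x :=
      ((contDiffOn_extDeriv_connAlt k μ).contDiffAt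
        (isOpen_disk.mem_nhds hx)).differentiableAt (by simp)
    have h0 : extDeriv (extDeriv (connAlt k μ)) x = 0 :=
      extDeriv_extDeriv_apply ((contDiffOn_connAlt k μ).contDiffAt (isOpen_disk.mem_nhds hx))
        (by rw [minSmoothness_of_isRCLikeNormedField]; exact WithTop.coe_le_coe.2 le_top)
    rw [h.extDeriv_eq]
    ext v
    have h1 := congrArg (fun L => L v) h0
    simp only [extDeriv_apply hd] at h1
    rw [extDeriv_apply (hd.const_smul I)]
    -- The exterior derivative is taken over `ℝ`, so the complex scalar `I` is pulled out of each
    -- directional derivative separately.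
    have h2 : ∀ i : Fin 3, fderiv ℝ (fun y => (I • extDeriv (connAlt k μ)) y (i.removeNth v)) x (v i)
        = I * fderiv ℝ (fun y => extDeriv (connAlt k μ) y (i.removeNth v)) x (v i) := by
      intro i
      have h3 : DifferentiableAt ℝ (fun y => extDeriv (connAlt k μ) y (i.removeNth v)) x :=
        hd.continuousAlternatingMap_apply_const _
      change fderiv ℝ (fun y => I * extDeriv (connAlt k μ) y (i.removeNth v)) x (v i) = _
      rw [fderiv_const_mul h3]
      rfl
    simp only [h2, ← mul_smul_comm, ← Finset.mul_sum]
    rw [h1]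
    simp

theorem isBalancedForm_omega (k μ : ℝ) : IsBalancedForm disk (jacobiKernel k μ) (omega k μ) := by
  intro x hx X Y
  rw [leviForm_log_jacobiKernel k μ X Y hx, leviForm_log_jacobiKernel k μ Y X hx,
    potentialMixed_antidiag, potentialMixed_antidiag, omega_apply]

/-- The logarithm of the kernel on the diagonal. -/
def logNorm (k μ : ℝ) (x : ℂ × ℂ) : ℝ := -(2 * k) * Real.log (pFun x) + μ * (fFun x x).re

theorem contDiff_pFun : ContDiff ℝ ∞ pFun := by
  unfold pFun
  exact contDiff_const.sub (contDiff_snd.norm_sq ℝ)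

theorem contDiffOn_logNorm (k μ : ℝ) : ContDiffOn ℝ ∞ (logNorm k μ) disk := by
  have h1 : ContDiffOn ℝ ∞ (fun x => Real.log (pFun x)) disk :=
    contDiff_pFun.contDiffOn.log fun x hx => (pFun_pos hx).ne'
  have h2 : ContDiffOn ℝ ∞ (fun x => (fFun x x).re) disk := by
    have h3 : ∀ x, (fFun x x).re =
        (2 * ‖x.1‖ ^ 2 + 2 * (x.1 ^ 2 * conj x.2).re) / (2 * pFun x) := fun x => by
      rw [fFun_self, ofReal_re]
    simp only [h3]
    refine ContDiffOn.div (ContDiff.contDiffOn ?_) (contDiff_const.mul contDiff_pFun).contDiffOn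
      fun x hx => by have := pFun_pos hx; positivity
    exact (contDiff_const.mul (contDiff_fst.norm_sq ℝ)).add (contDiff_const.mul
      (Complex.reCLM.contDiff.comp ((contDiff_fst.pow 2).mul contDiff_conj_snd)))
  exact (contDiffOn_const.mul h1).add (contDiffOn_const.mul h2)

theorem jacobiKernel_self_eq (k μ : ℝ) {x : ℂ × ℂ} (hx : x ∈ disk) :
    jacobiKernel k μ x x = (Real.exp (logNorm k μ x) : ℝ) := jacobiKernel_self k μ hx

theorem potentialGrad_antidiag_swap (k μ : ℝ) (x X : ℂ × ℂ) :
    potentialGrad k μ (conjPair X) (antidiag x).swap =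
      conj (potentialGrad k μ X (antidiag x)) := by
  simp only [potentialGrad, etaBar_antidiag, etaBar_antidiag_swap, den_swap, den_antidiag]
  simp [map_ofNat]

/-- As `ln K` is real on the diagonal, its differential is `∂ ln K` plus the conjugate; this is
metric compatibility before exponentiating. -/
theorem fderiv_logNorm (k μ : ℝ) {x : ℂ × ℂ} (hx : x ∈ disk) (X : ℂ × ℂ) :
    ((fderiv ℝ (logNorm k μ) x X : ℝ) : ℂ) = -(connForm k μ x X + conj (connForm k μ x X)) := by
  have hd : DifferentiableAt ℝ (logNorm k μ) x :=
    ((contDiffOn_logNorm k μ).contDiffAt (isOpen_disk.mem_nhds hx)).differentiableAt (by simp)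
  have h1 : HasFDerivAt (fun y => ((logNorm k μ y : ℝ) : ℂ))
      (Complex.ofRealCLM.comp (fderiv ℝ (logNorm k μ) x)) x :=
    Complex.ofRealCLM.hasFDerivAt.comp x hd.hasFDerivAt
  have h2 : (fun y => ((logNorm k μ y : ℝ) : ℂ)) =ᶠ[nhds x]
      fun y => potential k μ (antidiag y) := by
    filter_upwards [isOpen_disk.mem_nhds hx] with y hy
    rw [potential_antidiag k μ hy, logNorm]
  have h3 := (hasFDerivAt_comp_antidiag
    (differentiableAt_potential k μ (den_mem_slitPlane hx hx))).congr_of_eventuallyEq h2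
  have h4 := congrArg (fun L => L X) (h1.unique h3)
  simp only [ContinuousLinearMap.comp_apply, ContinuousLinearMap.coe_restrictScalars',
    ofRealCLM_apply] at h4
  rw [h4, antidiag_apply x, fderiv_potential k μ (den_mem_slitPlane hx hx), connForm_apply,
    ← antidiag_apply, show (antidiag X).2 = conjPair X from rfl, potentialGrad_antidiag_swap,
    show (antidiag X).1 = X from rfl]
  rw [neg_add, map_neg, neg_neg, neg_neg]

/-- The prequantum line bundle, trivialized by one holomorphic frame of norm `1 / K`. -/
def prequantumBundle (k μ : ℝ) : HermitianLineBundle disk where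
  ι := Unit
  U _ := disk
  isOpen _ := isOpen_disk
  cover := iUnion_const disk
  g _ _ _ := 1
  g_holomorphic _ _ := differentiableOn_const 1
  g_ne_zero _ _ _ _ := one_ne_zero
  cocycle _ _ _ _ _ := one_mul 1
  hhat _ x := Real.exp (-logNorm k μ x)
  hhat_smooth _ := (contDiffOn_logNorm k μ).neg.exp
  hhat_pos _ _ _ := Real.exp_pos _
  hhat_change _ _ _ _ := by rw [norm_one, one_pow, one_mul]
  θ _ := connForm k μ
  θ_smooth _ := contDiffOn_connForm k μ
  θ_change _ _ x _ X := by
    rw [fderiv_fun_const]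
    simp
  metric_compatible _ x hx X := by
    have hd : DifferentiableAt ℝ (logNorm k μ) x :=
      ((contDiffOn_logNorm k μ).contDiffAt (isOpen_disk.mem_nhds hx)).differentiableAt (by simp)
    have h := hd.hasFDerivAt.neg.exp
    have h' : fderiv ℝ (fun y => Real.exp (-logNorm k μ y)) x =
      Real.exp (-logNorm k μ x) • -fderiv ℝ (logNorm k μ) x := h.fderiv
    rw [h']
    simp only [FunLike.coe_smul, Pi.smul_apply, neg_apply, smul_eq_mul, ofReal_mul, ofReal_neg]
    rw [fderiv_logNorm k μ hx]
    ring
  type_one_zero _ x _ X := by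
    simp only [connForm_apply, potentialGrad, Prod.smul_fst, Prod.smul_snd, smul_eq_mul]
    ring

theorem isQuantizable_omega (k μ : ℝ) : IsQuantizable disk (jacobiKernel k μ) (omega k μ) := by
  refine ⟨isBalancedForm_omega k μ, prequantumBundle k μ, fun i x hx X Y => ?_, fun i x hx => ?_⟩
  · have hx' : x ∈ disk := hx
    have hd : DifferentiableAt ℝ (connForm k μ) x :=
      ((contDiffOn_connForm k μ).contDiffAt (isOpen_disk.mem_nhds hx')).differentiableAt (by simp)
    have h : ∀ X Y, fderiv ℝ (connForm k μ) x X Y = fderiv ℝ (fun y => connForm k μ y Y) x X := by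
      intro X Y
      rw [(hd.hasFDerivAt.clm_apply (hasFDerivAt_const Y x)).fderiv]
      simp
    change fderiv ℝ (connForm k μ) x X Y - fderiv ℝ (connForm k μ) x Y X = _
    rw [h, h, connForm_curvature k μ hx']
  · rw [jacobiKernel_self_eq k μ hx]
    change ((Real.exp (-logNorm k μ x) : ℝ) : ℂ) = _
    rw [Real.exp_neg, ofReal_inv]

/-- The metric is diagonal in the coframe `(𝒜, dw)`, a unipotent change of `(dz, dw)`, so its
determinant is the product of `μ / P` and `2k / P²`. -/
theorem volumeDensity_eq (k μ : ℝ) {x : ℂ × ℂ} (hx : x ∈ disk) :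
    volumeDensity k μ x = 2 * k * μ / pFun x ^ 3 := by
  have hP : (pFun x : ℂ) ≠ 0 := by exact_mod_cast (pFun_pos hx).ne'
  rw [volumeDensity, Matrix.det_fin_two]
  simp only [Matrix.of_apply, leviForm_log_jacobiKernel k μ _ _ hx, potentialMixed_antidiag]
  simp [hermForm]
  field_simp
  ring

theorem fockDensity_eq (k μ : ℝ) {x : ℂ × ℂ} (hx : x ∈ disk) :
    fockDensity k μ x =
      (4 * k - 3) / (2 * Real.pi ^ 2) * Real.exp (-logNorm k μ x) * (μ / pFun x ^ 3) := by
  rw [fockDensity, logNorm, fFun_self, ofReal_re, Real.rpow_def_of_pos (pFun_pos hx),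
    mul_assoc ((4 * k - 3) / (2 * Real.pi ^ 2)), ← Real.exp_add]
  congr 3
  ring

theorem fockDensity_eq_volumeDensity {k : ℝ} (hk : 0 < k) (μ : ℝ) {x : ℂ × ℂ} (hx : x ∈ disk) :
    (fockDensity k μ x : ℂ) = ((4 * k - 3) / (2 * Real.pi ^ 2) / (2 * k) : ℝ) *
      volumeDensity k μ x / jacobiKernel k μ x x := by
  have hk' : (k : ℂ) ≠ 0 := by exact_mod_cast hk.ne'
  have hP : (pFun x : ℂ) ≠ 0 := by exact_mod_cast (pFun_pos hx).ne'
  rw [fockDensity_eq k μ hx, volumeDensity_eq k μ hx, jacobiKernel_self_eq k μ hx, Real.exp_neg]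
  push_cast
  field_simp

/-! ### Power series of holomorphic functions -/

section PowerSeries

open PowerSeries

/-- The power series `p` converges to `f` on the disk of radius `R`. -/
def IsPowerSeriesOf (R : ℝ) (p : PowerSeries ℂ) (f : ℂ → ℂ) : Prop :=
  ∀ s : ℂ, ‖s‖ < R → HasSum (fun n => coeff n p * s ^ n) (f s)

variable {R : ℝ} {p q : PowerSeries ℂ} {f g : ℂ → ℂ}

theorem IsPowerSeriesOf.congr (hp : IsPowerSeriesOf R p f) (h : ∀ s, ‖s‖ < R → f s = g s) :
    IsPowerSeriesOf R p g := fun s hs => h s hs ▸ hp s hs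

theorem IsPowerSeriesOf.add (hp : IsPowerSeriesOf R p f) (hq : IsPowerSeriesOf R q g) :
    IsPowerSeriesOf R (p + q) fun s => f s + g s := fun s hs => by
  simpa [add_mul] using (hp s hs).add (hq s hs)

theorem IsPowerSeriesOf.smul (hp : IsPowerSeriesOf R p f) (c : ℂ) :
    IsPowerSeriesOf R (c • p) fun s => c * f s := fun s hs => by
  simpa [mul_assoc] using (hp s hs).mul_left c

theorem IsPowerSeriesOf.X_mul (hp : IsPowerSeriesOf R p f) :
    IsPowerSeriesOf R (X * p) fun s => s * f s := fun s hs => by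
  rw [← hasSum_nat_add_iff' 1]
  simp only [Finset.sum_range_one, coeff_zero_X_mul, zero_mul, sub_zero, coeff_succ_X_mul]
  refine ((hp s hs).mul_left s).congr_fun fun n => ?_
  ring

theorem IsPowerSeriesOf.unique (hR : 0 < R) (hp : IsPowerSeriesOf R p f)
    (hq : IsPowerSeriesOf R q f) : p = q := by
  have key : ∀ {p : PowerSeries ℂ}, IsPowerSeriesOf R p f →
      HasFPowerSeriesAt f (FormalMultilinearSeries.ofScalars ℂ fun n => coeff n p) 0 := by
    intro p hp
    rw [hasFPowerSeriesAt_iff]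
    filter_upwards [Metric.ball_mem_nhds (0 : ℂ) hR] with s hs
    have := hp s (by simpa using hs)
    simpa [mul_comm] using this
  have h := (key hp).eq_formalMultilinearSeries (key hq)
  rw [FormalMultilinearSeries.ofScalars_series_eq_iff] at h
  exact PowerSeries.ext fun n => congrFun h n

/-- The Taylor series at the origin. -/
def taylor (f : ℂ → ℂ) : PowerSeries ℂ := PowerSeries.mk fun n => iteratedDeriv n f 0 / n.factorial

theorem isPowerSeriesOf_taylor (hf : DifferentiableOn ℂ f (Metric.ball 0 R)) :
    IsPowerSeriesOf R (taylor f) f := fun s hs => by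
  refine (Complex.hasSum_taylorSeries_on_ball hf (by simpa using hs)).congr_fun fun n => ?_
  simp [taylor]
  ring

theorem coeff_taylor_deriv (f : ℂ → ℂ) (n : ℕ) :
    coeff n (taylor (deriv f)) = (n + 1) * coeff (n + 1) (taylor f) := by
  have h : ((n : ℂ) + 1) ≠ 0 := Nat.cast_add_one_ne_zero n
  have h2 : (n.factorial : ℂ) ≠ 0 := by exact_mod_cast n.factorial_ne_zero
  simp only [taylor, coeff_mk, iteratedDeriv_succ', Nat.factorial_succ]
  push_cast
  field_simp

theorem coeff_X_mul_taylor_deriv (f : ℂ → ℂ) (n : ℕ) :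
    coeff n (X * taylor (deriv f)) = n * coeff n (taylor f) := by
  cases n with
  | zero => simp
  | succ n => rw [coeff_succ_X_mul, coeff_taylor_deriv]; push_cast; rfl

/-- The power series recursion for solutions of
`(1 - c s²)² f' = (A + (c + B) s + A c s² - c² s³) f`. -/
theorem taylor_recursion {A B c : ℂ} (hR : 0 < R) (hf : DifferentiableOn ℂ f (Metric.ball 0 R))
    (hode : ∀ s : ℂ, ‖s‖ < R → (1 - c * s ^ 2) ^ 2 * deriv f s =
      (A + (c + B) * s + A * c * s ^ 2 - c ^ 2 * s ^ 3) * f s) {b : ℕ → ℂ}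
    (hb : ∀ n, b n = coeff n (taylor f)) :
    b 1 = A * b 0 ∧ 2 * b 2 = A * b 1 + (c + B) * b 0 ∧
      3 * b 3 = A * b 2 + (3 * c + B) * b 1 + A * c * b 0 ∧
      ∀ n : ℕ, (n + 4) * b (n + 4) = A * b (n + 3) + (c * (2 * n + 5) + B) * b (n + 2) +
        A * c * b (n + 1) - c ^ 2 * (n + 1) * b n := by
  have hf' : DifferentiableOn ℂ (deriv f) (Metric.ball 0 R) := hf.deriv Metric.isOpen_ball
  have h0 := isPowerSeriesOf_taylor hf
  have h1 := isPowerSeriesOf_taylor hf'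
  -- The two sides of the differential equation as power series, with `(1 - c s²)²` expanded as `1 -
  -- 2c s² + c² s⁴`.
  have hl := (h1.add (h1.X_mul.X_mul.smul (-(2 * c)))).add
    (h1.X_mul.X_mul.X_mul.X_mul.smul (c ^ 2))
  have hr := ((h0.smul A).add (h0.X_mul.smul (c + B))).add
    ((h0.X_mul.X_mul.smul (A * c)).add (h0.X_mul.X_mul.X_mul.smul (-c ^ 2)))
  have heq := (hl.congr fun s hs => (by linear_combination hode s hs : _ =
    (A * f s + (c + B) * (s * f s)) +
      (A * c * (s * (s * f s)) + -c ^ 2 * (s * (s * (s * f s)))))).unique hR hr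
  have hc := fun n => congrArg (coeff n) heq
  simp only [map_add, coeff_smul, smul_eq_mul] at hc
  simp only [hb]
  refine ⟨?_, ?_, ?_, fun n => ?_⟩
  · have := hc 0
    simp only [coeff_zero_X_mul, coeff_taylor_deriv] at this
    push_cast at this
    linear_combination this
  · have := hc (0 + 1)
    simp only [coeff_succ_X_mul, coeff_zero_X_mul, coeff_taylor_deriv, zero_add] at this
    push_cast at this
    linear_combination this
  · have := hc (0 + 1 + 1)
    simp only [coeff_succ_X_mul, coeff_zero_X_mul, coeff_taylor_deriv, zero_add] at this
    push_cast at this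
    linear_combination this
  -- After three factors `X` are removed, the quartic term is the coefficient of `X * taylor (deriv
  -- f)` at `n`. That formula also holds at `n = 0`, so three initial equations suffice.
  · have := hc (n + 3)
    rw [show n + 3 = n + 1 + 1 + 1 from rfl] at this
    simp only [coeff_succ_X_mul, coeff_X_mul_taylor_deriv, coeff_taylor_deriv] at this
    push_cast at this
    linear_combination this

end PowerSeries

/-! ### The polynomials `P_n` -/

/-- The normalized polynomials `P_n / n!`. -/
theorem matchingPoly_div (n : ℕ) (z w : ℂ) : matchingPoly n z w / n.factorial =
    ∑ p ∈ Finset.range (n / 2 + 1),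
      ((w / 2) ^ p / p.factorial) * (z ^ (n - 2 * p) / (n - 2 * p).factorial) := by
  have h2 : (n.factorial : ℂ) ≠ 0 := by exact_mod_cast n.factorial_ne_zero
  rw [matchingPoly, mul_div_cancel_left₀ _ h2]
  refine Finset.sum_congr rfl fun p _ => ?_
  ring

theorem succ_mul_pow_div_factorial (x : ℂ) (n : ℕ) :
    ((n : ℂ) + 1) * (x ^ (n + 1) / (n + 1).factorial) = x * (x ^ n / n.factorial) := by
  have h : ((n : ℂ) + 1) ≠ 0 := Nat.cast_add_one_ne_zero n
  have h2 : (n.factorial : ℂ) ≠ 0 := by exact_mod_cast n.factorial_ne_zero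
  rw [Nat.factorial_succ]
  push_cast
  field_simp
  ring

theorem matchingPoly_zero (z w : ℂ) : matchingPoly 0 z w = 1 := by simp [matchingPoly]

theorem matchingPoly_one (z w : ℂ) : matchingPoly 1 z w = z := by simp [matchingPoly]

/-- `P_n / n!` is the coefficient of `t^n` in `exp (z t + w t² / 2)`, whose `t`-derivative is
multiplication by `z + w t`. The proof performs this on the finite sums. -/
theorem matchingPoly_div_recursion (n : ℕ) (z w : ℂ) :
    ((n : ℂ) + 2) * (matchingPoly (n + 2) z w / (n + 2).factorial) =
      z * (matchingPoly (n + 1) z w / (n + 1).factorial) +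
        w * (matchingPoly n z w / n.factorial) := by
  simp only [matchingPoly_div]
  set a : ℕ → ℂ := fun p => (w / 2) ^ p / p.factorial with ha
  set b : ℕ → ℂ := fun j => z ^ j / j.factorial with hb
  have ha' : ∀ p : ℕ, 2 * ((p : ℂ) + 1) * a (p + 1) = w * a p := fun p => by
    rw [mul_assoc, ha]
    simp only
    rw [succ_mul_pow_div_factorial]
    ring
  have hb' : ∀ j : ℕ, ((j : ℂ) + 1) * b (j + 1) = z * b j := succ_mul_pow_div_factorial z
  change _ * ∑ p ∈ Finset.range ((n + 2) / 2 + 1), a p * b (n + 2 - 2 * p) =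
    z * (∑ p ∈ Finset.range ((n + 1) / 2 + 1), a p * b (n + 1 - 2 * p)) +
      w * ∑ p ∈ Finset.range (n / 2 + 1), a p * b (n - 2 * p)
  -- The degree is split as `2p + (n + 2 - 2p)`: the first part lowers the power of `w`, the second
  -- the power of `z`.
  have h1 : ((n : ℂ) + 2) * ∑ p ∈ Finset.range ((n + 2) / 2 + 1), a p * b (n + 2 - 2 * p) =
      (∑ p ∈ Finset.range ((n + 2) / 2 + 1), (2 * p * a p) * b (n + 2 - 2 * p)) +
      ∑ p ∈ Finset.range ((n + 2) / 2 + 1),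
        a p * (((n + 2 - 2 * p : ℕ) : ℂ) * b (n + 2 - 2 * p)) := by
    rw [Finset.mul_sum, ← Finset.sum_add_distrib]
    refine Finset.sum_congr rfl fun p hp => ?_
    have hp' : 2 * p ≤ n + 2 := by
      have := Finset.mem_range.mp hp
      omega
    rw [Nat.cast_sub hp']
    push_cast
    ring
  rw [h1, add_comm]
  congr 1
  · have h2 : ∀ N, 2 * N ≤ n + 2 → ∑ p ∈ Finset.range N,
        a p * (((n + 2 - 2 * p : ℕ) : ℂ) * b (n + 2 - 2 * p)) =
        z * ∑ p ∈ Finset.range N, a p * b (n + 1 - 2 * p) := by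
      intro N hN
      rw [Finset.mul_sum]
      refine Finset.sum_congr rfl fun p hp => ?_
      have := Finset.mem_range.mp hp
      rw [show n + 2 - 2 * p = (n + 1 - 2 * p) + 1 by omega]
      push_cast
      rw [hb']
      ring
    -- For even `n` the left sum has one more index, where no power of `z` is left and the term
    -- vanishes. For odd `n` the ranges agree, but the top index lies beyond the bound in `h2` and
    -- is matched by hand.
    rcases Nat.even_or_odd' n with ⟨m, rfl | rfl⟩
    · rw [show (2 * m + 2) / 2 + 1 = (m + 1) + 1 by omega,
        show (2 * m + 1) / 2 + 1 = m + 1 by omega, Finset.sum_range_succ, h2 (m + 1) (by omega)]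
      simp [show 2 * m + 2 - 2 * (m + 1) = 0 by omega]
    · rw [show (2 * m + 1 + 2) / 2 + 1 = m + 2 by omega,
        show (2 * m + 1 + 1) / 2 + 1 = m + 2 by omega]
      rw [Finset.sum_range_succ, h2 (m + 1) (by omega), Finset.sum_range_succ _ (m + 1),
        show 2 * m + 1 + 2 - 2 * (m + 1) = 0 + 1 by omega,
        show 2 * m + 1 + 1 - 2 * (m + 1) = 0 by omega, mul_add]
      have h3 := hb' 0
      push_cast at h3 ⊢
      linear_combination a (m + 1) * h3
  · rw [show (n + 2) / 2 + 1 = (n / 2 + 1) + 1 by omega, Finset.sum_range_succ', Finset.mul_sum]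
    simp only [Nat.cast_zero, mul_zero, zero_mul, add_zero]
    refine Finset.sum_congr rfl fun p _ => ?_
    rw [show n + 2 - 2 * (p + 1) = n - 2 * p by omega]
    push_cast
    rw [ha']
    ring

theorem matchingPoly_recursion (n : ℕ) (z w : ℂ) :
    matchingPoly (n + 2) z w = z * matchingPoly (n + 1) z w + (n + 1) * w * matchingPoly n z w := by
  have h := matchingPoly_div_recursion n z w
  have h0 : (n.factorial : ℂ) ≠ 0 := by exact_mod_cast n.factorial_ne_zero
  have h1 : ((n : ℂ) + 1) ≠ 0 := Nat.cast_add_one_ne_zero n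
  have h2 : ((n : ℂ) + 2) ≠ 0 := by exact_mod_cast (Nat.succ_ne_zero (n + 1))
  simp only [Nat.factorial_succ] at h
  push_cast at h
  rw [show (n : ℂ) + 1 + 1 = n + 2 by ring] at h
  field_simp at h
  linear_combination h

theorem conj_matchingPoly (n : ℕ) (z w : ℂ) :
    conj (matchingPoly n z w) = matchingPoly n (conj z) (conj w) := by
  simp [matchingPoly, map_ofNat]

/-- The coefficients of the Mehler series satisfy the recursion of `taylor_recursion`. -/
theorem mehler_coeff_recursion (z w ζ υ : ℂ) (n : ℕ) :
    let a : ℕ → ℂ := fun n => matchingPoly n z w * matchingPoly n ζ υ / n.factorial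
    ((n : ℂ) + 4) * a (n + 4) = z * ζ * a (n + 3) +
      (w * υ * (2 * n + 5) + (z ^ 2 * υ + ζ ^ 2 * w)) * a (n + 2) +
      z * ζ * (w * υ) * a (n + 1) - (w * υ) ^ 2 * (n + 1) * a n := by
  intro a
  have h0 : (n.factorial : ℂ) ≠ 0 := by exact_mod_cast n.factorial_ne_zero
  have h1 : ((n : ℂ) + 1) ≠ 0 := by exact_mod_cast Nat.succ_ne_zero n
  have h2 : ((n : ℂ) + 2) ≠ 0 := by exact_mod_cast Nat.succ_ne_zero (n + 1)
  have h3 : ((n : ℂ) + 3) ≠ 0 := by exact_mod_cast Nat.succ_ne_zero (n + 2)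
  have h4 : ((n : ℂ) + 4) ≠ 0 := by exact_mod_cast Nat.succ_ne_zero (n + 3)
  -- The three-term recursion leaves only `P_n` and `P_{n+1}` at the two points; the claim is then a
  -- polynomial identity in these four values.
  simp only [a, matchingPoly_recursion, Nat.factorial_succ]
  push_cast
  rw [show (n : ℂ) + 1 + 1 = n + 2 by ring, show (n : ℂ) + 2 + 1 = n + 3 by ring,
    show (n : ℂ) + 3 + 1 = n + 4 by ring]
  field_simp
  ring

/-- The right hand side of Mehler's formula, as a function of the weight parameter `s`. -/
def mehlerFun (A B c s : ℂ) : ℂ :=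
  Complex.exp (-(1 / 2) * log (1 - c * s ^ 2) + (2 * A * s + B * s ^ 2) / (2 * (1 - c * s ^ 2)))

theorem mul_sq_mem_slitPlane {c s : ℂ} (h : ‖c‖ * ‖s‖ ^ 2 < 1) :
    1 - c * s ^ 2 ∈ slitPlane := by
  left
  have h2 := (Complex.re_le_norm (c * s ^ 2)).trans_lt (by simpa using h)
  simpa using h2

theorem hasDerivAt_mehlerFun {A B c s : ℂ} (h : ‖c‖ * ‖s‖ ^ 2 < 1) :
    HasDerivAt (mehlerFun A B c) ((A + (c + B) * s + A * c * s ^ 2 - c ^ 2 * s ^ 3) /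
      (1 - c * s ^ 2) ^ 2 * mehlerFun A B c s) s := by
  have hs := mul_sq_mem_slitPlane h
  have h0 := slitPlane_ne_zero hs
  have hd : HasDerivAt (fun s : ℂ => 1 - c * s ^ 2) (-(c * (2 * s))) s := by
    simpa using ((hasDerivAt_pow 2 s).const_mul c).const_sub 1
  have hn : HasDerivAt (fun s : ℂ => 2 * A * s + B * s ^ 2) (2 * A + B * (2 * s)) s := by
    have h1 : HasDerivAt (fun s : ℂ => 2 * A * s) (2 * A) s := by
      simpa using (hasDerivAt_id s).const_mul (2 * A)
    have h2 : HasDerivAt (fun s : ℂ => B * s ^ 2) (B * (2 * s)) s := by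
      simpa using (hasDerivAt_pow 2 s).const_mul B
    exact h1.add h2
  have h1 := (((hd.clog hs).const_mul (-(1 / 2) : ℂ)).add
    (hn.div (hd.const_mul 2) (by simpa using h0))).cexp
  refine h1.congr_deriv ?_
  rw [mul_comm]
  congr 1
  field_simp
  ring

/-- Weighting the `n`-th term by `s^n` turns the right side into a solution of a first-order linear
equation in `s`. Its Taylor coefficients obey the same recursion as the products `P_n P_n / n!`,
with the same first four values; then `s = 1`. -/
theorem hasSum_mehler_aux {z w ζ υ : ℂ} (h : ‖w * υ‖ < 1) :
    HasSum (fun n : ℕ => matchingPoly n z w * matchingPoly n ζ υ / n.factorial)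
      (mehlerFun (z * ζ) (z ^ 2 * υ + ζ ^ 2 * w) (w * υ) 1) := by
  -- The Taylor series is evaluated at `s = 1`, which must be interior to the disk of holomorphy.
  obtain ⟨R, hR1, hR⟩ : ∃ R : ℝ, 1 < R ∧ ‖w * υ‖ * R ^ 2 < 1 := by
    have hc : ContinuousAt (fun R : ℝ => ‖w * υ‖ * R ^ 2) 1 := by fun_prop
    have h2 : ∀ᶠ R in nhds (1 : ℝ), ‖w * υ‖ * R ^ 2 < 1 := hc.eventually_lt_const (by simpa using h)
    obtain ⟨ε, hε, h3⟩ := Metric.eventually_nhds_iff.mp h2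
    exact ⟨1 + ε / 2, by linarith, h3 (by rw [Real.dist_eq, add_sub_cancel_left, abs_of_pos] <;> linarith)⟩
  have hlt : ∀ s : ℂ, ‖s‖ < R → ‖w * υ‖ * ‖s‖ ^ 2 < 1 := fun s hs =>
    lt_of_le_of_lt (by gcongr) hR
  set f := mehlerFun (z * ζ) (z ^ 2 * υ + ζ ^ 2 * w) (w * υ) with hf
  have hd : DifferentiableOn ℂ f (Metric.ball 0 R) := fun s hs =>
    (hasDerivAt_mehlerFun (hlt s (by simpa using hs))).differentiableAt.differentiableWithinAt
  have hode : ∀ s : ℂ, ‖s‖ < R → (1 - w * υ * s ^ 2) ^ 2 * deriv f s =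
      (z * ζ + (w * υ + (z ^ 2 * υ + ζ ^ 2 * w)) * s + z * ζ * (w * υ) * s ^ 2 -
        (w * υ) ^ 2 * s ^ 3) * f s := fun s hs => by
    have h0 := slitPlane_ne_zero (mul_sq_mem_slitPlane (hlt s hs))
    rw [(hasDerivAt_mehlerFun (hlt s hs)).deriv, ← mul_assoc, mul_div_cancel₀ _ (pow_ne_zero 2 h0)]
  obtain ⟨b, hb⟩ : ∃ b : ℕ → ℂ, ∀ n, b n = PowerSeries.coeff n (taylor f) := ⟨_, fun _ => rfl⟩
  obtain ⟨e1, e2, e3, e4⟩ := taylor_recursion (by linarith) hd hode hb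
  have hb0 : b 0 = 1 := by simp [hb, taylor, hf, mehlerFun]
  set a : ℕ → ℂ := fun n => matchingPoly n z w * matchingPoly n ζ υ / n.factorial with ha
  have ha0 : a 0 = 1 := by simp [ha, matchingPoly_zero]
  have ha1 : a 1 = z * ζ := by simp [ha, matchingPoly_one]
  have hP2 : ∀ z w, matchingPoly 2 z w = z ^ 2 + w := fun z w => by
    rw [matchingPoly_recursion 0, matchingPoly_one, matchingPoly_zero]; push_cast; ring
  have hP3 : ∀ z w, matchingPoly 3 z w = z ^ 3 + 3 * z * w := fun z w => by
    rw [matchingPoly_recursion 1, hP2, matchingPoly_one]; push_cast; ring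
  have ha2 : a 2 = (z ^ 2 + w) * (ζ ^ 2 + υ) / 2 := by simp [ha, hP2]
  have ha3 : a 3 = (z ^ 3 + 3 * z * w) * (ζ ^ 3 + 3 * ζ * υ) / 6 := by
    simp [ha, hP3, Nat.factorial]
  -- The recursion has order four, so the induction carries four consecutive coefficients.
  have hab : ∀ n, a n = b n ∧ a (n + 1) = b (n + 1) ∧ a (n + 2) = b (n + 2) ∧
      a (n + 3) = b (n + 3) := by
    intro n
    induction n with
    | zero =>
      rw [hb0] at e1 e2 e3
      have f1 : b 1 = z * ζ := by rw [e1]; ring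
      rw [f1] at e2 e3
      have f2 : b 2 = a 2 := by rw [ha2]; linear_combination e2 / 2
      rw [f2, ha2] at e3
      refine ⟨by rw [ha0, hb0], by rw [ha1, f1], f2.symm, ?_⟩
      rw [ha3]
      linear_combination -e3 / 3
    | succ n ih =>
      obtain ⟨i0, i1, i2, i3⟩ := ih
      refine ⟨i1, i2, i3, ?_⟩
      have h4 : ((n : ℂ) + 4) ≠ 0 := by exact_mod_cast Nat.succ_ne_zero (n + 3)
      have hra := mehler_coeff_recursion z w ζ υ n
      have hrb := e4 n
      refine mul_left_cancel₀ h4 ?_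
      change ((n : ℂ) + 4) * a (n + 4) = (n + 4) * b (n + 4)
      rw [hrb, ← i0, ← i1, ← i2, ← i3]
      exact hra
  have hsum := isPowerSeriesOf_taylor hd 1 (by simpa using hR1)
  refine hsum.congr_fun fun n => ?_
  rw [one_pow, mul_one, ← hb, ← (hab n).1]

/-! ### The kernel as a sum over the base functions -/

/-- Scaling both `z`-variables by `√μ` multiplies the quadratic exponent by `μ`; Mehler's factor `(1
- w w̄')^(-1/2)` is the disk kernel of weight `1/4`. -/
theorem hasSum_mehler {x y : ℂ × ℂ} (hx : x ∈ disk) (hy : y ∈ disk) {μ : ℝ} (hμ : 0 < μ) :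
    HasSum (fun n : ℕ => matchingPoly n (Real.sqrt μ * x.1) x.2 / Real.sqrt n.factorial *
        conj (matchingPoly n (Real.sqrt μ * y.1) y.2 / Real.sqrt n.factorial))
      (diskKernel (1 / 4) x.2 y.2 * Complex.exp (μ * fFun x y)) := by
  have hlt : ‖x.2 * conj y.2‖ < 1 := by
    have hx' : ‖x.2‖ < 1 := hx
    have hy' : ‖y.2‖ < 1 := hy
    rw [norm_mul, Complex.norm_conj]
    nlinarith [norm_nonneg x.2, norm_nonneg y.2]
  have hs : ((Real.sqrt μ : ℝ) : ℂ) ^ 2 = μ := by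
    rw [← ofReal_pow, Real.sq_sqrt hμ.le]
  have h := hasSum_mehler_aux (z := Real.sqrt μ * x.1) (ζ := Real.sqrt μ * conj y.1) hlt
  have hden := den_ne_zero hx hy
  have e1 : mehlerFun (Real.sqrt μ * x.1 * (Real.sqrt μ * conj y.1))
      ((Real.sqrt μ * x.1) ^ 2 * conj y.2 + (Real.sqrt μ * conj y.1) ^ 2 * x.2)
      (x.2 * conj y.2) 1 = diskKernel (1 / 4) x.2 y.2 * Complex.exp (μ * fFun x y) := by
    unfold den at hden
    simp only [conjPair_apply] at hden
    rw [mehlerFun, Complex.exp_add, diskKernel, fFun, cpow_def_of_ne_zero hden]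
    congr 1
    · congr 1
      push_cast
      ring_nf
    · congr 1
      rw [mul_pow, mul_pow, show (Real.sqrt μ : ℂ) * x.1 * (Real.sqrt μ * conj y.1) =
        (Real.sqrt μ : ℂ) ^ 2 * (x.1 * conj y.1) by ring, hs]
      ring
  rw [e1] at h
  refine h.congr_fun fun n => ?_
  have h2 : ((Real.sqrt n.factorial : ℝ) : ℂ) ^ 2 = n.factorial := by
    rw [← ofReal_pow, Real.sq_sqrt (by positivity)]
    simp
  rw [map_div₀, conj_matchingPoly, conj_ofReal, map_mul, conj_ofReal, ← h2]
  ring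

/-- Both sides are the rising factorial of `a` over `m!`; this matches the binomial series with the
normalization of `diskBasis`. -/
theorem choose_eq_gamma {a : ℝ} (ha : 0 < a) (m : ℕ) :
    Ring.choose ((a : ℂ) + m - 1) m =
      ((Real.Gamma (m + a) / (m.factorial * Real.Gamma a) : ℝ) : ℂ) := by
  have h0 : (m.factorial : ℂ) ≠ 0 := by exact_mod_cast m.factorial_ne_zero
  have h1 := Ring.factorial_nsmul_multichoose_eq_ascPochhammer (a : ℂ) m
  have hg : Complex.Gamma a ≠ 0 := Complex.Gamma_ne_zero_of_re_pos (by simpa using ha)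
  rw [Polynomial.ascPochhammer_smeval_eq_eval, Ring.multichoose_eq, nsmul_eq_mul,
    ← Complex.Gamma_add_nat_div_Gamma_eq] at h1
  · rw [← mul_right_inj' h0, h1]
    push_cast
    rw [← Complex.Gamma_ofReal, ← Complex.Gamma_ofReal]
    push_cast
    rw [add_comm (a : ℂ)]
    field_simp
  · intro j hj
    have := congrArg Complex.re hj
    simp only [ofReal_re, neg_re, natCast_re] at this
    have : (0 : ℝ) ≤ j := j.cast_nonneg
    linarith

theorem gamma_coeff_nonneg {a : ℝ} (ha : 0 < a) (m : ℕ) :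
    0 ≤ Real.Gamma (m + a) / (m.factorial * Real.Gamma a) := by
  have h1 := Real.Gamma_pos_of_pos ha
  have h2 : 0 < Real.Gamma (m + a) := Real.Gamma_pos_of_pos (by positivity)
  positivity

theorem hasSum_diskKernel {k' : ℝ} (hk' : 0 < k') {w w' : ℂ} (hw : ‖w‖ < 1) (hw' : ‖w'‖ < 1) :
    HasSum (fun m : ℕ => diskBasis k' m w * conj (diskBasis k' m w')) (diskKernel k' w w') := by
  have hlt : ‖w * conj w'‖ < 1 := by
    rw [norm_mul, Complex.norm_conj]
    nlinarith [norm_nonneg w, norm_nonneg w']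
  have h := (Complex.one_div_one_sub_cpow_hasFPowerSeriesOnBall_zero
    ((2 * k' : ℝ) : ℂ)).hasSum (y := w * conj w') (by
      rw [← ENNReal.ofReal_one, Metric.eball_ofReal]
      simpa using hlt)
  rw [zero_add, one_div, ← cpow_neg] at h
  rw [diskKernel]
  refine (h.congr_fun fun m => ?_)
  have h2 := Real.sq_sqrt (gamma_coeff_nonneg (by positivity : 0 < 2 * k') m)
  rw [FormalMultilinearSeries.ofScalars_apply_eq, choose_eq_gamma (by positivity), ← h2,
    diskBasis, diskBasis, map_mul, map_pow, conj_ofReal, smul_eq_mul, mul_pow]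
  push_cast
  ring

theorem diskKernel_mul (k l : ℝ) {w w' : ℂ} (hw : ‖w‖ < 1) (hw' : ‖w'‖ < 1) :
    diskKernel k w w' * diskKernel l w w' = diskKernel (k + l) w w' := by
  have h := den_ne_zero (x := (0, w)) (y := (0, w')) hw hw'
  unfold den at h
  simp only [conjPair_apply] at h
  rw [diskKernel, diskKernel, diskKernel, ← cpow_add _ _ h]
  congr 1
  push_cast
  ring

theorem hasSum_mul_prod {f g : ℕ → ℂ} {a b : ℂ} (hf : HasSum f a) (hg : HasSum g b) :
    HasSum (fun p : ℕ × ℕ => f p.1 * g p.2) (a * b) :=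
  HasSum.mul hf hg (summable_mul_of_summable_norm hf.summable.norm hg.summable.norm)

theorem hasSum_jacobiKernel {k k' μ : ℝ} (hk : k = k' + 1 / 4) (hk' : 0 < k') (hμ : 0 < μ)
    {x y : ℂ × ℂ} (hx : x ∈ disk) (hy : y ∈ disk) :
    HasSum (fun p : ℕ × ℕ => jacobiBasis k' μ p.1 p.2 x * conj (jacobiBasis k' μ p.1 p.2 y))
      (jacobiKernel k μ x y) := by
  have h1 := hasSum_mehler hx hy hμ
  have h2 := hasSum_diskKernel hk' (w := x.2) (w' := y.2) hx hy
  have h3 := hasSum_mul_prod h1 h2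
  have e : diskKernel (1 / 4) x.2 y.2 * Complex.exp (μ * fFun x y) * diskKernel k' x.2 y.2 =
      jacobiKernel k μ x y := by
    rw [jacobiKernel, hk, ← diskKernel_mul k' (1 / 4) hx hy]
    ring
  rw [← e]
  convert h3 using 2 with p
  rw [jacobiBasis, jacobiBasis, map_mul]
  ring

/-! ### Holomorphic series in several variables -/

/-- Cauchy's estimate on each complex line through `x`. In direction `X` the line stays in the
closed ball for `‖t‖ ≤ r / ‖X‖`. -/
theorem norm_fderiv_le_of_forall_norm_le {E G : Type*} [NormedAddCommGroup E] [NormedSpace ℂ E]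
    [NormedAddCommGroup G] [NormedSpace ℂ G] {f : E → G} {x : E} {r C : ℝ}
    (hr : 0 < r) (hf : ∀ y, dist y x ≤ r → DifferentiableAt ℂ f y)
    (hC : ∀ y, dist y x ≤ r → ‖f y‖ ≤ C) : ‖fderiv ℂ f x‖ ≤ C / r := by
  have hC0 : 0 ≤ C := (norm_nonneg _).trans (hC x (by simpa using hr.le))
  refine ContinuousLinearMap.opNorm_le_bound _ (by positivity) fun X => ?_
  rcases eq_or_ne X 0 with rfl | hX
  · simp
  have hX' : 0 < ‖X‖ := norm_pos_iff.mpr hX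
  have hdist : ∀ t : ℂ, ‖t‖ ≤ r / ‖X‖ → dist (x + t • X) x ≤ r := fun t ht => by
    rw [dist_eq_norm, add_sub_cancel_left, norm_smul]
    exact (le_div_iff₀ hX').mp ht
  have hd : ∀ t : ℂ, ‖t‖ ≤ r / ‖X‖ → DifferentiableAt ℂ (fun t : ℂ => f (x + t • X)) t :=
    fun t ht => (hf _ (hdist t ht)).comp t (by fun_prop)
  have h1 : deriv (fun t : ℂ => f (x + t • X)) 0 = fderiv ℂ f x X :=
    ((hf x (by simpa using hr.le)).hasFDerivAt.hasLineDerivAt X).deriv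
  have h2 := Complex.norm_deriv_le_of_forall_mem_sphere_norm_le (c := 0) (C := C)
    (f := fun t : ℂ => f (x + t • X)) (div_pos hr hX')
    (DifferentiableOn.diffContOnCl fun t ht => by
      rw [closure_ball _ (div_pos hr hX').ne'] at ht
      exact (hd t (by simpa using ht)).differentiableWithinAt)
    fun t ht => hC _ (hdist t (by simpa using (mem_sphere_zero_iff_norm.mp ht).le))
  rw [h1] at h2
  refine h2.trans (le_of_eq ?_)
  field_simp

/-- A locally normally convergent series of holomorphic maps is holomorphic. -/
theorem differentiableOn_tsum_of_locally_norm_le {E G α : Type*} [NormedAddCommGroup E]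
    [NormedSpace ℂ E] [NormedAddCommGroup G] [NormedSpace ℂ G] [CompleteSpace G] {U : Set E}
    (hU : IsOpen U) {f : α → E → G} (hf : ∀ n, DifferentiableOn ℂ (f n) U)
    (hb : ∀ x ∈ U, ∃ V ∈ nhds x, ∃ u : α → ℝ, Summable u ∧ ∀ n, ∀ y ∈ V, ‖f n y‖ ≤ u n) :
    DifferentiableOn ℂ (fun x => ∑' n, f n x) U := by
  intro x hx
  obtain ⟨V, hV, u, hu, hfu⟩ := hb x hx
  obtain ⟨ε, hε, hball⟩ := Metric.mem_nhds_iff.mp (Filter.inter_mem hV (hU.mem_nhds hx))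
  -- The real structure is only used for convexity, hence preconnectedness, of the ball.
  let : NormedSpace ℝ E := NormedSpace.restrictScalars ℝ ℂ E
  have hd : ∀ n, ∀ y ∈ Metric.ball x ε, DifferentiableAt ℂ (f n) y := fun n y hy =>
    (hf n).differentiableAt (hU.mem_nhds (hball hy).2)
  -- Around points of the half ball, Cauchy's estimate with radius `ε / 2` turns the bounds `u n`
  -- into summable bounds for the derivatives.
  have hsub : ∀ y ∈ Metric.ball x (ε / 2), ∀ z, dist z y ≤ ε / 2 → z ∈ Metric.ball x ε :=
    fun y hy z hz => by
      have := dist_triangle z y x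
      have := Metric.mem_ball.mp hy
      exact Metric.mem_ball.mpr (by linarith)
  have hx' : x ∈ Metric.ball x (ε / 2) := Metric.mem_ball_self (by linarith)
  refine (hasFDerivAt_tsum_of_isPreconnected (u := fun n => u n / (ε / 2)) (hu.div_const _)
    Metric.isOpen_ball (convex_ball x (ε / 2)).isPreconnected
    (fun n y hy => (hd n y (hsub y hy y (by rw [dist_self]; linarith))).hasFDerivAt)
    (fun n y hy => norm_fderiv_le_of_forall_norm_le (by linarith)
      (fun z hz => hd n z (hsub y hy z hz))
      fun z hz => hfu n z (hball (hsub y hy z hz)).1) hx'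
    (Summable.of_norm_bounded hu fun n => hfu n x (mem_of_mem_nhds hV))
    hx').differentiableAt.differentiableWithinAt

/-! ### Bounds for the base functions -/

theorem matchingPoly_ofReal (n : ℕ) (R r : ℝ) : matchingPoly n R r =
    ((n.factorial * ∑ p ∈ Finset.range (n / 2 + 1), (r / 2) ^ p *
      (R ^ (n - 2 * p) / (p.factorial * (n - 2 * p).factorial)) : ℝ) : ℂ) := by
  rw [matchingPoly]
  push_cast
  rfl

theorem norm_matchingPoly_le (n : ℕ) {z w : ℂ} {R r : ℝ} (hz : ‖z‖ ≤ R) (hw : ‖w‖ ≤ r) :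
    ‖matchingPoly n z w‖ ≤ ‖matchingPoly n (R : ℂ) (r : ℂ)‖ := by
  have hR : 0 ≤ R := (norm_nonneg z).trans hz
  have hr : 0 ≤ r := (norm_nonneg w).trans hw
  rw [matchingPoly_ofReal, Complex.norm_of_nonneg (by positivity), matchingPoly, norm_mul,
    Complex.norm_natCast]
  gcongr
  refine (norm_sum_le _ _).trans (Finset.sum_le_sum fun p _ => ?_)
  rw [norm_mul, norm_pow, norm_div, norm_div, norm_pow, norm_mul, Complex.norm_natCast,
    Complex.norm_natCast, Complex.norm_ofNat]
  gcongr

theorem matchingPoly_scale (n : ℕ) (t z w : ℂ) :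
    matchingPoly n (t * z) (t ^ 2 * w) = t ^ n * matchingPoly n z w := by
  rw [matchingPoly, matchingPoly, mul_left_comm]
  congr 1
  rw [Finset.mul_sum]
  refine Finset.sum_congr rfl fun p hp => ?_
  have hp' : n = 2 * p + (n - 2 * p) := by
    have := Finset.mem_range.mp hp
    omega
  have e : t ^ n = (t ^ 2) ^ p * t ^ (n - 2 * p) := by rw [← pow_mul, ← pow_add, ← hp']
  rw [e, mul_pow, mul_div_assoc, mul_pow]
  ring

theorem norm_jacobiBasis_le (k' : ℝ) {μ : ℝ} (n m : ℕ) {x : ℂ × ℂ} {R r : ℝ} (hz : ‖x.1‖ ≤ R)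
    (hw : ‖x.2‖ ≤ r) : ‖jacobiBasis k' μ n m x‖ ≤ ‖jacobiBasis k' μ n m ((R : ℂ), (r : ℂ))‖ := by
  have hr : 0 ≤ r := (norm_nonneg _).trans hw
  simp only [jacobiBasis, diskBasis, norm_mul, norm_div, norm_pow, Complex.norm_of_nonneg hr]
  gcongr
  rw [← ofReal_mul]
  refine norm_matchingPoly_le n ?_ hw
  rw [norm_mul, Complex.norm_of_nonneg (Real.sqrt_nonneg μ)]
  gcongr

/-- The grading with `z` of weight 1 and `w` of weight 2. It gives geometric decay in
`exists_summable_bound` and separates terms in `eq_zero_of_hasSum_jacobiBasis`. -/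
theorem jacobiBasis_scale (k' μ : ℝ) (n m : ℕ) (t : ℂ) (x : ℂ × ℂ) :
    jacobiBasis k' μ n m (t * x.1, t ^ 2 * x.2) = t ^ (n + 2 * m) * jacobiBasis k' μ n m x := by
  simp only [jacobiBasis, diskBasis]
  rw [mul_left_comm, matchingPoly_scale]
  ring

theorem conj_jacobiBasis (k' μ : ℝ) (n m : ℕ) (x : ℂ × ℂ) :
    conj (jacobiBasis k' μ n m x) = jacobiBasis k' μ n m (conjPair x) := by
  simp only [jacobiBasis, diskBasis, map_mul, map_div₀, conj_matchingPoly, conj_ofReal, map_pow,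
    conjPair_apply]

theorem differentiable_jacobiBasis (k' μ : ℝ) (n m : ℕ) :
    Differentiable ℂ (jacobiBasis k' μ n m) := by
  unfold jacobiBasis diskBasis matchingPoly
  fun_prop

theorem conjPair_mem_disk {x : ℂ × ℂ} : conjPair x ∈ disk ↔ x ∈ disk := by
  simp [disk]

section Family

variable {k k' μ : ℝ}

theorem summable_jacobiBasis_sq (hk' : 0 < k') (hμ : 0 < μ) {x : ℂ × ℂ} (hx : x ∈ disk) :
    Summable fun p : ℕ × ℕ => ‖jacobiBasis k' μ p.1 p.2 x‖ ^ 2 := by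
  have h := (hasSum_jacobiKernel rfl hk' hμ hx hx).summable.norm
  refine h.congr fun p => ?_
  rw [norm_mul, Complex.norm_conj, sq]

/-- The base functions are locally uniformly summable. -/
theorem exists_summable_bound (hk' : 0 < k') (hμ : 0 < μ) {x : ℂ × ℂ} (hx : x ∈ disk) :
    ∃ V ∈ nhds x, ∃ u : ℕ × ℕ → ℝ, Summable u ∧
      ∀ p, ∀ y ∈ V, ‖jacobiBasis k' μ p.1 p.2 y‖ ≤ u p := by
  have hx' : ‖x.2‖ < 1 := hx
  obtain ⟨r, hr1, hr2⟩ := exists_between hx'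
  have hr0 : 0 ≤ r := (norm_nonneg _).trans hr1.le
  -- The kernel only gives square summability. With `√r < t < 1` the point `(R / t, r / t²)` is
  -- still in the disk, and homogeneity yields a factor `t^(n + 2m)`; the arithmetic-geometric
  -- inequality then bounds the product by two summable squares.
  obtain ⟨t, ht1, ht2⟩ : ∃ t, Real.sqrt r < t ∧ t < 1 :=
    exists_between (by rw [Real.sqrt_lt' one_pos]; simpa using hr2)
  have ht0 : 0 < t := (Real.sqrt_nonneg r).trans_lt ht1
  have hrt : r / t ^ 2 < 1 := by
    rw [div_lt_one (by positivity)]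
    exact (Real.sqrt_lt' ht0).mp ht1
  set R := ‖x.1‖ + 1 with hR
  set y : ℂ × ℂ := (((R / t : ℝ) : ℂ), ((r / t ^ 2 : ℝ) : ℂ)) with hy
  have hyd : y ∈ disk := by
    change ‖((r / t ^ 2 : ℝ) : ℂ)‖ < 1
    rwa [Complex.norm_of_nonneg (by positivity)]
  have hyt : ((R : ℂ), (r : ℂ)) = ((t : ℂ) * y.1, (t : ℂ) ^ 2 * y.2) := by
    have : (t : ℂ) ≠ 0 := by exact_mod_cast ht0.ne'
    rw [hy]
    push_cast
    ext
    · simp only; field_simp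
    · simp only; field_simp
  refine ⟨{y | ‖y.1‖ < R ∧ ‖y.2‖ < r}, ?_,
    fun p => ((t ^ 2) ^ p.1 * ((t ^ 2) ^ 2) ^ p.2 + ‖jacobiBasis k' μ p.1 p.2 y‖ ^ 2) / 2, ?_, ?_⟩
  · refine IsOpen.mem_nhds ?_ ⟨by simp [hR], hr1⟩
    exact (isOpen_lt continuous_fst.norm continuous_const).inter
      (isOpen_lt continuous_snd.norm continuous_const)
  · refine (Summable.add ?_ (summable_jacobiBasis_sq hk' hμ hyd)).div_const 2
    have h1 : Summable fun n : ℕ => (t ^ 2) ^ n :=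
      summable_geometric_of_lt_one (by positivity) (by nlinarith)
    have h2 : Summable fun n : ℕ => ((t ^ 2) ^ 2) ^ n :=
      summable_geometric_of_lt_one (by positivity) (by
        have : t ^ 2 < 1 := by nlinarith
        nlinarith [sq_nonneg t])
    exact h1.mul_of_nonneg h2 (fun n => by positivity) fun n => by positivity
  · rintro ⟨n, m⟩ z ⟨hz1, hz2⟩
    refine (norm_jacobiBasis_le k' n m hz1.le hz2.le).trans ?_
    rw [hyt, jacobiBasis_scale, norm_mul, norm_pow, Complex.norm_of_nonneg ht0.le]
    have e : (t ^ 2) ^ n * ((t ^ 2) ^ 2) ^ m = (t ^ (n + 2 * m)) ^ 2 := by ring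
    simp only [e]
    nlinarith [sq_nonneg (t ^ (n + 2 * m) - ‖jacobiBasis k' μ n m y‖)]

end Family

/-! ### The map to the Hilbert space of square summable sequences -/

section KernelMap

variable {ι : Type*} (σ : ι ≃ ℕ × ℕ) (k' μ : ℝ)

open Classical in
/-- The map `x ↦ (f_{nk'm}(x))` to `ℓ²`, extended by zero. -/
def kernelMap (x : ℂ × ℂ) : lp (fun _ : ι => ℂ) 2 :=
  if h : Memℓp (fun i => jacobiBasis k' μ (σ i).1 (σ i).2 x) 2 then ⟨_, h⟩ else 0

variable {k k' μ}

theorem kernelMap_apply (hk' : 0 < k') (hμ : 0 < μ) {x : ℂ × ℂ} (hx : x ∈ disk) (i : ι) :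
    kernelMap σ k' μ x i = jacobiBasis k' μ (σ i).1 (σ i).2 x := by
  have h : Memℓp (fun i => jacobiBasis k' μ (σ i).1 (σ i).2 x) 2 := by
    rw [memℓp_gen_iff (by norm_num)]
    have := σ.summable_iff.mpr (summable_jacobiBasis_sq hk' hμ hx)
    simpa [Function.comp_def] using this
  rw [kernelMap, dif_pos h]

theorem inner_kernelMap (hk : k = k' + 1 / 4) (hk' : 0 < k') (hμ : 0 < μ) {x y : ℂ × ℂ}
    (hx : x ∈ disk) (hy : y ∈ disk) :
    ⟪kernelMap σ k' μ y, kernelMap σ k' μ x⟫_ℂ = jacobiKernel k μ x y := by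
  refine (lp.hasSum_inner _ _).unique ?_
  have h := σ.hasSum_iff.mpr (hasSum_jacobiKernel hk hk' hμ hx hy)
  refine h.congr_fun fun i => ?_
  rw [kernelMap_apply σ hk' hμ hx, kernelMap_apply σ hk' hμ hy]
  simp [RCLike.inner_apply]

/-- The map is the series of the `f_i(x)` times the unit vectors, which converges normally by the
absolute summability of `exists_summable_bound`. -/
theorem differentiableOn_kernelMap (hk' : 0 < k') (hμ : 0 < μ) :
    DifferentiableOn ℂ (kernelMap σ k' μ) disk := by
  classical
  have h1 : DifferentiableOn ℂ (fun x => ∑' i, jacobiBasis k' μ (σ i).1 (σ i).2 x •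
      (lp.single 2 i (1 : ℂ) : lp (fun _ : ι => ℂ) 2)) disk := by
    refine differentiableOn_tsum_of_locally_norm_le isOpen_disk (fun i =>
      ((differentiable_jacobiBasis k' μ _ _).smul_const _).differentiableOn) fun x hx => ?_
    obtain ⟨V, hV, u, hu, hfu⟩ := exists_summable_bound hk' hμ hx
    refine ⟨V, hV, u ∘ σ, σ.summable_iff.mpr hu, fun i y hy => ?_⟩
    rw [norm_smul, lp.norm_single (by norm_num), norm_one, mul_one]
    exact hfu _ y hy
  refine h1.congr fun x hx => ?_
  have h2 := lp.hasSum_single (p := 2) (by norm_num) (kernelMap σ k' μ x)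
  refine (h2.congr_fun fun i => ?_).tsum_eq.symm
  rw [kernelMap_apply σ hk' hμ hx, ← lp.single_smul, smul_eq_mul, mul_one]

end KernelMap

/-! ### Linear independence of the base functions -/

/-- Regroups a double series by the weight `d = n + 2m`: reindex along the injection `(n, m) ↦ (n +
2m, m)`, extend by zero, and sum each finite row. -/
theorem hasSum_weight {G : ℕ × ℕ → ℂ} {a : ℂ} (h : HasSum G a) :
    HasSum (fun d => ∑ m ∈ Finset.range (d / 2 + 1), G (d - 2 * m, m)) a := by
  set j : ℕ × ℕ → ℕ × ℕ := fun p => (p.1 + 2 * p.2, p.2) with hj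
  have hinj : Function.Injective j := by
    rintro ⟨n, m⟩ ⟨n', m'⟩ h
    simp only [hj, Prod.mk.injEq] at h ⊢
    omega
  set H : ℕ × ℕ → ℂ := fun q => if 2 * q.2 ≤ q.1 then G (q.1 - 2 * q.2, q.2) else 0 with hH
  have hHj : H ∘ j = G := by
    funext p
    simp [hH, hj]
  have h1 : HasSum H a := by
    rw [← hinj.hasSum_iff, hHj]
    · exact h
    · rintro ⟨d, m⟩ hq
      simp only [hH]
      refine if_neg fun hle => hq ⟨(d - 2 * m, m), ?_⟩
      simp only [hj, Prod.mk.injEq, and_true]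
      omega
  refine h1.prod_fiberwise fun d => ?_
  have h2 : ∑ m ∈ Finset.range (d / 2 + 1), G (d - 2 * m, m) =
      ∑ m ∈ Finset.range (d / 2 + 1), H (d, m) := by
    refine Finset.sum_congr rfl fun m hm => ?_
    have := Finset.mem_range.mp hm
    simp only [hH]
    rw [if_pos (by omega)]
  rw [h2]
  refine hasSum_sum_of_ne_finset_zero fun m hm => ?_
  have := Finset.mem_range.not.mp hm
  simp only [hH]
  rw [if_neg (by omega)]

theorem matchingPoly_zero_right (n : ℕ) (z : ℂ) : matchingPoly n z 0 = z ^ n := by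
  have h0 : (n.factorial : ℂ) ≠ 0 := by exact_mod_cast n.factorial_ne_zero
  rw [matchingPoly, Finset.sum_eq_single 0]
  · simp
    field_simp
  · intro p _ hp
    simp [hp]
  · simp

theorem gamma_coeff_pos {a : ℝ} (ha : 0 < a) (m : ℕ) :
    0 < Real.Gamma (m + a) / (m.factorial * Real.Gamma a) := by
  have h1 := Real.Gamma_pos_of_pos ha
  have h2 : 0 < Real.Gamma (m + a) := Real.Gamma_pos_of_pos (by positivity)
  positivity

/-- The base functions are linearly independent in the sense of convergent series. -/
theorem eq_zero_of_hasSum_jacobiBasis {k' μ : ℝ} (hk' : 0 < k') (hμ : 0 < μ) {c : ℕ × ℕ → ℂ}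
    (h : ∀ x ∈ disk, HasSum (fun p : ℕ × ℕ => jacobiBasis k' μ p.1 p.2 x * c p) 0) : c = 0 := by
  -- Along `s ↦ (s z, s² w)` the series becomes a power series in `s` with sum zero, so every weight
  -- component vanishes.
  have hS : ∀ d, ∀ x ∈ disk, ∑ m ∈ Finset.range (d / 2 + 1),
      jacobiBasis k' μ (d - 2 * m) m x * c (d - 2 * m, m) = 0 := by
    intro d x hx
    set S : PowerSeries ℂ := PowerSeries.mk fun d => ∑ m ∈ Finset.range (d / 2 + 1),
      jacobiBasis k' μ (d - 2 * m) m x * c (d - 2 * m, m) with hSdef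
    have h1 : IsPowerSeriesOf 1 S fun _ => 0 := fun s hs => by
      have hsx : (s * x.1, s ^ 2 * x.2) ∈ disk := by
        change ‖s ^ 2 * x.2‖ < 1
        have hx' : ‖x.2‖ < 1 := hx
        rw [norm_mul, norm_pow]
        have : ‖s‖ ^ 2 ≤ 1 := pow_le_one₀ (norm_nonneg s) hs.le
        nlinarith [norm_nonneg x.2]
      refine (hasSum_weight (h _ hsx)).congr_fun fun d => ?_
      rw [hSdef, PowerSeries.coeff_mk, Finset.sum_mul]
      refine Finset.sum_congr rfl fun m hm => ?_
      have hd : d - 2 * m + 2 * m = d := by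
        have := Finset.mem_range.mp hm
        omega
      rw [jacobiBasis_scale, hd]
      ring
    have h2 : IsPowerSeriesOf 1 0 fun _ => 0 := fun s _ => by simp
    have h3 := congrArg (PowerSeries.coeff d) (h1.unique one_pos h2)
    simpa [hSdef] using h3
  have hsq : ((Real.sqrt μ : ℝ) : ℂ) ≠ 0 := by
    exact_mod_cast (Real.sqrt_pos.mpr hμ).ne'
  -- Within weight `d`, take `√μ z = 1`. By induction the terms below `m` are gone; dividing by
  -- `w^m` and letting `w → 0` isolates the coefficient at `m`, since `P_n(1, 0) = 1`.
  have hc : ∀ d m, m ≤ d / 2 → c (d - 2 * m, m) = 0 := by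
    intro d m
    induction m using Nat.strong_induction_on with
    | _ m ih =>
      intro hm
      set A : ℕ → ℂ := fun m =>
        Real.sqrt (Real.Gamma (m + 2 * k') / (m.factorial * Real.Gamma (2 * k')))
      set g : ℂ → ℂ := fun w => ∑ l ∈ Finset.range (d / 2 + 1), if m ≤ l then
        A l * w ^ (l - m) * (matchingPoly (d - 2 * l) 1 w / Real.sqrt (d - 2 * l).factorial) *
          c (d - 2 * l, l) else 0 with hg
      have hgc : Continuous g := by
        refine continuous_finsetSum _ fun l _ => ?_
        split_ifs
        · unfold matchingPoly
          fun_prop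
        · exact continuous_const
      have hg0 : ∀ᶠ w in nhdsWithin (0 : ℂ) {0}ᶜ, g w = 0 := by
        filter_upwards [self_mem_nhdsWithin,
          mem_nhdsWithin_of_mem_nhds (Metric.ball_mem_nhds (0 : ℂ) one_pos)] with w hw hw1
        have hw0 : w ≠ 0 := hw
        have hx : ((Real.sqrt μ : ℂ)⁻¹, w) ∈ disk := by simpa [disk] using hw1
        have h4 := hS d _ hx
        refine (mul_eq_zero.mp ?_).resolve_left (pow_ne_zero m hw0)
        rw [← h4, hg, Finset.mul_sum]
        refine Finset.sum_congr rfl fun l hl => ?_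
        split_ifs with hml
        · obtain ⟨q, rfl⟩ := Nat.exists_eq_add_of_le hml
          simp only [jacobiBasis, diskBasis, mul_inv_cancel₀ hsq, Nat.add_sub_cancel_left, A]
          ring
        · have := Finset.mem_range.mp hl
          rw [ih l (by omega) (by omega)]
          ring
      have hlim : g 0 = 0 :=
        tendsto_nhds_unique ((hgc.tendsto 0).mono_left nhdsWithin_le_nhds)
          (tendsto_const_nhds.congr' (hg0.mono fun w hw => hw.symm))
      rw [hg] at hlim
      simp only at hlim
      rw [Finset.sum_eq_single m] at hlim
      · have hA : A m ≠ 0 := by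
          have := Real.sqrt_pos.mpr (gamma_coeff_pos (by positivity : 0 < 2 * k') m)
          change ((Real.sqrt _ : ℝ) : ℂ) ≠ 0
          exact_mod_cast this.ne'
        have hf : ((Real.sqrt (d - 2 * m).factorial : ℝ) : ℂ) ≠ 0 := by
          have : (0 : ℝ) < (d - 2 * m).factorial := by positivity
          exact_mod_cast (Real.sqrt_pos.mpr this).ne'
        simpa [hA, hf, matchingPoly_zero_right] using hlim
      · intro l _ hl
        split_ifs with hml
        · rw [zero_pow (by omega)]
          ring
        · rfl
      · intro hm'
        exact absurd (Finset.mem_range.mpr (by omega)) hm'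
  funext p
  obtain ⟨n, m⟩ := p
  have := hc (n + 2 * m) m (by omega)
  simpa using this

section Coherent

variable {ι : Type*} (σ : ι ≃ ℕ × ℕ) {k k' μ : ℝ}

/-- The vectors `e_{ς̄}` in `ℓ²` form a total system of coherent vectors. -/
theorem isCoherentSystem_kernelMap (hk : k = k' + 1 / 4) (hk' : 0 < k') (hμ : 0 < μ) :
    IsCoherentSystem disk (jacobiKernel k μ) fun x => kernelMap σ k' μ (conjPair x) := by
  constructor
  · intro x hx y hy
    change ⟪kernelMap σ k' μ (conjPair x), kernelMap σ k' μ (conjPair y)⟫_ℂ = _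
    refine (lp.hasSum_inner (kernelMap σ k' μ (conjPair x))
      (kernelMap σ k' μ (conjPair y))).unique ?_
    have h := σ.hasSum_iff.mpr (hasSum_jacobiKernel hk hk' hμ hx hy)
    refine h.congr_fun fun i => ?_
    rw [kernelMap_apply σ hk' hμ (conjPair_mem_disk.mpr hx),
      kernelMap_apply σ hk' hμ (conjPair_mem_disk.mpr hy), ← conj_jacobiBasis, ← conj_jacobiBasis]
    simp [RCLike.inner_apply, mul_comm]
  · rw [Submodule.topologicalClosure_eq_top_iff, Submodule.eq_bot_iff]
    intro v hv
    -- Orthogonality to all coherent vectors says that the series of the base functions with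
    -- coefficients `v` vanishes on the disk.
    have h0 : (fun p => v (σ.symm p)) = 0 := by
      refine eq_zero_of_hasSum_jacobiBasis hk' hμ fun x hx => ?_
      have h1 : ⟪kernelMap σ k' μ (conjPair x), v⟫_ℂ = 0 :=
        (Submodule.mem_orthogonal _ _).mp hv _ (Submodule.subset_span ⟨x, hx, rfl⟩)
      have h2 := lp.hasSum_inner (𝕜 := ℂ) (G := fun _ : ι => ℂ) (kernelMap σ k' μ (conjPair x)) v
      rw [h1] at h2
      rw [← σ.hasSum_iff]
      refine h2.congr_fun fun i => ?_
      rw [kernelMap_apply σ hk' hμ (conjPair_mem_disk.mpr hx), ← conj_jacobiBasis]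
      simp [RCLike.inner_apply, mul_comm]
    ext i
    have := congrFun h0 (σ i)
    simpa using this

end Coherent

/-! ### The pullback of the Fubini-Study form -/

section Pullback

variable {ι : Type*} (σ : ι ≃ ℕ × ℕ) {k k' μ : ℝ}

theorem jacobiKernel_ne_zero (k μ : ℝ) {x y : ℂ × ℂ} (hx : x ∈ disk) (hy : y ∈ disk) :
    jacobiKernel k μ x y ≠ 0 := by
  rw [jacobiKernel_eq_exp k μ hx hy]
  exact Complex.exp_ne_zero _

theorem kernelMap_ne_zero (hk' : 0 < k') (hμ : 0 < μ) {x : ℂ × ℂ} (hx : x ∈ disk) :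
    kernelMap σ k' μ x ≠ 0 := by
  intro h
  have h1 := inner_kernelMap σ rfl hk' hμ hx hx
  rw [h, inner_zero_left] at h1
  exact jacobiKernel_ne_zero _ _ hx hx h1.symm

theorem differentiableAt_kernelMap (hk' : 0 < k') (hμ : 0 < μ) {x : ℂ × ℂ} (hx : x ∈ disk) :
    DifferentiableAt ℂ (kernelMap σ k' μ) x :=
  (differentiableOn_kernelMap σ hk' hμ).differentiableAt (isOpen_disk.mem_nhds hx)

theorem inner_kernelMap_fderiv (hk : k = k' + 1 / 4) (hk' : 0 < k') (hμ : 0 < μ) {x y : ℂ × ℂ}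
    (hx : x ∈ disk) (hy : y ∈ disk) (X : ℂ × ℂ) :
    ⟪kernelMap σ k' μ y, fderiv ℂ (kernelMap σ k' μ) x X⟫_ℂ =
      Complex.exp (potential k μ (x, conjPair y)) * potentialGrad k μ X (x, conjPair y) := by
  have h1 := (innerSL ℂ (kernelMap σ k' μ y)).hasFDerivAt.comp x
    (differentiableAt_kernelMap σ hk' hμ hx).hasFDerivAt
  have h2 : HasFDerivAt (fun x : ℂ × ℂ => (x, conjPair y))
      ((ContinuousLinearMap.id ℂ (ℂ × ℂ)).prod 0) x :=
    (hasFDerivAt_id x).prodMk (hasFDerivAt_const _ x)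
  have h3 := ((differentiableAt_potential k μ
    (den_mem_slitPlane hx hy)).hasFDerivAt.comp x h2).cexp
  have h4 : (innerSL ℂ (kernelMap σ k' μ y)) ∘ kernelMap σ k' μ =ᶠ[nhds x]
      fun x => Complex.exp (potential k μ (x, conjPair y)) := by
    filter_upwards [isOpen_disk.mem_nhds hx] with x' hx'
    rw [← jacobiKernel_eq_exp k μ hx' hy, ← inner_kernelMap σ hk hk' hμ hx' hy]
    rfl
  have h5 := congrArg (fun L => L X) (h1.unique (h3.congr_of_eventuallyEq h4))
  refine h5.trans ?_
  change Complex.exp (potential k μ (x, conjPair y)) *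
    fderiv ℂ (potential k μ) (x, conjPair y) (X, 0) = _
  rw [fderiv_potential k μ (den_mem_slitPlane hx hy)]
  simp [potentialGrad]

/-- The identity of `inner_kernelMap_fderiv`, differentiated in `y` at `y = x` with the right-hand
vector frozen. Here `y` enters through its conjugate, so the derivative is real. -/
theorem inner_fderiv_kernelMap_fderiv (hk : k = k' + 1 / 4) (hk' : 0 < k') (hμ : 0 < μ)
    {x : ℂ × ℂ} (hx : x ∈ disk) (X Y : ℂ × ℂ) :
    ⟪fderiv ℂ (kernelMap σ k' μ) x Y, fderiv ℂ (kernelMap σ k' μ) x X⟫_ℂ =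
      Complex.exp (potential k μ (antidiag x)) *
        (potentialGrad k μ (conjPair Y) (antidiag x).swap * potentialGrad k μ X (antidiag x) +
          hermForm k μ x X Y) := by
  set v := fderiv ℂ (kernelMap σ k' μ) x X with hv
  have hs := den_mem_slitPlane hx hx
  have h1 := ((differentiableAt_kernelMap σ hk' hμ hx).hasFDerivAt.restrictScalars ℝ).inner ℂ
    (hasFDerivAt_const v x)
  have h2 : HasFDerivAt (fun u : ℂ × ℂ => (x, u))
      ((0 : ℂ × ℂ →L[ℂ] ℂ × ℂ).prod (ContinuousLinearMap.id ℂ (ℂ × ℂ))) (conjPair x) :=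
    (hasFDerivAt_const _ _).prodMk (hasFDerivAt_id _)
  have h3 := ((differentiableAt_potential k μ hs).hasFDerivAt.comp (conjPair x) h2).cexp.mul
    ((differentiableAt_potentialGrad k μ X (slitPlane_ne_zero hs)).hasFDerivAt.comp
      (conjPair x) h2)
  have h4 := (h3.restrictScalars ℝ).comp x conjPair.hasFDerivAt
  have h5 := congrArg (fun L => L Y) (h1.unique (h4.congr_of_eventuallyEq (by
    filter_upwards [isOpen_disk.mem_nhds hx] with y hy
    exact inner_kernelMap_fderiv σ hk hk' hμ hx hy X)))
  have h6 : ⟪fderiv ℂ (kernelMap σ k' μ) x Y, v⟫_ℂ =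
      Complex.exp (potential k μ (antidiag x)) *
        fderiv ℂ (potentialGrad k μ X) (antidiag x) (0, conjPair Y) +
      potentialGrad k μ X (antidiag x) * (Complex.exp (potential k μ (antidiag x)) *
        fderiv ℂ (potential k μ) (antidiag x) (0, conjPair Y)) := by
    simpa [fderivInnerCLM_apply] using h5
  rw [h6, antidiag_apply, fderiv_potential k μ hs, fderiv_potentialGrad k μ X
    (slitPlane_ne_zero hs), ← antidiag_apply, potentialMixed_antidiag]
  simp only [potentialHess, potentialGrad, Prod.fst_zero, Prod.snd_zero]
  ring

theorem inner_kernelMap_self (hk : k = k' + 1 / 4) (hk' : 0 < k') (hμ : 0 < μ) {x : ℂ × ℂ}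
    (hx : x ∈ disk) : ⟪kernelMap σ k' μ x, kernelMap σ k' μ x⟫_ℂ =
      Complex.exp (potential k μ (antidiag x)) := by
  rw [inner_kernelMap σ hk hk' hμ hx hx, jacobiKernel_eq_exp k μ hx hx, antidiag_apply]

/-- The subtracted term in the Fubini-Study metric is exactly the product of first derivatives,
leaving the mixed derivative of `ln K`. -/
theorem fubiniStudyMetric_kernelMap (hk : k = k' + 1 / 4) (hk' : 0 < k') (hμ : 0 < μ)
    {x : ℂ × ℂ} (hx : x ∈ disk) (X Y : ℂ × ℂ) :
    fubiniStudyMetric (kernelMap σ k' μ x) (fderiv ℂ (kernelMap σ k' μ) x X)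
      (fderiv ℂ (kernelMap σ k' μ) x Y) = hermForm k μ x X Y := by
  have hconj : conj (Complex.exp (potential k μ (antidiag x))) =
      Complex.exp (potential k μ (antidiag x)) := by
    rw [potential_antidiag k μ hx, ← ofReal_exp, conj_ofReal]
  have h1 : ⟪fderiv ℂ (kernelMap σ k' μ) x Y, kernelMap σ k' μ x⟫_ℂ =
      Complex.exp (potential k μ (antidiag x)) *
        potentialGrad k μ (conjPair Y) (antidiag x).swap := by
    rw [← inner_conj_symm, inner_kernelMap_fderiv σ hk hk' hμ hx hx, map_mul,
      ← antidiag_apply, hconj, potentialGrad_antidiag_swap]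
  have h0 := Complex.exp_ne_zero (potential k μ (antidiag x))
  rw [fubiniStudyMetric, inner_fderiv_kernelMap_fderiv σ hk hk' hμ hx,
    inner_kernelMap_self σ hk hk' hμ hx, h1, inner_kernelMap_fderiv σ hk hk' hμ hx hx,
    ← antidiag_apply]
  field_simp
  ring

/-- The point of the projective space of `ℓ²` with homogeneous coordinates `f_{nk'm}(x)`. -/
def kernelPoint (hk' : 0 < k') (hμ : 0 < μ) (x : disk) : ℙ ℂ (lp (fun _ : ι => ℂ) 2) :=
  Projectivization.mk ℂ (kernelMap σ k' μ x) (kernelMap_ne_zero σ hk' hμ x.2)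

theorem isLocalLift_kernelMap (hk' : 0 < k') (hμ : 0 < μ) :
    IsLocalLift (kernelPoint σ hk' hμ) disk (kernelMap σ k' μ) where
  isOpen := isOpen_disk
  subset := Subset.rfl
  differentiableOn := differentiableOn_kernelMap σ hk' hμ
  lift x _ := ⟨kernelMap_ne_zero σ hk' hμ x.2, rfl⟩

/-- A local lift is locally a holomorphic multiple of the global one. -/
theorem IsLocalLift.exists_smul_kernelMap (hk' : 0 < k') (hμ : 0 < μ) {U : Set (ℂ × ℂ)}
    {F : ℂ × ℂ → lp (fun _ : ι => ℂ) 2} (hF : IsLocalLift (kernelPoint σ hk' hμ) U F)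
    {x : ℂ × ℂ} (hx : x ∈ U) : ∃ c : ℂ, c ≠ 0 ∧ F x = c • kernelMap σ k' μ x ∧
      ∀ X, ∃ a : ℂ, fderiv ℂ F x X = c • fderiv ℂ (kernelMap σ k' μ) x X +
        a • kernelMap σ k' μ x := by
  set Φ := kernelMap σ k' μ with hΦ
  have hxd := hF.subset hx
  have hmul : ∀ y ∈ U, ∃ c : ℂ, c ≠ 0 ∧ F y = c • Φ y := fun y hy => by
    obtain ⟨h0, h1⟩ := hF.lift ⟨y, hF.subset hy⟩ hy
    rw [kernelPoint, Projectivization.mk_eq_mk_iff'] at h1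
    obtain ⟨a, ha⟩ := h1
    have ha' : a • F y = Φ y := ha
    have ha0 : a ≠ 0 := by
      rintro rfl
      rw [zero_smul] at ha'
      exact kernelMap_ne_zero σ hk' hμ (hF.subset hy) ha'.symm
    exact ⟨a⁻¹, inv_ne_zero ha0, by rw [← ha', inv_smul_smul₀ ha0]⟩
  have hK : ∀ y ∈ U, ⟪Φ x, Φ y⟫_ℂ ≠ 0 := fun y hy => by
    rw [inner_kernelMap σ rfl hk' hμ (hF.subset hy) hxd]
    exact jacobiKernel_ne_zero _ _ (hF.subset hy) hxd
  -- Pointwise proportionality gives no regularity. Pairing with the fixed vector `Φ x` expresses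
  -- the factor as a quotient of holomorphic functions, its denominator being a kernel value, which
  -- is never zero.
  set c : ℂ × ℂ → ℂ := fun y => ⟪Φ x, F y⟫_ℂ / ⟪Φ x, Φ y⟫_ℂ with hc
  have hFc : ∀ y ∈ U, c y ≠ 0 ∧ F y = c y • Φ y := fun y hy => by
    obtain ⟨a, ha0, ha⟩ := hmul y hy
    have : c y = a := by
      rw [hc]
      simp only
      rw [ha, inner_smul_right, mul_div_cancel_right₀ _ (hK y hy)]
    rw [this]
    exact ⟨ha0, ha⟩
  have hdΦ := differentiableAt_kernelMap σ hk' hμ hxd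
  have hdF : DifferentiableAt ℂ F x := hF.differentiableOn.differentiableAt (hF.isOpen.mem_nhds hx)
  have hdc : DifferentiableAt ℂ c x := by
    have h1 : DifferentiableAt ℂ (fun y => ⟪Φ x, F y⟫_ℂ) x :=
      (innerSL ℂ (Φ x)).differentiableAt.comp x hdF
    have h2 : DifferentiableAt ℂ (fun y => ⟪Φ x, Φ y⟫_ℂ) x :=
      (innerSL ℂ (Φ x)).differentiableAt.comp x hdΦ
    simp only [hc, div_eq_mul_inv]
    exact h1.mul (h2.inv (hK x hx))
  refine ⟨c x, (hFc x hx).1, (hFc x hx).2, fun X => ⟨fderiv ℂ c x X, ?_⟩⟩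
  have h3 : F =ᶠ[nhds x] fun y => c y • Φ y := by
    filter_upwards [hF.isOpen.mem_nhds hx] with y hy using (hFc y hy).2
  rw [h3.fderiv_eq, fderiv_fun_smul hdc hdΦ]
  rfl

theorem fubiniStudyMetric_lift_eq (hk : k = k' + 1 / 4) (hk' : 0 < k') (hμ : 0 < μ)
    {U : Set (ℂ × ℂ)} {F : ℂ × ℂ → lp (fun _ : ι => ℂ) 2}
    (hF : IsLocalLift (kernelPoint σ hk' hμ) U F) {x : ℂ × ℂ} (hx : x ∈ U) (X Y : ℂ × ℂ) :
    fubiniStudyMetric (F x) (fderiv ℂ F x X) (fderiv ℂ F x Y) = hermForm k μ x X Y := by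
  obtain ⟨c, hc0, hc, h⟩ := hF.exists_smul_kernelMap σ hk' hμ hx
  obtain ⟨a, ha⟩ := h X
  obtain ⟨b, hb⟩ := h Y
  rw [hc, ha, hb, fubiniStudyMetric_lift _ _ _ _ _ _ hc0
    (kernelMap_ne_zero σ hk' hμ (hF.subset hx)),
    fubiniStudyMetric_kernelMap σ hk hk' hμ (hF.subset hx)]

theorem isFubiniStudyPullback_kernelPoint (hk : k = k' + 1 / 4) (hk' : 0 < k') (hμ : 0 < μ) :
    IsFubiniStudyPullback (kernelPoint σ hk' hμ) (omega k μ) := by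
  intro U F hF x hx X Y
  rw [fubiniStudyForm, fubiniStudyMetric_lift_eq σ hk hk' hμ hF hx,
    fubiniStudyMetric_lift_eq σ hk hk' hμ hF hx, omega_apply]

theorem jacobiBasis_zero_zero (hk' : 0 < k') (x : ℂ × ℂ) : jacobiBasis k' μ 0 0 x = 1 := by
  have h := (Real.Gamma_pos_of_pos (by positivity : 0 < 2 * k')).ne'
  simp [jacobiBasis, diskBasis, matchingPoly_zero, h]

theorem jacobiBasis_one_zero (hk' : 0 < k') (x : ℂ × ℂ) :
    jacobiBasis k' μ 1 0 x = Real.sqrt μ * x.1 := by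
  have h := (Real.Gamma_pos_of_pos (by positivity : 0 < 2 * k')).ne'
  simp [jacobiBasis, diskBasis, matchingPoly_one, h]

theorem jacobiBasis_zero_one (x : ℂ × ℂ) : jacobiBasis k' μ 0 1 x =
    Real.sqrt (Real.Gamma (1 + 2 * k') / Real.Gamma (2 * k')) * x.2 := by
  simp [jacobiBasis, diskBasis, matchingPoly_zero]

/-- The homogeneous coordinates `f_00 = 1`, `f_10 ∝ z` and `f_01 ∝ w` already determine the point.
-/
theorem kernelPoint_injective (hk' : 0 < k') (hμ : 0 < μ) :
    Function.Injective (kernelPoint σ hk' hμ) := by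
  intro x y hxy
  rw [kernelPoint, kernelPoint, Projectivization.mk_eq_mk_iff'] at hxy
  obtain ⟨a, ha⟩ := hxy
  have h : ∀ n m, a * jacobiBasis k' μ n m y = jacobiBasis k' μ n m x := fun n m => by
    have h1 := congrArg (fun v : lp (fun _ : ι => ℂ) 2 => v (σ.symm (n, m))) ha
    simpa [kernelMap_apply σ hk' hμ x.2, kernelMap_apply σ hk' hμ y.2] using h1
  have ha1 : a = 1 := by simpa [jacobiBasis_zero_zero hk'] using h 0 0
  subst ha1
  have h1 := h 1 0
  have h2 := h 0 1
  have hsq : ((Real.sqrt μ : ℝ) : ℂ) ≠ 0 := by exact_mod_cast (Real.sqrt_pos.mpr hμ).ne'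
  have hg : ((Real.sqrt (Real.Gamma (1 + 2 * k') / Real.Gamma (2 * k')) : ℝ) : ℂ) ≠ 0 := by
    have h3 := Real.Gamma_pos_of_pos (by positivity : 0 < 2 * k')
    have h4 := Real.Gamma_pos_of_pos (by positivity : 0 < 1 + 2 * k')
    exact_mod_cast (Real.sqrt_pos.mpr (div_pos h4 h3)).ne'
  rw [one_mul, jacobiBasis_one_zero hk', jacobiBasis_one_zero hk'] at h1
  rw [one_mul, jacobiBasis_zero_one, jacobiBasis_zero_one] at h2
  exact Subtype.ext (Prod.ext (mul_left_cancel₀ hsq h1).symm (mul_left_cancel₀ hg h2).symm)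

theorem isHolomorphicEmbedding_kernelPoint (hk' : 0 < k') (hμ : 0 < μ) :
    IsHolomorphicEmbedding (kernelPoint σ hk' hμ) where
  holomorphic x hx := ⟨disk, kernelMap σ k' μ, hx, isLocalLift_kernelMap σ hk' hμ⟩
  immersion U F hF x hx X hX := by
    -- A derivative along the line of `F x` has zero Fubini-Study length, but the pulled-back metric
    -- is positive definite.
    by_contra hX0
    have hpos := hermForm_self_pos (k := k' + 1 / 4) (by positivity) hμ (hF.subset hx) hX0
    rw [← fubiniStudyMetric_lift_eq σ rfl hk' hμ hF hx] at hpos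
    obtain ⟨a, ha⟩ := Submodule.mem_span_singleton.mp hX
    rw [← ha, fubiniStudyMetric] at hpos
    simp only [inner_smul_left, inner_smul_right] at hpos
    refine absurd hpos (not_lt.mpr (le_of_eq ?_))
    rw [← Complex.zero_re]
    congr 1
    ring
  injective := kernelPoint_injective σ hk' hμ

end Pullback

/-! ### Equivariance of the kernel -/

/-- The element `g` acts on the disk by the holomorphic map `φ`, with the holomorphic factor of
automorphy `J`. -/
structure IsAutomorphy (k μ : ℝ) (g : JacobiGroup) (φ : ℂ × ℂ → ℂ × ℂ) (J : ℂ × ℂ → ℂ) :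
    Prop where
  map_eq : ∀ x : disk, φ x = ((g • x : disk) : ℂ × ℂ)
  differentiableOn_map : DifferentiableOn ℂ φ disk
  differentiableOn_factor : DifferentiableOn ℂ J disk
  factor_ne_zero : ∀ x ∈ disk, J x ≠ 0
  kernel_map : ∀ x ∈ disk, ∀ y ∈ disk,
    jacobiKernel k μ (φ x) (φ y) = J x * conj (J y) * jacobiKernel k μ x y

theorem IsAutomorphy.mem {k μ : ℝ} {g : JacobiGroup} {φ : ℂ × ℂ → ℂ × ℂ} {J : ℂ × ℂ → ℂ}
    (h : IsAutomorphy k μ g φ J) {x : ℂ × ℂ} (hx : x ∈ disk) : φ x ∈ disk := by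
  rw [h.map_eq ⟨x, hx⟩]
  exact (g • (⟨x, hx⟩ : disk)).2

theorem IsAutomorphy.mul {k μ : ℝ} {g g' : JacobiGroup} {φ φ' : ℂ × ℂ → ℂ × ℂ}
    {J J' : ℂ × ℂ → ℂ} (h : IsAutomorphy k μ g φ J) (h' : IsAutomorphy k μ g' φ' J') :
    IsAutomorphy k μ (g * g') (φ ∘ φ') (fun x => J (φ' x) * J' x) where
  map_eq x := by
    rw [mul_smul, Function.comp_apply, h'.map_eq, h.map_eq]
  differentiableOn_map := h.differentiableOn_map.comp h'.differentiableOn_map fun x hx => h'.mem hx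
  differentiableOn_factor := (h.differentiableOn_factor.comp h'.differentiableOn_map
    fun x hx => h'.mem hx).mul h'.differentiableOn_factor
  factor_ne_zero x hx := mul_ne_zero (h.factor_ne_zero _ (h'.mem hx)) (h'.factor_ne_zero x hx)
  kernel_map x hx y hy := by
    rw [Function.comp_apply, Function.comp_apply, h.kernel_map _ (h'.mem hx) _ (h'.mem hy),
      h'.kernel_map x hx y hy, map_mul]
    ring

/-- The increment of the exponent splits into a function of `(z, w)` plus one of `(u, v)`; this
splitting produces the factor of automorphy. -/
theorem quadratic_heisenberg {z w u v : ℂ} (α β : ℂ) (h : 1 - w * v ≠ 0) :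
    (2 * (u + β - α * v) * (z + α - β * w) + (z + α - β * w) ^ 2 * v +
        (u + β - α * v) ^ 2 * w) / (2 * (1 - w * v)) =
      (β * z + α * β / 2 - β ^ 2 * w / 2) + (α * u + β * α / 2 - α ^ 2 * v / 2) +
        (2 * u * z + z ^ 2 * v + u ^ 2 * w) / (2 * (1 - w * v)) := by
  have h' := mul_ne_zero two_ne_zero h
  rw [div_eq_iff h', add_mul _ (_ / _), div_mul_cancel₀ _ h']
  ring

theorem one_sub_mul_moebius {a b c d w v : ℂ} (hdet : a * d - b * c = 1)
    (h1 : c * w + d ≠ 0) (h2 : b * v + a ≠ 0) :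
    1 - (a * w + b) / (c * w + d) * ((d * v + c) / (b * v + a)) =
      (1 - w * v) / ((c * w + d) * (b * v + a)) := by
  rw [div_mul_div_comm, eq_div_iff (mul_ne_zero h1 h2), sub_mul,
    div_mul_cancel₀ _ (mul_ne_zero h1 h2)]
  linear_combination (1 - w * v) * hdet

theorem quadratic_moebius {a b c d z w u v : ℂ} (hdet : a * d - b * c = 1)
    (h1 : c * w + d ≠ 0) (h2 : b * v + a ≠ 0) (h : 1 - w * v ≠ 0) :
    (2 * (u / (b * v + a)) * (z / (c * w + d)) +
        (z / (c * w + d)) ^ 2 * ((d * v + c) / (b * v + a)) +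
        (u / (b * v + a)) ^ 2 * ((a * w + b) / (c * w + d))) /
        (2 * (1 - (a * w + b) / (c * w + d) * ((d * v + c) / (b * v + a)))) =
      c * z ^ 2 / (2 * (c * w + d)) + b * u ^ 2 / (2 * (b * v + a)) +
        (2 * u * z + z ^ 2 * v + u ^ 2 * w) / (2 * (1 - w * v)) := by
  rw [one_sub_mul_moebius hdet h1 h2]
  generalize hp : c * w + d = p at *
  generalize hq : b * v + a = q at *
  -- Exposes the multiples of `1 - w v`, which cancel the denominator and leave the two separate
  -- terms.
  have e1 : d * v + c = p * v + c * (1 - w * v) := by rw [← hp]; ring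
  have e2 : a * w + b = q * w + b * (1 - w * v) := by rw [← hq]; ring
  rw [e1, e2]
  generalize 1 - w * v = D at *
  field_simp
  ring

theorem isAutomorphy_heisenberg (k μ : ℝ) (h : Heisenberg) :
    IsAutomorphy k μ (SemidirectProduct.inl h) (fun x => (x.1 + h.α - conj h.α * x.2, x.2))
      fun x => Complex.exp (μ * (conj h.α * x.1 + h.α * conj h.α / 2 - conj h.α ^ 2 * x.2 / 2)) where
  map_eq x := by
    change _ = ((h • ((1 : SU11) • x) : disk) : ℂ × ℂ)
    rw [one_smul, Heisenberg.coe_smul]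
  differentiableOn_map := Differentiable.differentiableOn (by fun_prop)
  differentiableOn_factor := Differentiable.differentiableOn (by fun_prop)
  factor_ne_zero x _ := Complex.exp_ne_zero _
  kernel_map x hx y hy := by
    have hd := den_ne_zero hx hy
    simp only [den, conjPair_apply] at hd
    rw [← Complex.exp_conj, jacobiKernel, jacobiKernel, mul_left_comm (_ * _), ← Complex.exp_add,
      ← Complex.exp_add]
    congr 2
    simp only [fFun, map_add, map_sub, map_mul, map_div₀, map_pow, conj_conj, conj_ofReal,
      map_ofNat]
    rw [quadratic_heisenberg h.α (conj h.α) hd]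
    ring

theorem eq_of_exp_eq_of_im_lt {a b : ℂ} (h : Complex.exp a = Complex.exp b)
    (him : |a.im - b.im| < 2 * Real.pi) : a = b := by
  obtain ⟨n, hn⟩ := Complex.exp_eq_exp_iff_exists_int.mp h
  have h1 : a.im - b.im = n * (2 * Real.pi) := by
    rw [hn]
    simp
  have hpi := Real.pi_pos
  rw [h1, abs_mul, abs_of_pos (by positivity : 0 < 2 * Real.pi)] at him
  have h2 : |(n : ℝ)| < 1 := by
    by_contra! h3
    nlinarith
  have h3 : n = 0 := by
    rw [← Int.cast_abs] at h2
    exact Int.abs_lt_one_iff.mp (by exact_mod_cast h2)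
  rw [hn, h3]
  simp

theorem abs_im_log_lt {z : ℂ} (hz : 0 < z.re) : |(log z).im| < Real.pi / 2 := by
  rw [Complex.log_im, Complex.abs_arg_lt_pi_div_two_iff]
  exact Or.inl hz

/-! ### The factor of automorphy of SU(1,1) -/

section SU

variable (g : SU11)

theorem SU11.a_ne_zero : g.a ≠ 0 := by
  intro h
  have h1 := g.normSq_eq
  rw [h] at h1
  simp only [norm_zero] at h1
  nlinarith [sq_nonneg ‖g.b‖]

theorem SU11.re_factor_pos {w : ℂ} (hw : ‖w‖ < 1) : 0 < (1 + conj g.b / conj g.a * w).re := by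
  have ha := norm_pos_iff.mpr g.a_ne_zero
  have h1 : ‖conj g.b / conj g.a * w‖ < 1 := by
    rw [norm_mul, norm_div, Complex.norm_conj, Complex.norm_conj]
    have h2 : ‖g.b‖ / ‖g.a‖ < 1 := by
      rw [div_lt_one ha]
      nlinarith [g.normSq_eq, norm_nonneg g.b]
    have h3 : 0 ≤ ‖g.b‖ / ‖g.a‖ := by positivity
    nlinarith [norm_nonneg w]
  have h2 := (abs_lt.mp ((Complex.abs_re_le_norm _).trans_lt h1)).1
  rw [add_re, one_re]
  linarith

/-- A real power of `b̄ w + ā` needs a branch. Writing it as `ā (1 + b̄ w / ā)` puts the second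
factor in the right half-plane; the constant phase of `ā` cancels against its conjugate, so only
`‖a‖` is kept. -/
theorem SU11.diskKernel_map (k : ℝ) {w w' : ℂ} (hw : ‖w‖ < 1) (hw' : ‖w'‖ < 1) :
    diskKernel k ((g.a * w + g.b) / (conj g.b * w + conj g.a))
        ((g.a * w' + g.b) / (conj g.b * w' + conj g.a)) =
      Complex.exp (2 * k * (Real.log ‖g.a‖ + log (1 + conj g.b / conj g.a * w))) *
        conj (Complex.exp (2 * k * (Real.log ‖g.a‖ + log (1 + conj g.b / conj g.a * w')))) *
        diskKernel k w w' := by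
  set v := (g.a * w + g.b) / (conj g.b * w + conj g.a) with hv
  set v' := (g.a * w' + g.b) / (conj g.b * w' + conj g.a) with hv'
  have hvd : ‖v‖ < 1 := g.norm_lt hw
  have hvd' : ‖v'‖ < 1 := g.norm_lt hw'
  have r1 := den_re_pos (x := (0, w)) (y := (0, conj w')) hw (by simpa using hw')
  have r2 := den_re_pos (x := (0, v)) (y := (0, conj v')) hvd (by simpa using hvd')
  simp only [den] at r1 r2
  have r3 := g.re_factor_pos hw
  have r4 := g.re_factor_pos hw'
  have n1 : 1 - w * conj w' ≠ 0 := fun h => by simp [h] at r1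
  have n2 : 1 - v * conj v' ≠ 0 := fun h => by simp [h] at r2
  have n3 : 1 + conj g.b / conj g.a * w ≠ 0 := fun h => by simp [h] at r3
  have n4 : 1 + conj g.b / conj g.a * w' ≠ 0 := fun h => by simp [h] at r4
  have ha : conj g.a ≠ 0 := by simpa using g.a_ne_zero
  have ha' := g.a_ne_zero
  have d1 := g.delta_ne_zero hw
  have d2 := g.delta_ne_zero hw'
  have d2' : g.b * conj w' + g.a ≠ 0 := by
    have := (map_ne_zero (starRingEnd ℂ)).mpr d2
    simpa using this
  -- The exponentials agree by the Möbius identity. Each of the four complex logarithms has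
  -- imaginary part below `π/2` in modulus, so the sides differ by less than `2π` and are equal.
  have key : log (1 - v * conj v') = log (1 - w * conj w') -
      (2 * Real.log ‖g.a‖ + log (1 + conj g.b / conj g.a * w) +
        conj (log (1 + conj g.b / conj g.a * w'))) := by
    apply eq_of_exp_eq_of_im_lt
    · have hna : ((Real.log ‖g.a‖ : ℝ) : ℂ) + (Real.log ‖g.a‖ : ℝ) =
          ((Real.log (‖g.a‖ * ‖g.a‖) : ℝ) : ℂ) := by
        rw [Real.log_mul (norm_ne_zero_iff.mpr ha') (norm_ne_zero_iff.mpr ha')]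
        push_cast
        rfl
      have hpos : 0 < ‖g.a‖ * ‖g.a‖ := by
        have := norm_pos_iff.mpr ha'
        positivity
      have hmul : ((‖g.a‖ * ‖g.a‖ : ℝ) : ℂ) = g.a * conj g.a := by
        rw [Complex.mul_conj']
        push_cast
        ring
      have hdet := g.det_eq
      rw [Complex.exp_sub, Complex.exp_add, Complex.exp_add, Complex.exp_conj, exp_log n1,
        exp_log n2, exp_log n3, exp_log n4, two_mul, hna, ← ofReal_exp, Real.exp_log hpos, hmul,
        hv, hv']
      simp only [map_add, map_mul, map_div₀, conj_conj, map_one]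
      have n4' : 1 + g.b / g.a * conj w' ≠ 0 := by
        have := (map_ne_zero (starRingEnd ℂ)).mpr n4
        simpa using this
      rw [one_sub_mul_moebius hdet d1 d2']
      congr 1
      generalize conj g.a = A at *
      generalize conj g.b = B at *
      generalize conj w' = v at *
      field_simp
      ring
    · have b1 := abs_im_log_lt r1
      have b2 := abs_im_log_lt r2
      have b3 := abs_im_log_lt r3
      have b4 := abs_im_log_lt r4
      rw [abs_lt] at b1 b2 b3 b4 ⊢
      simp only [sub_im, add_im, conj_im, mul_im, ofReal_im, ofReal_re, re_ofNat, im_ofNat,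
        mul_zero, zero_mul, add_zero] at b1 b2 b3 b4 ⊢
      constructor <;> linarith [b1.1, b1.2, b2.1, b2.2, b3.1, b3.2, b4.1, b4.2]
  rw [diskKernel, diskKernel, cpow_def_of_ne_zero n1, cpow_def_of_ne_zero n2, key,
    ← Complex.exp_conj, ← Complex.exp_add, ← Complex.exp_add]
  congr 1
  simp only [map_add, map_mul, conj_ofReal, map_ofNat]
  push_cast
  ring

theorem isAutomorphy_su11 (k μ : ℝ) :
    IsAutomorphy k μ (SemidirectProduct.inr g)
      (fun x => (x.1 / (conj g.b * x.2 + conj g.a),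
        (g.a * x.2 + g.b) / (conj g.b * x.2 + conj g.a)))
      fun x => Complex.exp (2 * k * (Real.log ‖g.a‖ + log (1 + conj g.b / conj g.a * x.2))) *
        Complex.exp (μ * (conj g.b * x.1 ^ 2 / (2 * (conj g.b * x.2 + conj g.a)))) where
  map_eq x := by
    change _ = (((1 : Heisenberg) • (g • x) : disk) : ℂ × ℂ)
    rw [one_smul, SU11.coe_smul]
  differentiableOn_map x hx := by
    have h := g.delta_ne_zero (w := x.2) hx
    refine DifferentiableAt.differentiableWithinAt ?_
    fun_prop (disch := assumption)
  differentiableOn_factor x hx := by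
    have h := g.delta_ne_zero (w := x.2) hx
    have h2 : 2 * (conj g.b * x.2 + conj g.a) ≠ 0 := mul_ne_zero two_ne_zero h
    have h3 : 1 + conj g.b / conj g.a * x.2 ∈ slitPlane := Or.inl (g.re_factor_pos hx)
    refine DifferentiableAt.differentiableWithinAt ?_
    fun_prop (disch := assumption)
  factor_ne_zero x _ := mul_ne_zero (Complex.exp_ne_zero _) (Complex.exp_ne_zero _)
  kernel_map x hx y hy := by
    have hd := den_ne_zero hx hy
    simp only [den, conjPair_apply] at hd
    have d1 := g.delta_ne_zero (w := x.2) hx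
    have d2 := g.delta_ne_zero (w := y.2) hy
    have d2' : g.b * conj y.2 + g.a ≠ 0 := by
      have := (map_ne_zero (starRingEnd ℂ)).mpr d2
      simpa using this
    have hdet := g.det_eq
    have hF : fFun (x.1 / (conj g.b * x.2 + conj g.a),
          (g.a * x.2 + g.b) / (conj g.b * x.2 + conj g.a))
        (y.1 / (conj g.b * y.2 + conj g.a), (g.a * y.2 + g.b) / (conj g.b * y.2 + conj g.a)) =
        conj g.b * x.1 ^ 2 / (2 * (conj g.b * x.2 + conj g.a)) +
          conj (conj g.b * y.1 ^ 2 / (2 * (conj g.b * y.2 + conj g.a))) + fFun x y := by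
      simp only [fFun, map_add, map_mul, map_div₀, map_pow, conj_conj, map_ofNat]
      exact quadratic_moebius hdet d1 d2' hd
    have hexp : ∀ A B C : ℂ, Complex.exp (μ * (A + conj B + C)) =
        Complex.exp (μ * A) * conj (Complex.exp (μ * B)) * Complex.exp (μ * C) := by
      intro A B C
      rw [← Complex.exp_conj, ← Complex.exp_add, ← Complex.exp_add, map_mul, conj_ofReal]
      ring_nf
    rw [jacobiKernel, jacobiKernel, SU11.diskKernel_map g k hx hy, hF, hexp, map_mul]
    ring

end SU

theorem exists_isAutomorphy (k μ : ℝ) (q : JacobiGroup) : ∃ φ J, IsAutomorphy k μ q φ J := by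
  have h := (isAutomorphy_heisenberg k μ q.left).mul (isAutomorphy_su11 q.right k μ)
  rw [SemidirectProduct.inl_left_mul_inr_right] at h
  exact ⟨_, _, h⟩

/-! ### Unitary equivariance -/

/-- Two total families of vectors with the same Gram matrix are related by a unitary map. -/
theorem exists_linearIsometryEquiv_of_inner_eq {X H H' : Type*} [NormedAddCommGroup H]
    [InnerProductSpace ℂ H] [CompleteSpace H] [NormedAddCommGroup H'] [InnerProductSpace ℂ H']
    [CompleteSpace H'] {e : X → H} {e' : X → H'} (h : ∀ x y, ⟪e x, e y⟫_ℂ = ⟪e' x, e' y⟫_ℂ)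
    (he : (Submodule.span ℂ (range e)).topologicalClosure = ⊤)
    (he' : (Submodule.span ℂ (range e')).topologicalClosure = ⊤) :
    ∃ u : H ≃ₗᵢ[ℂ] H', ∀ x, u (e x) = e' x := by
  have hd : DenseRange (Finsupp.linearCombination ℂ e) := by
    have h1 := Submodule.dense_iff_topologicalClosure_eq_top.mpr he
    rwa [← Finsupp.range_linearCombination, LinearMap.coe_range] at h1
  have hd' : DenseRange (Finsupp.linearCombination ℂ e') := by
    have h1 := Submodule.dense_iff_topologicalClosure_eq_top.mpr he'
    rwa [← Finsupp.range_linearCombination, LinearMap.coe_range] at h1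
  have hn : ∀ c : X →₀ ℂ, ‖Finsupp.linearCombination ℂ e' (LinearEquiv.refl ℂ (X →₀ ℂ) c)‖ =
      ‖Finsupp.linearCombination ℂ e c‖ := fun c => by
    rw [LinearEquiv.refl_apply, @norm_eq_sqrt_re_inner ℂ, @norm_eq_sqrt_re_inner ℂ]
    simp only [Finsupp.linearCombination_apply, Finsupp.sum, sum_inner, inner_sum,
      inner_smul_left, inner_smul_right, h]
  refine ⟨(LinearEquiv.refl ℂ (X →₀ ℂ)).extendOfIsometry _ _ hd hd' hn, fun x => ?_⟩
  have h2 := LinearEquiv.extendOfIsometry_eq (LinearEquiv.refl ℂ (X →₀ ℂ)) _ _ hd hd' hn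
    (Finsupp.single x 1)
  simpa using h2

section Equivariance

variable {ι : Type*} (σ : ι ≃ ℕ × ℕ) {k k' μ : ℝ}

theorem span_range_kernelMap (hk' : 0 < k') (hμ : 0 < μ) :
    (Submodule.span ℂ (range fun x : disk => kernelMap σ k' μ x)).topologicalClosure = ⊤ := by
  rw [← (isCoherentSystem_kernelMap σ rfl hk' hμ).2]
  congr 2
  ext v
  simp only [mem_range, mem_image, Subtype.exists, exists_prop]
  constructor
  · rintro ⟨x, hx, rfl⟩
    exact ⟨conjPair x, conjPair_mem_disk.mpr hx, by simp⟩
  · rintro ⟨x, hx, rfl⟩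
    exact ⟨conjPair x, conjPair_mem_disk.mpr hx, rfl⟩

variable {g : JacobiGroup} {φ : ℂ × ℂ → ℂ × ℂ} {J : ℂ × ℂ → ℂ}

theorem IsAutomorphy.surjOn (h : IsAutomorphy k μ g φ J) : SurjOn φ disk disk := by
  intro y hy
  refine ⟨_, (g⁻¹ • (⟨y, hy⟩ : disk)).2, ?_⟩
  rw [h.map_eq, smul_inv_smul]

theorem IsAutomorphy.injOn (h : IsAutomorphy k μ g φ J) : InjOn φ disk := by
  intro x hx y hy hxy
  rw [h.map_eq ⟨x, hx⟩, h.map_eq ⟨y, hy⟩] at hxy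
  exact congrArg Subtype.val (MulAction.injective g (Subtype.ext hxy))

/-- The group acts on the coherent vectors by unitary operators, up to the factor of
automorphy. -/
theorem IsAutomorphy.exists_unitary (hk : k = k' + 1 / 4) (hk' : 0 < k') (hμ : 0 < μ)
    (h : IsAutomorphy k μ g φ J) :
    ∃ u : lp (fun _ : ι => ℂ) 2 ≃ₗᵢ[ℂ] lp (fun _ : ι => ℂ) 2, ∀ x ∈ disk,
      kernelMap σ k' μ (φ x) = J x • u (kernelMap σ k' μ x) := by
  have hgram : ∀ x y : disk, ⟪kernelMap σ k' μ x, kernelMap σ k' μ y⟫_ℂ =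
      ⟪(J x)⁻¹ • kernelMap σ k' μ (φ x), (J y)⁻¹ • kernelMap σ k' μ (φ y)⟫_ℂ := fun x y => by
    have hx := h.factor_ne_zero x x.2
    have hy := h.factor_ne_zero y y.2
    have hx' : conj (J x) ≠ 0 := (map_ne_zero (starRingEnd ℂ)).mpr hx
    rw [inner_smul_left, inner_smul_right, inner_kernelMap σ hk hk' hμ y.2 x.2,
      inner_kernelMap σ hk hk' hμ (h.mem y.2) (h.mem x.2), h.kernel_map y y.2 x x.2, map_inv₀]
    field_simp
  -- Since `φ` maps the disk onto itself and `J` has no zeros, the transformed family spans at least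
  -- as much.
  have hspan : (Submodule.span ℂ (range fun x : disk =>
      (J x)⁻¹ • kernelMap σ k' μ (φ x))).topologicalClosure = ⊤ := by
    rw [eq_top_iff, ← span_range_kernelMap σ hk' hμ]
    refine Submodule.topologicalClosure_mono (Submodule.span_le.mpr ?_)
    rintro _ ⟨y, rfl⟩
    obtain ⟨x, hx, hxy⟩ := h.surjOn y.2
    have h1 : kernelMap σ k' μ y = J x • ((J x)⁻¹ • kernelMap σ k' μ (φ x)) := by
      rw [smul_inv_smul₀ (h.factor_ne_zero x hx), hxy]
    change kernelMap σ k' μ y ∈ _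
    rw [h1]
    exact Submodule.smul_mem _ _ (Submodule.subset_span ⟨⟨x, hx⟩, rfl⟩)
  obtain ⟨u, hu⟩ := exists_linearIsometryEquiv_of_inner_eq hgram
    (span_range_kernelMap σ hk' hμ) hspan
  exact ⟨u, fun x hx => by rw [hu ⟨x, hx⟩, smul_inv_smul₀ (h.factor_ne_zero x hx)]⟩

theorem isCSEmbedding_kernelPoint (hk : k = k' + 1 / 4) (hk' : 0 < k') (hμ : 0 < μ) :
    IsCSEmbedding JacobiGroup (omega k μ) (kernelPoint σ hk' hμ) where
  embedding := isHolomorphicEmbedding_kernelPoint σ hk' hμ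
  pullback := isFubiniStudyPullback_kernelPoint σ hk hk' hμ
  equivariant g := by
    obtain ⟨φ, J, h⟩ := exists_isAutomorphy k μ g
    obtain ⟨u, hu⟩ := h.exists_unitary σ hk hk' hμ
    refine ⟨u, fun x => ?_⟩
    rw [kernelPoint, kernelPoint, Projectivization.map_mk, Projectivization.mk_eq_mk_iff']
    exact ⟨J x, by rw [← h.map_eq x, hu x x.2]; rfl⟩

/-- Differentiate `Φ ∘ φ = J · u Φ`: the Fubini-Study metric ignores the factor `J` with its
derivative, and the unitary map `u`. -/
theorem IsAutomorphy.hermForm_map (hk : k = k' + 1 / 4) (hk' : 0 < k') (hμ : 0 < μ)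
    (h : IsAutomorphy k μ g φ J) {x : ℂ × ℂ} (hx : x ∈ disk) (X Y : ℂ × ℂ) :
    hermForm k μ (φ x) (fderiv ℂ φ x X) (fderiv ℂ φ x Y) = hermForm k μ x X Y := by
  set Φ := kernelMap (Equiv.refl (ℕ × ℕ)) k' μ with hΦ
  obtain ⟨u, hu⟩ := h.exists_unitary (Equiv.refl (ℕ × ℕ)) hk hk' hμ
  have hφ := h.differentiableOn_map.differentiableAt (isOpen_disk.mem_nhds hx)
  have hJ := h.differentiableOn_factor.differentiableAt (isOpen_disk.mem_nhds hx)
  have hdΦ : DifferentiableAt ℂ Φ x := differentiableAt_kernelMap _ hk' hμ hx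
  have hdΦ' : DifferentiableAt ℂ Φ (φ x) := differentiableAt_kernelMap _ hk' hμ (h.mem hx)
  have h1 : Φ ∘ φ =ᶠ[nhds x] fun y => J y • u (Φ y) := by
    filter_upwards [isOpen_disk.mem_nhds hx] with y hy using hu y hy
  have h2 : HasFDerivAt (fun y => u (Φ y))
      ((u.toContinuousLinearEquiv : lp (fun _ : ℕ × ℕ => ℂ) 2 →L[ℂ]
        lp (fun _ : ℕ × ℕ => ℂ) 2).comp (fderiv ℂ Φ x)) x :=
    (u.toContinuousLinearEquiv : lp (fun _ : ℕ × ℕ => ℂ) 2 →L[ℂ]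
      lp (fun _ : ℕ × ℕ => ℂ) 2).hasFDerivAt.comp x
      hdΦ.hasFDerivAt
  have h3 : ∀ Z, fderiv ℂ Φ (φ x) (fderiv ℂ φ x Z) =
      J x • u (fderiv ℂ Φ x Z) + (fderiv ℂ J x Z) • u (Φ x) := fun Z =>
    congrArg (fun L => L Z) ((hdΦ'.hasFDerivAt.comp x hφ.hasFDerivAt).unique
      ((hJ.hasFDerivAt.smul h2).congr_of_eventuallyEq h1))
  have hne : u (Φ x) ≠ 0 := fun h0 =>
    kernelMap_ne_zero (Equiv.refl (ℕ × ℕ)) hk' hμ hx (u.map_eq_zero_iff.mp h0)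
  have hux : Φ (φ x) = J x • u (Φ x) := hu x hx
  rw [← fubiniStudyMetric_kernelMap (Equiv.refl (ℕ × ℕ)) hk hk' hμ (h.mem hx),
    ← fubiniStudyMetric_kernelMap (Equiv.refl (ℕ × ℕ)) hk hk' hμ hx, ← hΦ, h3, h3, hux,
    fubiniStudyMetric_lift _ _ _ _ _ _ (h.factor_ne_zero x hx) hne]
  simp only [fubiniStudyMetric, u.inner_map_map]

end Equivariance

/-! ### The homogeneous space -/

theorem continuous_jacobi_smul : Continuous fun p : JacobiGroup × disk => p.1 • p.2 := by
  have hi : Continuous fun q : JacobiGroup => (q.left.α, q.left.t, q.right) :=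
    continuous_induced_dom
  have hα : Continuous fun p : JacobiGroup × disk => p.1.left.α :=
    continuous_fst.comp (hi.comp continuous_fst)
  have hr0 : Continuous fun p : JacobiGroup × disk => (p.1.right : SU11) :=
    (continuous_snd.comp continuous_snd).comp (hi.comp continuous_fst)
  have hr1 : Continuous fun g : SU11 => g.1.1 :=
    continuous_subtype_val.comp continuous_subtype_val
  have hr := hr1.comp hr0
  have ha : Continuous fun p : JacobiGroup × disk => p.1.right.a :=
    (continuous_apply_apply (0 : Fin 2) (0 : Fin 2)).comp hr
  have hb : Continuous fun p : JacobiGroup × disk => p.1.right.b :=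
    (continuous_apply_apply (0 : Fin 2) (1 : Fin 2)).comp hr
  have hz : Continuous fun p : JacobiGroup × disk => p.2.1.1 :=
    continuous_fst.comp (continuous_subtype_val.comp continuous_snd)
  have hw : Continuous fun p : JacobiGroup × disk => p.2.1.2 :=
    continuous_snd.comp (continuous_subtype_val.comp continuous_snd)
  have hc : Continuous (starRingEnd ℂ) := Complex.continuous_conj
  have hδ := ((hc.comp hb).mul hw).add (hc.comp ha)
  have hδ0 : ∀ p : JacobiGroup × disk,
      conj p.1.right.b * p.2.1.2 + conj p.1.right.a ≠ 0 := fun p =>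
    p.1.right.delta_ne_zero p.2.2
  have hw' := ((ha.mul hw).add hb).div hδ hδ0
  have hz' := ((hz.div hδ hδ0).add hα).sub ((hc.comp hα).mul hw')
  exact (hz'.prodMk hw').subtype_mk _

theorem exists_su11_smul {w : ℂ} (hw : ‖w‖ < 1) :
    ∃ g : SU11, g.b / conj g.a = w := by
  have hP : 0 < 1 - ‖w‖ ^ 2 := by nlinarith [norm_nonneg w]
  -- The matrix with `a = s` and `b = w s` has determinant `s² (1 - |w|²) = 1`.
  set s : ℝ := (Real.sqrt (1 - ‖w‖ ^ 2))⁻¹ with hs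
  have hs2 : s ^ 2 * (1 - ‖w‖ ^ 2) = 1 := by
    rw [hs, inv_pow, Real.sq_sqrt hP.le, inv_mul_cancel₀ hP.ne']
  have hs0 : (s : ℂ) ≠ 0 := by
    rintro h
    rw [ofReal_eq_zero.mp h] at hs2
    simp at hs2
  refine ⟨⟨⟨!![(s : ℂ), w * s; conj (w * s), conj (s : ℂ)], ?_⟩, rfl, rfl⟩, ?_⟩
  · rw [Matrix.det_fin_two_of, map_mul, conj_ofReal]
    have h1 : ((s ^ 2 * (1 - ‖w‖ ^ 2) : ℝ) : ℂ) = 1 := by rw [hs2, ofReal_one]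
    push_cast at h1
    rw [← Complex.mul_conj'] at h1
    linear_combination h1
  · change w * s / conj (s : ℂ) = w
    rw [conj_ofReal, mul_div_cancel_right₀ _ hs0]

/-- The base point of the disk. -/
def origin : disk := ⟨(0, 0), by simp [disk]⟩

theorem exists_smul_origin (x : disk) : ∃ g : JacobiGroup, g • origin = x := by
  obtain ⟨g, hg⟩ := exists_su11_smul x.2
  -- `η` solves `z = η - η̄ w`: it is the Heisenberg translation carrying `(0, w)` to `(z, w)`.
  have h1 : x.1.1 = eta x.1 - conj (eta x.1) * x.1.2 := by
    have hP : ((pFun x.1 : ℝ) : ℂ) ≠ 0 := by exact_mod_cast (pFun_pos x.2).ne'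
    have hP2 : ((pFun x.1 : ℝ) : ℂ) = 1 - x.1.2 * conj x.1.2 := by
      rw [pFun, Complex.mul_conj']
      push_cast
      rfl
    simp only [eta, map_div₀, map_add, map_mul, conj_conj, conj_ofReal]
    rw [div_mul_eq_mul_div, ← sub_div, eq_div_iff hP, hP2]
    ring
  refine ⟨SemidirectProduct.inl ⟨eta x.1, 0⟩ * SemidirectProduct.inr g, ?_⟩
  rw [mul_smul]
  have h2 : (SemidirectProduct.inr g : JacobiGroup) • origin = ⟨(0, x.1.2), x.2⟩ := by
    apply Subtype.ext
    change (((1 : Heisenberg) • (g • origin) : disk) : ℂ × ℂ) = _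
    rw [one_smul, SU11.coe_smul]
    simp [origin, hg]
  rw [h2]
  apply Subtype.ext
  change ((((⟨eta x.1, 0⟩ : Heisenberg) • ((1 : SU11) • (⟨(0, x.1.2), x.2⟩ : disk)) : disk)) :
    ℂ × ℂ) = _
  rw [one_smul, Heisenberg.coe_smul]
  refine Prod.ext ?_ rfl
  change 0 + eta x.1 - conj (eta x.1) * x.1.2 = x.1.1
  rw [zero_add, ← h1]

theorem isHomogeneousKahler {k k' μ : ℝ} (hk : k = k' + 1 / 4) (hk' : 0 < k') (hμ : 0 < μ) :
    IsHomogeneousKahler JacobiGroup disk (omega k μ) where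
  kahler := isKahlerForm_omega (by rw [hk]; positivity) hμ
  continuous_smul := continuous_jacobi_smul
  transitive := ⟨fun x y => by
    obtain ⟨g, rfl⟩ := exists_smul_origin x
    obtain ⟨g', rfl⟩ := exists_smul_origin y
    exact ⟨g' * g⁻¹, by rw [mul_smul, inv_smul_smul]⟩⟩
  automorphism g := by
    obtain ⟨φ, J, h⟩ := exists_isAutomorphy k μ g
    refine ⟨φ, h.differentiableOn_map, h.map_eq, fun x hx X Y => ?_⟩
    rw [omega_apply, omega_apply, h.hermForm_map hk hk' hμ hx, h.hermForm_map hk hk' hμ hx]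

theorem isCSManifold {k k' μ : ℝ} (hk : k = k' + 1 / 4) (hk' : 0 < k') (hμ : 0 < μ) :
    IsCSManifold JacobiGroup disk (omega k μ) where
  homogeneous := isHomogeneousKahler hk hk' hμ
  exists_embedding := ⟨_, isCSEmbedding_kernelPoint Nat.pairEquiv.symm hk hk' hμ⟩

/-! ### The total mass of the measure -/

theorem lintegral_gaussian_add {b : ℝ} (hb : 0 < b) (c : ℝ) :
    ∫⁻ x : ℝ, ENNReal.ofReal (Real.exp (-b * (x + c) ^ 2)) =
      ENNReal.ofReal (Real.sqrt (Real.pi / b)) := by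
  rw [lintegral_add_right_eq_self (fun x : ℝ => ENNReal.ofReal (Real.exp (-b * x ^ 2))) c,
    ← ofReal_integral_eq_lintegral_ofReal (integrable_exp_neg_mul_sq hb)
      (Filter.Eventually.of_forall fun x => (Real.exp_pos _).le), integral_gaussian]

theorem lintegral_gaussian_quadratic {b : ℝ} (hb : 0 < b) {w : ℂ} (hw : ‖w‖ < 1) :
    ∫⁻ z : ℂ, ENNReal.ofReal (Real.exp (-b * (‖z‖ ^ 2 + (z ^ 2 * conj w).re))) =
      ENNReal.ofReal (Real.pi / (b * Real.sqrt (1 - ‖w‖ ^ 2))) := by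
  have hP : 0 < 1 - ‖w‖ ^ 2 := by nlinarith [norm_nonneg w]
  have hp : 0 < 1 + w.re := by
    have := (abs_lt.mp ((Complex.abs_re_le_norm w).trans_lt hw)).1
    linarith
  set P := 1 - ‖w‖ ^ 2 with hPdef
  have hw2 : ‖w‖ ^ 2 = w.re ^ 2 + w.im ^ 2 := by
    rw [← Complex.normSq_eq_norm_sq, Complex.normSq_apply]
    ring
  -- Completing the square in `x`: the quadratic form has leading coefficient `1 + Re w` and
  -- determinant `1 - |w|²`. The `y + 0` fits the shape of `lintegral_gaussian_add`.
  have hsplit : ∀ x y : ℝ, Real.exp (-b * (‖(⟨x, y⟩ : ℂ)‖ ^ 2 +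
      ((⟨x, y⟩ : ℂ) ^ 2 * conj w).re)) =
      Real.exp (-(b * (1 + w.re)) * (x + w.im * y / (1 + w.re)) ^ 2) *
        Real.exp (-(b * P / (1 + w.re)) * (y + 0) ^ 2) := fun x y => by
    rw [← Real.exp_add, ← Complex.normSq_eq_norm_sq, Complex.normSq_apply]
    congr 1
    simp only [sq, mul_re, mul_im, conj_re, conj_im]
    rw [hPdef, hw2]
    field_simp
    ring
  have h1 : Measurable fun z : ℂ =>
      ENNReal.ofReal (Real.exp (-b * (‖z‖ ^ 2 + (z ^ 2 * conj w).re))) := by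
    refine (Continuous.measurable ?_).ennreal_ofReal
    fun_prop
  have h2 : Measurable fun p : ℝ × ℝ => ENNReal.ofReal (Real.exp (-b * (‖(⟨p.1, p.2⟩ : ℂ)‖ ^ 2 +
      ((⟨p.1, p.2⟩ : ℂ) ^ 2 * conj w).re))) :=
    h1.comp Complex.measurableEquivRealProd.symm.measurable
  rw [← Complex.volume_preserving_equiv_real_prod.symm.lintegral_comp h1]
  change ∫⁻ p : ℝ × ℝ, ENNReal.ofReal (Real.exp (-b * (‖(⟨p.1, p.2⟩ : ℂ)‖ ^ 2 +
      ((⟨p.1, p.2⟩ : ℂ) ^ 2 * conj w).re))) = _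
  rw [Measure.volume_eq_prod, lintegral_prod_symm _ h2.aemeasurable]
  simp only [hsplit, ENNReal.ofReal_mul (Real.exp_pos _).le]
  have h3 : ∀ y : ℝ, ∫⁻ x : ℝ,
      ENNReal.ofReal (Real.exp (-(b * (1 + w.re)) * (x + w.im * y / (1 + w.re)) ^ 2)) *
        ENNReal.ofReal (Real.exp (-(b * P / (1 + w.re)) * (y + 0) ^ 2)) =
      ENNReal.ofReal (Real.sqrt (Real.pi / (b * (1 + w.re)))) *
        ENNReal.ofReal (Real.exp (-(b * P / (1 + w.re)) * (y + 0) ^ 2)) := fun y => by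
    rw [lintegral_mul_const' _ _ ENNReal.ofReal_ne_top, lintegral_gaussian_add (by positivity)]
  simp only [h3]
  rw [lintegral_const_mul' _ _ ENNReal.ofReal_ne_top, lintegral_gaussian_add (by positivity),
    ← ENNReal.ofReal_mul (Real.sqrt_nonneg _), ← Real.sqrt_mul (by positivity)]
  congr 1
  have h4 : Real.pi / (b * (1 + w.re)) * (Real.pi / (b * P / (1 + w.re))) =
      (Real.pi / b) ^ 2 / P := by
    field_simp
  rw [h4, Real.sqrt_div (by positivity), Real.sqrt_sq (by positivity), div_div]

theorem integral_mul_one_sub_sq_rpow {s : ℝ} (hs : 0 < s) :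
    ∫ r in (0 : ℝ)..1, r * (1 - r ^ 2) ^ (s - 1) = 1 / (2 * s) := by
  have hcont : ContinuousOn (fun r : ℝ => -((1 - r ^ 2) ^ s / (2 * s))) (Icc 0 1) := by
    refine ContinuousOn.neg (ContinuousOn.div_const ?_ _)
    exact ContinuousOn.rpow_const (by fun_prop) fun x _ => Or.inr hs.le
  have hderiv : ∀ r ∈ Ioo (0 : ℝ) 1, HasDerivAt (fun r : ℝ => -((1 - r ^ 2) ^ s / (2 * s)))
      (r * (1 - r ^ 2) ^ (s - 1)) r := by
    intro r hr
    have hpos : 0 < 1 - r ^ 2 := by nlinarith [hr.1, hr.2]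
    have h1 : HasDerivAt (fun r : ℝ => 1 - r ^ 2) (-(2 * r)) r := by
      simpa using (hasDerivAt_pow 2 r).const_sub 1
    have h2 := ((h1.rpow_const (p := s) (Or.inl hpos.ne')).div_const (2 * s)).neg
    refine h2.congr_deriv ?_
    field_simp
  have hnn : ∀ r ∈ Ioo (0 : ℝ) 1, 0 ≤ r * (1 - r ^ 2) ^ (s - 1) := fun r hr =>
    mul_nonneg hr.1.le (Real.rpow_nonneg (by nlinarith [hr.1, hr.2]) _)
  -- For `s < 1` the integrand blows up at `1`; integrability comes from its being the nonnegative
  -- derivative of a continuous function.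
  have hint := intervalIntegral.integrableOn_deriv_of_nonneg hcont hderiv hnn
  rw [intervalIntegral.integral_eq_sub_of_hasDerivAt_of_le zero_le_one hcont hderiv
    ((intervalIntegrable_iff_integrableOn_Ioc_of_le zero_le_one).mpr hint)]
  simp [Real.zero_rpow hs.ne']

theorem lintegral_ball_one_sub_sq_rpow {s : ℝ} (hs : 0 < s) :
    ∫⁻ w in Metric.ball (0 : ℂ) 1, ENNReal.ofReal ((1 - ‖w‖ ^ 2) ^ (s - 1)) =
      ENNReal.ofReal (Real.pi / s) := by
  set f : ℝ → ℝ := (Iio 1).indicator fun r => (1 - r ^ 2) ^ (s - 1) with hf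
  have h1 : ∫ w : ℂ, f ‖w‖ = Real.pi / s := by
    rw [integral_fun_norm_addHaar volume f, Complex.finrank_real_complex]
    have h2 : ∫ y in Ioi (0 : ℝ), y ^ (2 - 1) • f y = 1 / (2 * s) := by
      rw [← integral_mul_one_sub_sq_rpow hs, intervalIntegral.integral_of_le zero_le_one,
        ← integral_Ioc_eq_integral_Ioo.symm, ← Ioi_inter_Iio]
      rw [← setIntegral_indicator measurableSet_Iio]
      refine integral_congr_ae (Filter.Eventually.of_forall fun r => ?_)
      by_cases hr : r ∈ Iio (1 : ℝ) <;> simp [hf, hr]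
    rw [h2, measureReal_def, Complex.volume_ball]
    simp
    field_simp
  -- A non-integrable function would have Bochner integral zero, but the value found is positive.
  have hint : Integrable fun w : ℂ => f ‖w‖ := by
    by_contra h
    rw [integral_undef h] at h1
    have : 0 < Real.pi / s := by positivity
    linarith
  have hnn : ∀ w : ℂ, 0 ≤ f ‖w‖ := fun w => by
    by_cases hw : ‖w‖ < 1
    · have : 0 ≤ 1 - ‖w‖ ^ 2 := by nlinarith [norm_nonneg w]
      simpa [hf, hw] using Real.rpow_nonneg this (s - 1)
    · simp [hf, hw]
  rw [← h1, ofReal_integral_eq_lintegral_ofReal hint (Filter.Eventually.of_forall hnn),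
    ← lintegral_indicator Metric.isOpen_ball.measurableSet]
  refine lintegral_congr fun w => ?_
  by_cases hw : ‖w‖ < 1 <;> simp [hf, hw]

theorem measurable_fockDensity (k μ : ℝ) : Measurable (fockDensity k μ) := by
  have h1 : Measurable pFun := contDiff_pFun.continuous.measurable
  have h2 : Measurable fun x : ℂ × ℂ => 2 * ‖x.1‖ ^ 2 + 2 * (x.1 ^ 2 * conj x.2).re :=
    Continuous.measurable (by fun_prop)
  unfold fockDensity
  exact ((measurable_const.mul (h1.pow_const _)).mul
    ((h2.div (h1.const_mul 2)).const_mul (-μ)).exp).mul ((h1.pow_const 3).const_div μ)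

theorem fockDensity_nonneg {k μ : ℝ} (hk : 3 / 4 < k) (hμ : 0 < μ) {x : ℂ × ℂ} (hx : x ∈ disk) :
    0 ≤ fockDensity k μ x := by
  have hP := pFun_pos hx
  have h : 0 < 4 * k - 3 := by linarith
  rw [fockDensity]
  positivity

theorem disk_eq_prod : disk = univ ×ˢ Metric.ball (0 : ℂ) 1 := by
  ext x
  simp [disk]

/-- The Gaussian integral over `z` contributes `π √P / μ`, leaving `P^(s - 1)` on the disk with `s =
2k - 3/2`. Positivity of `s` is the condition `k > 3/4`, and `Λ` is the resulting normalization. -/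
theorem fockMeasure_univ {k μ : ℝ} (hk : 3 / 4 < k) (hμ : 0 < μ) :
    fockMeasure k μ univ = 1 := by
  have hm := (measurable_fockDensity k μ).ennreal_ofReal
  rw [fockMeasure, withDensity_apply _ MeasurableSet.univ, Measure.restrict_univ, disk_eq_prod,
    Measure.volume_eq_prod, ← Measure.prod_restrict, Measure.restrict_univ,
    lintegral_prod_symm _ hm.aemeasurable]
  have hC : 0 < (4 * k - 3) / (2 * Real.pi ^ 2) := by
    have : 0 < 4 * k - 3 := by linarith
    positivity
  have h1 : ∀ w ∈ Metric.ball (0 : ℂ) 1,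
      ∫⁻ z : ℂ, ENNReal.ofReal (fockDensity k μ (z, w)) =
        ENNReal.ofReal ((4 * k - 3) / (2 * Real.pi)) *
          ENNReal.ofReal ((1 - ‖w‖ ^ 2) ^ ((2 * k - 3 / 2) - 1)) := by
    intro w hw
    have hw' : ‖w‖ < 1 := by simpa using hw
    have hP : 0 < 1 - ‖w‖ ^ 2 := by nlinarith [norm_nonneg w]
    have h2 : ∀ z : ℂ, fockDensity k μ (z, w) =
        ((4 * k - 3) / (2 * Real.pi ^ 2) * (1 - ‖w‖ ^ 2) ^ (2 * k) * (μ / (1 - ‖w‖ ^ 2) ^ 3)) *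
          Real.exp (-(μ / (1 - ‖w‖ ^ 2)) * (‖z‖ ^ 2 + (z ^ 2 * conj w).re)) := fun z => by
      rw [fockDensity]
      simp only [pFun]
      rw [mul_right_comm]
      congr 2
      field_simp
    have h3 : 0 ≤ (4 * k - 3) / (2 * Real.pi ^ 2) * (1 - ‖w‖ ^ 2) ^ (2 * k) *
        (μ / (1 - ‖w‖ ^ 2) ^ 3) := by positivity
    simp only [h2, ENNReal.ofReal_mul h3]
    rw [lintegral_const_mul' _ _ ENNReal.ofReal_ne_top,
      lintegral_gaussian_quadratic (by positivity) hw', ← ENNReal.ofReal_mul h3,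
      ← ENNReal.ofReal_mul (by have : 0 < 4 * k - 3 := by linarith
                               positivity)]
    congr 1
    have h4 : (1 - ‖w‖ ^ 2) ^ (2 * k) = (1 - ‖w‖ ^ 2) ^ (2 * k - 3 / 2 - 1) *
        ((1 - ‖w‖ ^ 2) ^ 2 * Real.sqrt (1 - ‖w‖ ^ 2)) := by
      rw [Real.sqrt_eq_rpow, ← Real.rpow_natCast (1 - ‖w‖ ^ 2) 2, ← Real.rpow_add hP,
        ← Real.rpow_add hP]
      congr 1
      push_cast
      ring
    have h5 := Real.sqrt_pos.mpr hP
    rw [h4]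
    field_simp
  rw [setLIntegral_congr_fun Metric.isOpen_ball.measurableSet h1,
    lintegral_const_mul' _ _ ENNReal.ofReal_ne_top,
    lintegral_ball_one_sub_sq_rpow (by linarith),
    ← ENNReal.ofReal_mul (by have : 0 < 4 * k - 3 := by linarith
                             positivity), ← ENNReal.ofReal_one]
  congr 1
  have : 4 * k - 3 ≠ 0 := by linarith
  have h6 : 2 * k - 3 / 2 = (4 * k - 3) / 2 := by ring
  rw [h6]
  field_simp

/-! ### Change of variables -/

section ChangeOfVariables

variable {k k' μ : ℝ} {g : JacobiGroup} {φ : ℂ × ℂ → ℂ × ℂ} {J : ℂ × ℂ → ℂ}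

/-- The Gram determinant is the determinant of the metric times the squared modulus of the
coordinate determinant; it turns invariance of the metric into a Jacobian. -/
theorem hermForm_gram (k μ : ℝ) {x : ℂ × ℂ} (hx : x ∈ disk) (X Y : ℂ × ℂ) :
    hermForm k μ x X X * hermForm k μ x Y Y - hermForm k μ x X Y * hermForm k μ x Y X =
      ((2 * k * μ / pFun x ^ 3 * ‖X.1 * Y.2 - Y.1 * X.2‖ ^ 2 : ℝ) : ℂ) := by
  have hP : (pFun x : ℂ) ≠ 0 := by exact_mod_cast (pFun_pos hx).ne'
  push_cast
  rw [← Complex.mul_conj']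
  simp only [hermForm, map_add, map_mul, map_sub, conj_conj]
  field_simp
  ring

theorem det_prod_eq (L : ℂ × ℂ →L[ℂ] ℂ × ℂ) :
    (L.restrictScalars ℝ).det =
      ‖(L (1, 0)).1 * (L (0, 1)).2 - (L (0, 1)).1 * (L (1, 0)).2‖ ^ 2 := by
  have h1 : LinearMap.det (L : ℂ × ℂ →ₗ[ℂ] ℂ × ℂ) =
      (L (1, 0)).1 * (L (0, 1)).2 - (L (0, 1)).1 * (L (1, 0)).2 := by
    rw [← LinearMap.det_toMatrix (Module.Basis.finTwoProd ℂ), Matrix.det_fin_two]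
    simp [LinearMap.toMatrix_apply]
  change LinearMap.det ((L : ℂ × ℂ →ₗ[ℂ] ℂ × ℂ).restrictScalars ℝ) = _
  rw [← h1, LinearMap.det_restrictScalars, Algebra.norm_complex_eq]
  exact Complex.normSq_eq_norm_sq _

/-- Compare the Gram determinants of the standard basis and of its image; no derivative of `φ` is
computed. -/
theorem IsAutomorphy.det_eq (hk : k = k' + 1 / 4) (hk' : 0 < k') (hμ : 0 < μ)
    (h : IsAutomorphy k μ g φ J) {x : ℂ × ℂ} (hx : x ∈ disk) :
    ((fderiv ℂ φ x).restrictScalars ℝ).det = pFun (φ x) ^ 3 / pFun x ^ 3 := by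
  have h1 := hermForm_gram k μ (h.mem hx) (fderiv ℂ φ x (1, 0)) (fderiv ℂ φ x (0, 1))
  simp only [h.hermForm_map hk hk' hμ hx] at h1
  rw [hermForm_gram k μ hx, ofReal_inj, ← det_prod_eq] at h1
  have hP := pFun_pos hx
  have hP' := pFun_pos (h.mem hx)
  have hk0 : 0 < k := by rw [hk]; positivity
  rw [eq_div_iff (by positivity)]
  field_simp at h1
  simp at h1
  linear_combination -h1

/-- The Jacobian absorbs the powers `P³`, and `1 / K` on the diagonal changes by `1 / |J|²`. -/
theorem IsAutomorphy.fockDensity_map (h : IsAutomorphy k μ g φ J) {x : ℂ × ℂ} (hx : x ∈ disk) :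
    pFun (φ x) ^ 3 / pFun x ^ 3 * fockDensity k μ (φ x) =
      fockDensity k μ x * (‖J x‖ ^ 2)⁻¹ := by
  have hP := pFun_pos hx
  have hP' := pFun_pos (h.mem hx)
  have hJ := norm_pos_iff.mpr (h.factor_ne_zero x hx)
  have h1 := h.kernel_map x hx x hx
  rw [jacobiKernel_self_eq k μ hx, jacobiKernel_self_eq k μ (h.mem hx), Complex.mul_conj',
    ← ofReal_pow, ← ofReal_mul, ofReal_inj] at h1
  rw [fockDensity_eq k μ hx, fockDensity_eq k μ (h.mem hx), Real.exp_neg, Real.exp_neg, h1]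
  have := Real.exp_pos (logNorm k μ x)
  field_simp

theorem IsAutomorphy.hasFDerivWithinAt (h : IsAutomorphy k μ g φ J) :
    ∀ x ∈ disk, HasFDerivWithinAt φ ((fderiv ℂ φ x).restrictScalars ℝ) disk x := fun _ hx =>
  ((h.differentiableOn_map.differentiableAt
    (isOpen_disk.mem_nhds hx)).hasFDerivAt.restrictScalars ℝ).hasFDerivWithinAt

theorem IsAutomorphy.image_disk (h : IsAutomorphy k μ g φ J) : φ '' disk = disk :=
  Subset.antisymm (image_subset_iff.mpr fun _ hx => h.mem hx) h.surjOn

theorem measurableSet_disk : MeasurableSet disk := isOpen_disk.measurableSet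

theorem lintegral_fockMeasure (k μ : ℝ) (f : ℂ × ℂ → ENNReal) :
    ∫⁻ x, f x ∂fockMeasure k μ = ∫⁻ x in disk, ENNReal.ofReal (fockDensity k μ x) * f x := by
  rw [fockMeasure, lintegral_withDensity_eq_lintegral_mul_non_measurable _
    (measurable_fockDensity k μ).ennreal_ofReal
    (Filter.Eventually.of_forall fun _ => ENNReal.ofReal_lt_top)]
  rfl

theorem integral_fockMeasure (hk : 3 / 4 < k) (hμ : 0 < μ) (f : ℂ × ℂ → ℂ) :
    ∫ x, f x ∂fockMeasure k μ = ∫ x in disk, fockDensity k μ x • f x := by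
  rw [fockMeasure, integral_withDensity_eq_integral_toReal_smul
    (measurable_fockDensity k μ).ennreal_ofReal
    (Filter.Eventually.of_forall fun _ => ENNReal.ofReal_lt_top)]
  refine setIntegral_congr_fun measurableSet_disk fun x hx => ?_
  simp only [ENNReal.toReal_ofReal (fockDensity_nonneg hk hμ hx)]

theorem isAddHaarMeasure_volume_prod : (volume : Measure (ℂ × ℂ)).IsAddHaarMeasure := by
  rw [Measure.volume_eq_prod]
  infer_instance

theorem IsAutomorphy.lintegral_map (hk : k = k' + 1 / 4) (hk' : 0 < k') (hμ : 0 < μ)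
    (h : IsAutomorphy k μ g φ J) (f : ℂ × ℂ → ENNReal) :
    ∫⁻ x, f x ∂fockMeasure k μ =
      ∫⁻ x, ENNReal.ofReal (‖J x‖ ^ 2)⁻¹ * f (φ x) ∂fockMeasure k μ := by
  have := isAddHaarMeasure_volume_prod
  rw [lintegral_fockMeasure, lintegral_fockMeasure]
  nth_rewrite 1 [← h.image_disk]
  rw [lintegral_image_eq_lintegral_abs_det_fderiv_mul volume measurableSet_disk
    h.hasFDerivWithinAt h.injOn]
  refine setLIntegral_congr_fun measurableSet_disk fun x hx => ?_
  have hP := pFun_pos hx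
  have hP' := pFun_pos (h.mem hx)
  rw [h.det_eq hk hk' hμ hx, abs_of_nonneg (by positivity), ← mul_assoc, ← mul_assoc,
    ← ENNReal.ofReal_mul (by positivity), h.fockDensity_map hx, ENNReal.ofReal_mul' (by positivity)]

theorem IsAutomorphy.integral_map (hk : k = k' + 1 / 4) (hk34 : 3 / 4 < k) (hμ : 0 < μ)
    (h : IsAutomorphy k μ g φ J) (f : ℂ × ℂ → ℂ) :
    ∫ x, f x ∂fockMeasure k μ =
      ∫ x, ((‖J x‖ ^ 2)⁻¹ : ℝ) • f (φ x) ∂fockMeasure k μ := by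
  have := isAddHaarMeasure_volume_prod
  rw [integral_fockMeasure hk34 hμ, integral_fockMeasure hk34 hμ]
  nth_rewrite 1 [← h.image_disk]
  rw [integral_image_eq_integral_abs_det_fderiv_smul volume measurableSet_disk
    h.hasFDerivWithinAt h.injOn]
  refine setIntegral_congr_fun measurableSet_disk fun x hx => ?_
  have hP := pFun_pos hx
  have hP' := pFun_pos (h.mem hx)
  rw [h.det_eq hk (by linarith) hμ hx, abs_of_nonneg (by positivity), smul_smul, smul_smul,
    h.fockDensity_map hx]

end ChangeOfVariables

/-! ### The mean value property -/

section MeanValue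

variable {k k' μ : ℝ}

/-- The rotations of the disk are automorphisms with trivial factor. -/
theorem exists_isAutomorphy_rotation (k μ : ℝ) (c : ℂ) (hc : ‖c‖ = 1) :
    ∃ g φ J, IsAutomorphy k μ g φ J ∧ (∀ x, φ x = (c * x.1, c ^ 2 * x.2)) ∧ ∀ x, J x = 1 := by
  have hcc : c * conj c = 1 := by rw [Complex.mul_conj', hc]; simp
  let g : SU11 := ⟨⟨!![c, 0; 0, conj c], by rw [Matrix.det_fin_two_of, hcc]; simp⟩,
    by change (0 : ℂ) = conj 0; simp, rfl⟩
  have ha : g.a = c := rfl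
  have hb : g.b = 0 := rfl
  have hc0 : conj c ≠ 0 := right_ne_zero_of_mul_eq_one hcc
  refine ⟨_, _, _, isAutomorphy_su11 g k μ, fun x => ?_, fun x => ?_⟩
  · simp only [ha, hb, map_zero, zero_mul, zero_add, add_zero]
    refine Prod.ext ?_ ?_
    · change x.1 / conj c = c * x.1
      rw [div_eq_iff hc0]
      linear_combination -x.1 * hcc
    · change c * x.2 / conj c = c ^ 2 * x.2
      rw [div_eq_iff hc0]
      linear_combination -c * x.2 * hcc
  · simp [ha, hb, hc]

theorem integral_rotation (hk : k = k' + 1 / 4) (hk34 : 3 / 4 < k) (hμ : 0 < μ) {c : ℂ}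
    (hc : ‖c‖ = 1) (f : ℂ × ℂ → ℂ) :
    ∫ x, f (c * x.1, c ^ 2 * x.2) ∂fockMeasure k μ = ∫ x, f x ∂fockMeasure k μ := by
  obtain ⟨g, φ, J, h, hφ, hJ⟩ := exists_isAutomorphy_rotation k μ c hc
  rw [h.integral_map hk hk34 hμ f]
  simp [hφ, hJ]

theorem lintegral_rotation (hk : k = k' + 1 / 4) (hk' : 0 < k') (hμ : 0 < μ) {c : ℂ}
    (hc : ‖c‖ = 1) (f : ℂ × ℂ → ENNReal) :
    ∫⁻ x, f (c * x.1, c ^ 2 * x.2) ∂fockMeasure k μ = ∫⁻ x, f x ∂fockMeasure k μ := by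
  obtain ⟨g, φ, J, h, hφ, hJ⟩ := exists_isAutomorphy_rotation k μ c hc
  rw [h.lintegral_map hk hk' hμ f]
  simp [hφ, hJ]

theorem norm_circleMap_zero_one (θ : ℝ) : ‖circleMap 0 1 θ‖ = 1 := by simp

theorem rotation_mem_disk {c : ℂ} (hc : ‖c‖ ≤ 1) {x : ℂ × ℂ} (hx : x ∈ disk) :
    (c * x.1, c ^ 2 * x.2) ∈ disk := by
  change ‖c ^ 2 * x.2‖ < 1
  have hx' : ‖x.2‖ < 1 := hx
  rw [norm_mul, norm_pow]
  have h1 : ‖c‖ ^ 2 ≤ 1 := pow_le_one₀ (norm_nonneg _) hc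
  nlinarith [norm_nonneg x.2]

/-- The one-variable mean value property of `c ↦ f (c z, c² w)`, holomorphic near the closed unit
disk. -/
theorem integral_circle_rotation {f : ℂ × ℂ → ℂ} (hf : DifferentiableOn ℂ f disk) {x : ℂ × ℂ}
    (hx : x ∈ disk) : ∫ θ in (0 : ℝ)..2 * Real.pi,
      f (circleMap 0 1 θ * x.1, circleMap 0 1 θ ^ 2 * x.2) = 2 * Real.pi * f (0, 0) := by
  have h1 : DiffContOnCl ℂ (fun c : ℂ => f (c * x.1, c ^ 2 * x.2)) (Metric.ball 0 |1|) := by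
    refine DifferentiableOn.diffContOnCl fun c hc => ?_
    rw [abs_one, closure_ball _ one_ne_zero, mem_closedBall_zero_iff] at hc
    have h2 := hf.differentiableAt (isOpen_disk.mem_nhds (rotation_mem_disk hc hx))
    exact (h2.comp c (f := fun c : ℂ => (c * x.1, c ^ 2 * x.2))
      (by fun_prop)).differentiableWithinAt
  have h3 := h1.circleAverage
  rw [Real.circleAverage_def] at h3
  have hpi : (2 * Real.pi : ℝ) ≠ 0 := by positivity
  rw [inv_smul_eq_iff₀ hpi] at h3
  rw [h3]
  simp

theorem fockMeasure_compl_disk (k μ : ℝ) : fockMeasure k μ diskᶜ = 0 := by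
  refine withDensity_absolutelyContinuous _ _ ?_
  rw [Measure.restrict_apply measurableSet_disk.compl]
  simp

theorem ae_mem_disk (k μ : ℝ) : ∀ᵐ x ∂fockMeasure k μ, x ∈ disk :=
  fockMeasure_compl_disk k μ

theorem aestronglyMeasurable_of_continuousOn {f : ℂ × ℂ → ℂ} (hf : ContinuousOn f disk) :
    AEStronglyMeasurable f (fockMeasure k μ) :=
  (hf.aestronglyMeasurable measurableSet_disk).mono_ac (withDensity_absolutelyContinuous _ _)

theorem isProbabilityMeasure_fockMeasure (hk34 : 3 / 4 < k) (hμ : 0 < μ) :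
    IsProbabilityMeasure (fockMeasure k μ) := ⟨fockMeasure_univ hk34 hμ⟩

/-- Rotations preserve the measure, so by Fubini the integrand may be replaced by its circle mean,
the constant `f (0, 0)`; the total mass is one. -/
theorem integral_holomorphic (hk : k = k' + 1 / 4) (hk34 : 3 / 4 < k) (hμ : 0 < μ)
    {f : ℂ × ℂ → ℂ} (hf : DifferentiableOn ℂ f disk) (hint : Integrable f (fockMeasure k μ)) :
    ∫ x, f x ∂fockMeasure k μ = f (0, 0) := by
  have hprob := isProbabilityMeasure_fockMeasure hk34 hμ
  set ν := fockMeasure k μ with hν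
  -- Nothing is known about `f` off the disk; the indicator is measurable everywhere, as Fubini on
  -- the product requires.
  set F := disk.indicator f with hF
  have hFm : Measurable F := by
    classical
    rw [hF, ← piecewise_eq_indicator]
    exact hf.continuousOn.measurable_piecewise continuousOn_const measurableSet_disk
  have hFf : F =ᵐ[ν] f := by
    filter_upwards [ae_mem_disk k μ] with x hx
    exact indicator_of_mem hx f
  have hFint : Integrable F ν := hint.congr hFf.symm
  set R : ℝ × (ℂ × ℂ) → ℂ × ℂ := fun p =>
    (circleMap 0 1 p.1 * p.2.1, circleMap 0 1 p.1 ^ 2 * p.2.2) with hR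
  have hRm : Measurable R := by
    have h1 : Measurable fun p : ℝ × (ℂ × ℂ) => circleMap 0 1 p.1 :=
      (continuous_circleMap 0 1).measurable.comp measurable_fst
    exact (h1.mul (measurable_fst.comp measurable_snd)).prodMk
      ((h1.pow_const 2).mul (measurable_snd.comp measurable_snd))
  set I0 : Measure ℝ := volume.restrict (Ioc 0 (2 * Real.pi)) with hI0
  have hint2 : Integrable (fun p => F (R p)) (I0.prod ν) := by
    refine ⟨(hFm.comp hRm).aestronglyMeasurable, ?_⟩
    have hm : Measurable fun p => ‖F (R p)‖ₑ := (hFm.comp hRm).enorm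
    rw [HasFiniteIntegral, lintegral_prod _ hm.aemeasurable]
    have h2 : ∀ θ : ℝ, ∫⁻ x, ‖F (R (θ, x))‖ₑ ∂ν = ∫⁻ x, ‖F x‖ₑ ∂ν := fun θ =>
      lintegral_rotation hk (by linarith) hμ (norm_circleMap_zero_one θ) fun x => ‖F x‖ₑ
    simp only [h2, lintegral_const]
    refine ENNReal.mul_lt_top hFint.2 ?_
    rw [hI0, Measure.restrict_apply_univ, Real.volume_Ioc]
    exact ENNReal.ofReal_lt_top
  have h3 := integral_integral_swap (f := fun θ x => F (R (θ, x))) hint2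
  have h4 : ∀ θ : ℝ, ∫ x, F (R (θ, x)) ∂ν = ∫ x, F x ∂ν := fun θ =>
    integral_rotation hk hk34 hμ (norm_circleMap_zero_one θ) F
  have h5 : ∀ᵐ x ∂ν, ∫ θ, F (R (θ, x)) ∂I0 = 2 * Real.pi * f (0, 0) := by
    filter_upwards [ae_mem_disk k μ] with x hx
    rw [← integral_circle_rotation hf hx, intervalIntegral.integral_of_le (by positivity)]
    refine integral_congr_ae (Filter.Eventually.of_forall fun θ => ?_)
    exact indicator_of_mem (rotation_mem_disk (norm_circleMap_zero_one θ).le hx) f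
  simp only [h4] at h3
  rw [integral_congr_ae h5] at h3
  rw [← integral_congr_ae hFf]
  simp only [integral_const, probReal_univ, one_smul] at h3
  have hvol : I0.real univ = 2 * Real.pi := by
    rw [hI0, measureReal_restrict_apply_univ, Real.volume_real_Ioc_of_le (by positivity), sub_zero]
  rw [hvol, Complex.real_smul] at h3
  push_cast at h3
  have hpi : (2 * Real.pi : ℂ) ≠ 0 := by exact_mod_cast (by positivity : (2 * Real.pi : ℝ) ≠ 0)
  exact mul_left_cancel₀ hpi h3

end MeanValue

/-! ### The reproducing kernel -/

section Reproducing

variable {k k' μ : ℝ}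

theorem jacobiKernel_zero_right (k μ : ℝ) (x : ℂ × ℂ) : jacobiKernel k μ x (0, 0) = 1 := by
  simp [jacobiKernel, diskKernel, fFun]

theorem differentiableOn_jacobiKernel (k μ : ℝ) {y : ℂ × ℂ} (hy : y ∈ disk) :
    DifferentiableOn ℂ (fun x => jacobiKernel k μ x y) disk := by
  have h2 : ∀ x ∈ disk, DifferentiableAt ℂ
      (fun x : ℂ × ℂ => Complex.exp (potential k μ (x, conjPair y))) x := fun x hx =>
    ((differentiableAt_potential k μ (den_mem_slitPlane hx hy)).comp x
      (f := fun x : ℂ × ℂ => (x, conjPair y)) (by fun_prop)).cexp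
  exact DifferentiableOn.congr (fun x hx => (h2 x hx).differentiableWithinAt)
    fun x hx => jacobiKernel_eq_exp k μ hx hy

/-- Every point of the disk is the image of the origin under an automorphism. -/
theorem exists_isAutomorphy_origin (k μ : ℝ) {y : ℂ × ℂ} (hy : y ∈ disk) :
    ∃ g φ J, IsAutomorphy k μ g φ J ∧ φ (0, 0) = y := by
  obtain ⟨g, hg⟩ := exists_smul_origin ⟨y, hy⟩
  obtain ⟨φ, J, h⟩ := exists_isAutomorphy k μ g
  exact ⟨g, φ, J, h, (h.map_eq origin).trans (by rw [hg])⟩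

theorem zero_mem_disk : ((0, 0) : ℂ × ℂ) ∈ disk := origin.2

theorem memLp_two_iff {f : ℂ × ℂ → ℂ} (hf : ContinuousOn f disk) :
    MemLp f 2 (fockMeasure k μ) ↔ ∫⁻ x, ‖f x‖ₑ ^ 2 ∂fockMeasure k μ < ⊤ := by
  rw [MemLp, eLpNorm_lt_top_iff_lintegral_rpow_enorm_lt_top two_ne_zero ENNReal.ofNat_ne_top]
  simp only [aestronglyMeasurable_of_continuousOn hf, true_and, ENNReal.toReal_ofNat,
    ENNReal.rpow_ofNat]

theorem enorm_sq_eq_ofReal (z : ℂ) : ‖z‖ₑ ^ 2 = ENNReal.ofReal (‖z‖ ^ 2) := by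
  rw [ENNReal.ofReal_pow (norm_nonneg z), ofReal_norm]

/-- Moving `y` to the origin, where the kernel is `1`, makes the transformed integrand the constant
`|J(0)|²`. -/
theorem memLp_jacobiKernel (hk : k = k' + 1 / 4) (hk' : 0 < k') (hk34 : 3 / 4 < k) (hμ : 0 < μ)
    {y : ℂ × ℂ} (hy : y ∈ disk) :
    MemLp (fun x => jacobiKernel k μ x y) 2 (fockMeasure k μ) := by
  obtain ⟨g, φ, J, h, rfl⟩ := exists_isAutomorphy_origin k μ hy
  rw [memLp_two_iff (differentiableOn_jacobiKernel k μ hy).continuousOn,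
    h.lintegral_map hk hk' hμ]
  have h1 : ∀ᵐ x ∂fockMeasure k μ, ENNReal.ofReal (‖J x‖ ^ 2)⁻¹ *
      ‖jacobiKernel k μ (φ x) (φ (0, 0))‖ₑ ^ 2 = ENNReal.ofReal (‖J (0, 0)‖ ^ 2) := by
    filter_upwards [ae_mem_disk k μ] with x hx
    have hJ := norm_pos_iff.mpr (h.factor_ne_zero x hx)
    rw [h.kernel_map x hx _ zero_mem_disk, jacobiKernel_zero_right, enorm_sq_eq_ofReal,
      ← ENNReal.ofReal_mul (by positivity), mul_one, norm_mul, Complex.norm_conj]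
    congr 1
    field_simp
  rw [lintegral_congr_ae h1, lintegral_const, fockMeasure_univ hk34 hμ, mul_one]
  exact ENNReal.ofReal_lt_top

theorem isReproducingKernel (hk : k = k' + 1 / 4) (hk' : 0 < k') (hk34 : 3 / 4 < k)
    (hμ : 0 < μ) : IsReproducingKernel disk (fockMeasure k μ) (jacobiKernel k μ) := by
  intro y hy
  refine ⟨differentiableOn_jacobiKernel k μ hy, memLp_jacobiKernel hk hk' hk34 hμ hy, ?_⟩
  intro f hf hf2
  have hprob := isProbabilityMeasure_fockMeasure hk34 hμ
  obtain ⟨g, φ, J, h, rfl⟩ := exists_isAutomorphy_origin k μ hy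
  -- The unitary pullback of `f`. After the change of variables the integrand is `J(0) q(x)`, whose
  -- mean `J(0) q(0)` is the value of `f` at `φ(0)`.
  set q : ℂ × ℂ → ℂ := fun x => (J x)⁻¹ * f (φ x) with hq
  have hqd : DifferentiableOn ℂ q disk :=
    (h.differentiableOn_factor.fun_inv h.factor_ne_zero).mul
      (hf.comp h.differentiableOn_map fun x hx => h.mem hx)
  have hq2 : MemLp q 2 (fockMeasure k μ) := by
    rw [memLp_two_iff hqd.continuousOn]
    rw [memLp_two_iff hf.continuousOn, h.lintegral_map hk hk' hμ] at hf2
    refine (lintegral_congr fun x => ?_).trans_lt hf2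
    rw [hq]
    simp only
    rw [enorm_sq_eq_ofReal, enorm_sq_eq_ofReal, ← ENNReal.ofReal_mul (by positivity), norm_mul,
      norm_inv, mul_pow, inv_pow]
  have hmean := integral_holomorphic hk hk34 hμ hqd (hq2.integrable one_le_two)
  have hJ0 := h.factor_ne_zero _ zero_mem_disk
  rw [h.integral_map hk hk34 hμ]
  have h1 : ∀ᵐ x ∂fockMeasure k μ, ((‖J x‖ ^ 2)⁻¹ : ℝ) •
      (conj (jacobiKernel k μ (φ x) (φ (0, 0))) * f (φ x)) = J (0, 0) * q x := by
    filter_upwards [ae_mem_disk k μ] with x hx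
    have hJ := h.factor_ne_zero x hx
    have hJ' : conj (J x) ≠ 0 := (map_ne_zero (starRingEnd ℂ)).mpr hJ
    rw [h.kernel_map x hx _ zero_mem_disk, jacobiKernel_zero_right, hq, Complex.real_smul]
    push_cast
    rw [← Complex.mul_conj', map_mul, map_mul, conj_conj, map_one]
    field_simp
  rw [integral_congr_ae h1, integral_const_mul, hmean, hq]
  field_simp

end Reproducing

/-! ### Reproducing kernels and coherent systems -/

section Fock

/-- One-sided version for a target family not known to be total, here the kernel functions in `L²`.
-/
theorem exists_linearIsometry_of_inner_eq {X H H' : Type*} [NormedAddCommGroup H]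
    [InnerProductSpace ℂ H] [NormedAddCommGroup H'] [InnerProductSpace ℂ H']
    [CompleteSpace H'] {e : X → H} {e' : X → H'} (h : ∀ x y, ⟪e x, e y⟫_ℂ = ⟪e' x, e' y⟫_ℂ)
    (he : (Submodule.span ℂ (range e)).topologicalClosure = ⊤) :
    ∃ u : H →ₗᵢ[ℂ] H', ∀ x, u (e x) = e' x := by
  have hd : DenseRange (Finsupp.linearCombination ℂ e) := by
    have h1 := Submodule.dense_iff_topologicalClosure_eq_top.mpr he
    rwa [← Finsupp.range_linearCombination, LinearMap.coe_range] at h1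
  have hn : ∀ c : X →₀ ℂ, ‖Finsupp.linearCombination ℂ e' c‖ =
      ‖Finsupp.linearCombination ℂ e c‖ := fun c => by
    rw [@norm_eq_sqrt_re_inner ℂ, @norm_eq_sqrt_re_inner ℂ]
    simp only [Finsupp.linearCombination_apply, Finsupp.sum, sum_inner, inner_sum,
      inner_smul_left, inner_smul_right, h]
  set v := (Finsupp.linearCombination ℂ e').extendOfNorm (Finsupp.linearCombination ℂ e) with hv
  have hve : ∀ c, v (Finsupp.linearCombination ℂ e c) = Finsupp.linearCombination ℂ e' c :=
    fun c => LinearMap.extendOfNorm_eq hd ⟨1, fun c => by simp [hn c]⟩ c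
  refine ⟨⟨v, fun x => ?_⟩, fun x => ?_⟩
  · refine hd.induction (P := fun x => ‖v x‖ = ‖x‖) ?_
      (isClosed_eq (by fun_prop) continuous_norm) x
    rintro _ ⟨c, rfl⟩
    simpa [hve] using hn c
  · have h2 := hve (Finsupp.single x 1)
    simpa using h2

variable {E H : Type*} [NormedAddCommGroup H] [InnerProductSpace ℂ H] {M : Set E} {K : E → E → ℂ}
  {e : E → H}

theorem IsCoherentSystem.span_range (he : IsCoherentSystem M K e) :
    (Submodule.span ℂ (range fun x : M => e x)).topologicalClosure = ⊤ := by
  rw [← he.2, image_eq_range]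

variable [MeasurableSpace E] {ν : Measure E}

/-- On the span this is linearity. In the limit, an `L²`-convergent sequence has an almost
everywhere convergent subsequence, while the inner products converge pointwise. -/
theorem ae_eq_inner_of_isCoherentSystem (hM : ∀ᵐ x ∂ν, x ∈ M)
    (he : IsCoherentSystem M K e) {u : H →ₗᵢ[ℂ] Lp ℂ 2 ν}
    (hu : ∀ y ∈ M, u (e y) =ᵐ[ν] fun x => K x y) (ψ : H) :
    u ψ =ᵐ[ν] fun x => ⟪e x, ψ⟫_ℂ := by
  have hspan : ∀ ψ ∈ Submodule.span ℂ (e '' M), u ψ =ᵐ[ν] fun x => ⟪e x, ψ⟫_ℂ := by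
    intro ψ hψ
    induction hψ using Submodule.span_induction with
    | mem v hv =>
      obtain ⟨y, hy, rfl⟩ := hv
      filter_upwards [hu y hy, hM] with x h1 h2
      rw [h1, he.1 x h2 y hy]
    | zero =>
      rw [map_zero]
      filter_upwards [Lp.coeFn_zero ℂ 2 ν] with x hx
      simpa using hx
    | add v w _ _ hv hw =>
      rw [map_add]
      filter_upwards [Lp.coeFn_add (u v) (u w), hv, hw] with x h1 h2 h3
      rw [h1, Pi.add_apply, h2, h3, inner_add_right]
    | smul c v _ hv =>
      rw [map_smul]
      filter_upwards [Lp.coeFn_smul c (u v), hv] with x h1 h2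
      rw [h1, Pi.smul_apply, h2, inner_smul_right, smul_eq_mul]
  have hcl : ψ ∈ closure (Submodule.span ℂ (e '' M) : Set H) := by
    rw [← Submodule.topologicalClosure_coe, he.2]
    trivial
  obtain ⟨s, hs, hlim⟩ := mem_closure_iff_seq_limit.mp hcl
  have h1 : Filter.Tendsto (fun n => u (s n)) Filter.atTop (nhds (u ψ)) :=
    (u.continuous.tendsto ψ).comp hlim
  obtain ⟨ns, hns, h2⟩ := (tendstoInMeasure_of_tendsto_Lp h1).exists_seq_tendsto_ae
  have h3 : ∀ᵐ x ∂ν, ∀ n, u (s n) x = ⟪e x, s n⟫_ℂ :=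
    ae_all_iff.mpr fun n => hspan _ (hs n)
  filter_upwards [h2, h3] with x h4 h5
  simp only [h5] at h4
  refine tendsto_nhds_unique h4 ?_
  exact tendsto_const_nhds.inner (hlim.comp hns.tendsto_atTop)

variable [NormedAddCommGroup E] [NormedSpace ℂ E]

theorem IsReproducingKernel.inner_toLp (hK : IsReproducingKernel M ν K) {y : E} (hy : y ∈ M)
    {f : Lp ℂ 2 ν} {φ : E → ℂ} (hφ : DifferentiableOn ℂ φ M) (hf : f =ᵐ[ν] φ) :
    ⟪(hK y hy).2.1.toLp _, f⟫_ℂ = φ y := by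
  rw [(hK y hy).2.2 φ hφ ((memLp_congr_ae hf).mp (Lp.memLp f)), L2.inner_def]
  refine integral_congr_ae ?_
  filter_upwards [hf, (hK y hy).2.1.coeFn_toLp] with x h1 h2
  rw [h1, h2, RCLike.inner_apply, mul_comm]

variable [CompleteSpace H]

/-- The coherent vectors of a reproducing kernel give a realization as a space of holomorphic
functions. -/
theorem isFockRealization_of_differentiableOn (hM : ∀ᵐ x ∂ν, x ∈ M)
    (hK : IsReproducingKernel M ν K) (he : IsCoherentSystem M K e)
    (hd : ∀ ψ : H, DifferentiableOn ℂ (fun x => ⟪e x, ψ⟫_ℂ) M) : IsFockRealization M ν e := by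
  obtain ⟨u, hu⟩ := exists_linearIsometry_of_inner_eq (e := fun x : M => e x)
    (e' := fun x : M => (hK x x.2).2.1.toLp _)
    (fun x y => by
      rw [he.1 x x.2 y y.2]
      exact (hK.inner_toLp x.2 (hK y y.2).1 (hK y y.2).2.1.coeFn_toLp).symm) he.span_range
  have hu' : ∀ y ∈ M, u (e y) =ᵐ[ν] fun x => K x y := fun y hy => by
    have h1 : u (e y) = (hK y hy).2.1.toLp _ := hu ⟨y, hy⟩
    rw [h1]
    exact (hK y hy).2.1.coeFn_toLp
  have hae := ae_eq_inner_of_isCoherentSystem hM he hu'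
  have hmem : ∀ ψ, u ψ ∈ holomorphicL2 M ν := fun ψ => ⟨_, hd ψ, hae ψ⟩
  let v : H →ₗᵢ[ℂ] holomorphicL2 M ν := ⟨u.toLinearMap.codRestrict _ hmem, u.norm_map⟩
  have hsurj : Function.Surjective v := by
    rintro ⟨f, φ, hφ, hf⟩
    -- The preimage is the adjoint applied to `f`: `(e x, u* f) = (u (e x), f)` is the value at `x`
    -- of the holomorphic representative.
    refine ⟨ContinuousLinearMap.adjoint u.toContinuousLinearMap f, Subtype.ext ?_⟩
    refine Lp.ext ((hae _).trans (Filter.EventuallyEq.trans ?_ hf.symm))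
    filter_upwards [hM] with x hx
    rw [ContinuousLinearMap.adjoint_inner_right, ← hK.inner_toLp hx hφ hf, ← hu ⟨x, hx⟩]
    rfl
  exact ⟨LinearIsometryEquiv.ofSurjective v hsurj, fun ψ => ⟨hd ψ, hae ψ⟩⟩

theorem IsFockRealization.isComplete (h : IsFockRealization M ν e) :
    IsComplete (holomorphicL2 M ν : Set (Lp ℂ 2 ν)) := by
  obtain ⟨u, -⟩ := h
  rw [← completeSpace_coe_iff_isComplete]
  exact (completeSpace_congr (e := u.toEquiv) u.isometry.isUniformEmbedding).mp inferInstance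

theorem IsFockRealization.of_isCoherentSystem {H' : Type*} [NormedAddCommGroup H']
    [InnerProductSpace ℂ H'] [CompleteSpace H'] {e' : E → H'} (h : IsFockRealization M ν e)
    (hM : ∀ᵐ x ∂ν, x ∈ M) (he : IsCoherentSystem M K e) (he' : IsCoherentSystem M K e') :
    IsFockRealization M ν e' := by
  obtain ⟨u, hu⟩ := h
  obtain ⟨v, hv⟩ := exists_linearIsometryEquiv_of_inner_eq (e := fun x : M => e' x)
    (e' := fun x : M => e x) (fun x y => by rw [he.1 x x.2 y y.2, he'.1 x x.2 y y.2])
    he'.span_range he.span_range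
  have h1 : ∀ x ∈ M, ∀ ψ, ⟪e x, v ψ⟫_ℂ = ⟪e' x, ψ⟫_ℂ := fun x hx ψ => by
    rw [← v.inner_map_map (e' x) ψ]
    exact congrArg (fun w => ⟪w, v ψ⟫_ℂ) (hv ⟨x, hx⟩).symm
  refine ⟨v.trans u, fun ψ => ⟨(hu (v ψ)).1.congr fun x hx => (h1 x hx ψ).symm,
    (hu (v ψ)).2.trans ?_⟩⟩
  filter_upwards [hM] with x hx
  exact h1 x hx ψ

end Fock

/-! ### The Fock space of the Siegel-Jacobi disk -/

section FockDisk

variable {ι : Type*} (σ : ι ≃ ℕ × ℕ) {k k' μ : ℝ}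

/-- Conjugation moves to the fixed vector, so that `x` enters holomorphically; the evaluation
functions are then holomorphic. -/
theorem inner_kernelMap_conjPair (hk' : 0 < k') (hμ : 0 < μ) {x : ℂ × ℂ} (hx : x ∈ disk)
    (c : lp (fun _ : ι => ℂ) 2) :
    ⟪kernelMap σ k' μ (conjPair x), c⟫_ℂ = ⟪star c, kernelMap σ k' μ x⟫_ℂ := by
  refine (lp.hasSum_inner (kernelMap σ k' μ (conjPair x)) c).unique ?_
  refine (lp.hasSum_inner (star c) (kernelMap σ k' μ x)).congr_fun fun i => ?_
  rw [kernelMap_apply σ hk' hμ hx, kernelMap_apply σ hk' hμ (conjPair_mem_disk.mpr hx),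
    ← conj_jacobiBasis, lp.star_apply, RCLike.inner_apply, RCLike.inner_apply, conj_conj,
    RCLike.star_def, conj_conj, mul_comm]

theorem isFockRealization_kernelMap (hk : k = k' + 1 / 4) (hk' : 0 < k') (hk34 : 3 / 4 < k)
    (hμ : 0 < μ) : IsFockRealization disk (fockMeasure k μ)
      fun x => kernelMap σ k' μ (conjPair x) := by
  have hprob := isProbabilityMeasure_fockMeasure hk34 hμ
  refine isFockRealization_of_differentiableOn (ae_mem_disk k μ)
    (isReproducingKernel hk hk' hk34 hμ) (isCoherentSystem_kernelMap σ hk hk' hμ) fun c => ?_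
  exact ((innerSL ℂ (star c)).differentiable.comp_differentiableOn
    (differentiableOn_kernelMap σ hk' hμ)).congr
      fun x hx => inner_kernelMap_conjPair σ hk' hμ hx c

/-- The basis is the image of the unit vectors of `ℓ²` under the Fock realization; evaluating at `x`
picks out the coordinate `f_{nk'm}(x)`. -/
theorem exists_hilbertBasis (hk : k = k' + 1 / 4) (hk' : 0 < k') (hk34 : 3 / 4 < k)
    (hμ : 0 < μ) : ∃ B : HilbertBasis (ℕ × ℕ) ℂ (holomorphicL2 disk (fockMeasure k μ)),
      ∀ n m, ((B (n, m) : Lp ℂ 2 (fockMeasure k μ)) : ℂ × ℂ → ℂ) =ᵐ[fockMeasure k μ]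
        jacobiBasis k' μ n m := by
  classical
  obtain ⟨u, hu⟩ := isFockRealization_kernelMap (Equiv.refl (ℕ × ℕ)) hk hk' hk34 hμ
  refine ⟨HilbertBasis.ofRepr u.symm, fun n m => ?_⟩
  have h1 : (HilbertBasis.ofRepr u.symm) (n, m) =
      u (lp.single 2 (n, m) (1 : ℂ) : lp (fun _ : ℕ × ℕ => ℂ) 2) := by
    rw [← HilbertBasis.repr_symm_single]
    rfl
  rw [h1]
  refine (hu _).2.trans ?_
  filter_upwards [ae_mem_disk k μ] with x hx
  rw [lp.inner_single_right, kernelMap_apply _ hk' hμ (conjPair_mem_disk.mpr hx),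
    ← conj_jacobiBasis, RCLike.inner_apply, conj_conj, one_mul]
  rfl

end FockDisk

/-! ### The normalized kernel, the Berezin kernel and the diastasis -/

section Normalized

variable {k μ : ℝ}

theorem diskKernel_self (k : ℝ) {w : ℂ} (hw : ‖w‖ < 1) :
    diskKernel k w w = (Real.exp (-(2 * k) * Real.log (1 - ‖w‖ ^ 2)) : ℝ) := by
  have hP : 0 < 1 - ‖w‖ ^ 2 := by nlinarith [norm_nonneg w]
  have h1 : 1 - w * conj w = ((1 - ‖w‖ ^ 2 : ℝ) : ℂ) := by
    rw [Complex.mul_conj']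
    push_cast
    rfl
  rw [diskKernel, h1, ← ofReal_neg, ← ofReal_cpow hP.le, Real.rpow_def_of_pos hP, mul_comm]

theorem re_one_sub_mul_conj_pos {w w' : ℂ} (hw : ‖w‖ < 1) (hw' : ‖w'‖ < 1) :
    0 < (1 - w * conj w').re := by
  have h := den_re_pos (x := (0, w)) (y := (0, conj w')) hw (by simpa using hw')
  simpa only [den] using h

theorem normalizedKernel_diskKernel (k : ℝ) {w w' : ℂ} (hw : ‖w‖ < 1) (hw' : ‖w'‖ < 1) :
    normalizedKernel (diskKernel k) w w' =
      (((1 - ‖w‖ ^ 2) * (1 - ‖w'‖ ^ 2) : ℝ) / (1 - w * conj w') ^ 2 : ℂ) ^ (k : ℂ) := by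
  have hP : 0 < 1 - ‖w‖ ^ 2 := by nlinarith [norm_nonneg w]
  have hP' : 0 < 1 - ‖w'‖ ^ 2 := by nlinarith [norm_nonneg w']
  have hre := re_one_sub_mul_conj_pos hw hw'
  have hd : 1 - w * conj w' ≠ 0 := fun h => by simp [h] at hre
  set d := 1 - w * conj w' with hdef
  set L := Real.log (1 - ‖w‖ ^ 2) + Real.log (1 - ‖w'‖ ^ 2) with hL
  have hpq : (1 - ‖w‖ ^ 2) * (1 - ‖w'‖ ^ 2) = Real.exp L := by
    rw [hL, Real.exp_add, Real.exp_log hP, Real.exp_log hP']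
  have hexp : (((1 - ‖w‖ ^ 2) * (1 - ‖w'‖ ^ 2) : ℝ) / d ^ 2 : ℂ) =
      Complex.exp (L - 2 * log d) := by
    rw [hpq, Complex.exp_sub, ofReal_exp, two_mul, Complex.exp_add, exp_log hd, sq]
  have him := abs_lt.mp (abs_im_log_lt hre)
  -- `d` has positive real part, so `2 log d` has imaginary part below `π` in modulus and the
  -- principal branch is respected.
  have hlog : log (((1 - ‖w‖ ^ 2) * (1 - ‖w'‖ ^ 2) : ℝ) / d ^ 2 : ℂ) = L - 2 * log d := by
    rw [hexp]
    refine log_exp ?_ ?_ <;>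
    · simp only [sub_im, ofReal_im, mul_im, re_ofNat, im_ofNat, zero_mul, add_zero]
      linarith [him.1, him.2]
  have hsqrt : Real.sqrt ((diskKernel k w w).re * (diskKernel k w' w').re) =
      Real.exp (-k * L) := by
    rw [diskKernel_self k hw, diskKernel_self k hw', ofReal_re, ofReal_re, ← Real.exp_add,
      Real.sqrt_eq_iff_mul_self_eq (Real.exp_pos _).le (Real.exp_pos _).le, ← Real.exp_add]
    congr 1
    ring
  have hne : (((1 - ‖w‖ ^ 2) * (1 - ‖w'‖ ^ 2) : ℝ) / d ^ 2 : ℂ) ≠ 0 := by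
    rw [hexp]
    exact Complex.exp_ne_zero _
  rw [normalizedKernel, hsqrt, cpow_def_of_ne_zero hne, hlog, diskKernel, ← hdef,
    cpow_def_of_ne_zero hd, ofReal_exp, ← Complex.exp_sub]
  congr 1
  push_cast
  ring

theorem normalizedKernel_jacobiKernel (k μ : ℝ) {x y : ℂ × ℂ} (hx : x ∈ disk) (hy : y ∈ disk) :
    normalizedKernel (jacobiKernel k μ) x y =
      normalizedKernel (diskKernel k) x.2 y.2 *
        Complex.exp (μ * (fFun x y - (fFun x x + fFun y y) / 2)) := by
  have hF : ∀ x, fFun x x = ((fFun x x).re : ℂ) := fun x => by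
    rw [fFun_self, ofReal_re]
  have hself : ∀ {x}, x ∈ disk → (jacobiKernel k μ x x).re =
      (diskKernel k x.2 x.2).re * Real.exp (μ * (fFun x x).re) := fun {x} hx => by
    rw [jacobiKernel, diskKernel_self k hx, hF, ofReal_re, ← ofReal_mul, ← ofReal_exp,
      ← ofReal_mul, ofReal_re, ofReal_re]
  have hsqrt : Real.sqrt (Real.exp (μ * (fFun x x).re) * Real.exp (μ * (fFun y y).re)) =
      Real.exp (μ * ((fFun x x).re + (fFun y y).re) / 2) := by
    rw [← Real.exp_add, Real.sqrt_eq_iff_mul_self_eq (Real.exp_pos _).le (Real.exp_pos _).le,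
      ← Real.exp_add]
    congr 1
    ring
  have hnn : 0 ≤ (diskKernel k x.2 x.2).re * (diskKernel k y.2 y.2).re := by
    rw [diskKernel_self k hx, diskKernel_self k hy, ofReal_re, ofReal_re]
    positivity
  rw [normalizedKernel, normalizedKernel, hself hx, hself hy, mul_mul_mul_comm, Real.sqrt_mul hnn,
    hsqrt, jacobiKernel, ofReal_mul, mul_div_mul_comm, ofReal_exp, ← Complex.exp_sub]
  congr 2
  rw [hF x, hF y]
  push_cast
  simp only [ofReal_re]
  ring

theorem berezinKernel_jacobiKernel (k μ : ℝ) {x y : ℂ × ℂ} (hx : x ∈ disk) (hy : y ∈ disk) :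
    berezinKernel (jacobiKernel k μ) x y =
      berezinKernel (diskKernel k) x.2 y.2 *
        Real.exp (μ * (2 * (fFun x y).re - (fFun x x).re - (fFun y y).re)) := by
  rw [berezinKernel, berezinKernel, normalizedKernel_jacobiKernel k μ hx hy, norm_mul, mul_pow,
    Complex.norm_exp, ← Real.exp_nat_mul]
  congr 2
  rw [re_ofReal_mul]
  simp only [sub_re, add_re, div_ofNat_re]
  push_cast
  ring

theorem log_berezinKernel_diskKernel (k : ℝ) {w w' : ℂ} (hw : ‖w‖ < 1) (hw' : ‖w'‖ < 1) :
    0 < berezinKernel (diskKernel k) w w' ∧ Real.log (berezinKernel (diskKernel k) w w') =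
      -(2 * k * Real.log (‖1 - w * conj w'‖ ^ 2 / ((1 - ‖w‖ ^ 2) * (1 - ‖w'‖ ^ 2)))) := by
  have hP : 0 < 1 - ‖w‖ ^ 2 := by nlinarith [norm_nonneg w]
  have hP' : 0 < 1 - ‖w'‖ ^ 2 := by nlinarith [norm_nonneg w']
  have hre := re_one_sub_mul_conj_pos hw hw'
  have hd : 0 < ‖1 - w * conj w'‖ := norm_pos_iff.mpr fun h => by simp [h] at hre
  have hq : 0 < (1 - ‖w‖ ^ 2) * (1 - ‖w'‖ ^ 2) / ‖1 - w * conj w'‖ ^ 2 := by positivity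
  have h1 : ‖normalizedKernel (diskKernel k) w w'‖ =
      ((1 - ‖w‖ ^ 2) * (1 - ‖w'‖ ^ 2) / ‖1 - w * conj w'‖ ^ 2) ^ k := by
    rw [normalizedKernel_diskKernel k hw hw', norm_cpow_real, norm_div, norm_pow,
      Complex.norm_of_nonneg (by positivity)]
  rw [berezinKernel, h1]
  refine ⟨by positivity, ?_⟩
  rw [Real.log_pow, Real.log_rpow hq, ← inv_div, Real.log_inv]
  push_cast
  ring

theorem diastasis_jacobiKernel (k μ : ℝ) {x y : ℂ × ℂ} (hx : x ∈ disk) (hy : y ∈ disk) :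
    diastasis (jacobiKernel k μ) x y / 2 =
      k * Real.log (‖1 - x.2 * conj y.2‖ ^ 2 / ((1 - ‖x.2‖ ^ 2) * (1 - ‖y.2‖ ^ 2))) +
        μ * (((fFun x x).re + (fFun y y).re) / 2 - (fFun x y).re) := by
  obtain ⟨h1, h2⟩ := log_berezinKernel_diskKernel k (w := x.2) (w' := y.2) hx hy
  rw [diastasis, berezinKernel_jacobiKernel k μ hx hy, Real.log_mul h1.ne' (Real.exp_pos _).ne',
    h2, Real.log_exp]
  ring

end Normalized

end SiegelJacobi

end

theorem proposition2 (k k' μ : ℝ) (hk : k = k' + 1 / 4) (hk' : 0 < k') (hμ : 0 < μ) :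
    -- CS-group, CS-manifold, quantizable
    IsCSManifold JacobiGroup disk (omega k μ) ∧
    IsQuantizable disk (jacobiKernel k μ) (omega k μ) ∧
    -- the kernel function is given by the base functions
    (∀ x ∈ disk, ∀ y ∈ disk,
      HasSum (fun p : ℕ × ℕ => jacobiBasis k' μ p.1 p.2 x * conj (jacobiBasis k' μ p.1 p.2 y))
        (jacobiKernel k μ x y)) ∧
    -- the Fock space
    (3 / 4 < k →
      (∀ x ∈ disk, (fockDensity k μ x : ℂ) =
        ((4 * k - 3) / (2 * Real.pi ^ 2) / (2 * k) : ℝ) *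
          volumeDensity k μ x / jacobiKernel k μ x x) ∧
      IsComplete (holomorphicL2 disk (fockMeasure k μ) : Set (Lp ℂ 2 (fockMeasure k μ))) ∧
      (∃ B : HilbertBasis (ℕ × ℕ) ℂ (holomorphicL2 disk (fockMeasure k μ)), ∀ n m,
        ((B (n, m) : Lp ℂ 2 (fockMeasure k μ)) : ℂ × ℂ → ℂ) =ᵐ[fockMeasure k μ]
          jacobiBasis k' μ n m) ∧
      IsReproducingKernel disk (fockMeasure k μ) (jacobiKernel k μ) ∧
      ∀ (H : Type*) [NormedAddCommGroup H] [InnerProductSpace ℂ H] [CompleteSpace H]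
        (e : ℂ × ℂ → H), IsCoherentSystem disk (jacobiKernel k μ) e →
          IsFockRealization disk (fockMeasure k μ) e) ∧
    -- the embedding by the base functions, in any order
    (∀ σ : ℕ ≃ ℕ × ℕ, ∃ (Φ : disk → ell2) (hΦ : ∀ x, Φ x ≠ 0),
      (∀ x N, Φ x N = jacobiBasis k' μ (σ N).1 (σ N).2 x) ∧
      IsCSEmbedding JacobiGroup (omega k μ) (fun x => Projectivization.mk ℂ (Φ x) (hΦ x))) ∧
    -- the normalized Bergman kernel
    (∀ w w' : ℂ, ‖w‖ < 1 → ‖w'‖ < 1 →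
      normalizedKernel (diskKernel k) w w' =
        (((1 - ‖w‖ ^ 2) * (1 - ‖w'‖ ^ 2) : ℝ) / (1 - w * conj w') ^ 2 : ℂ) ^ (k : ℂ)) ∧
    (∀ x ∈ disk, ∀ y ∈ disk,
      normalizedKernel (jacobiKernel k μ) x y =
        normalizedKernel (diskKernel k) x.2 y.2 *
          Complex.exp (μ * (fFun x y - (fFun x x + fFun y y) / 2))) ∧
    -- the Berezin kernel
    (∀ x ∈ disk, ∀ y ∈ disk,
      berezinKernel (jacobiKernel k μ) x y =
        berezinKernel (diskKernel k) x.2 y.2 *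
          Real.exp (μ * (2 * (fFun x y).re - (fFun x x).re - (fFun y y).re))) ∧
    -- the diastasis
    (∀ x ∈ disk, ∀ y ∈ disk,
      diastasis (jacobiKernel k μ) x y / 2 =
        k * Real.log (‖1 - x.2 * conj y.2‖ ^ 2 / ((1 - ‖x.2‖ ^ 2) * (1 - ‖y.2‖ ^ 2))) +
          μ * (((fFun x x).re + (fFun y y).re) / 2 - (fFun x y).re)) := by
  have hk0 : 0 < k := by
    rw [hk]
    positivity
  refine ⟨isCSManifold hk hk' hμ, isQuantizable_omega k μ,
    fun x hx y hy => hasSum_jacobiKernel hk hk' hμ hx hy, fun hk34 => ?_, fun σ => ?_,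
    fun w w' hw hw' => normalizedKernel_diskKernel k hw hw',
    fun x hx y hy => normalizedKernel_jacobiKernel k μ hx hy,
    fun x hx y hy => berezinKernel_jacobiKernel k μ hx hy,
    fun x hx y hy => diastasis_jacobiKernel k μ hx hy⟩
  · have hF := isFockRealization_kernelMap (Equiv.refl (ℕ × ℕ)) hk hk' hk34 hμ
    exact ⟨fun x hx => fockDensity_eq_volumeDensity hk0 μ hx, hF.isComplete,
      exists_hilbertBasis hk hk' hk34 hμ, isReproducingKernel hk hk' hk34 hμ,
      fun H _ _ _ e he => hF.of_isCoherentSystem (ae_mem_disk k μ)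
        (isCoherentSystem_kernelMap (Equiv.refl (ℕ × ℕ)) hk hk' hμ) he⟩
  · exact ⟨fun x => kernelMap σ k' μ x, fun x => kernelMap_ne_zero σ hk' hμ x.2,
      fun x N => kernelMap_apply σ hk' hμ x.2 N, isCSEmbedding_kernelPoint σ hk hk' hμ⟩
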